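/- Let $(\mathbb X,\mathcal X)$ be a standard Borel space and let $(X_n)_{n\ge1}$ be a sequence of $\mathbb X$-valued random variables on a probability space $(\Omega,\mathcal H,\mathbb P)$. Terminology. The sequence is a measure-valued Pólya sequence (MVPS) with parameters $\theta>0$, a probability measure $\nu$ on $\mathbb X$ and a finite transition kernel $R$ on $\mathbb X$ (i.e. $R_x(\mathbb X)<\infty$ for all $x$) if $X_1\sim\nu$ and, for all $n\ge1$ and $A\in\mathcal X$, $$\mathbb P(X_{n+1}\in A\mid X_1,\dots,X_n)=\frac{\theta\nu(A)+\sum_{i=1}^nR_{X_i}(A)}{\theta+\sum_{i=1}^nR_{X_i}(\mathbb X)}\quad\text{a.s.}$$ It has strictly positive reinforcement if $\nu(\{x:R_x(\mathbb X)=0\})=0$. It is exchangeable if, for each $n$, the law of $(X_1,\dots,X_n)$ is invariant under permutations of the coordinates. A sub-$\sigma$-algebra $\mathcal G\subseteq\mathcal X$ is countably generated under $\nu$ if there is $C\in\mathcal G$ with $\nu(C)=1$ such that the trace $\mathcal G\cap C$ is countably generated. For a probability measure $\mu$ on a measurable space $(\Pi,\mathcal P)$, $\mathrm{DP}(\theta,\mu)$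 (the Dirichlet process) is the law of the random measure $\sum_{j\ge1}V_j\delta_{U_j}$, where $V_j=W_j\prod_{i<j}(1-W_i)$, the $W_i$ are i.i.d. $\mathrm{Beta}(1,\theta)$, and the $U_j$ are i.i.d. with law $\mu$ and independent of $(W_i)_{i\ge1}$; laws of random measures are taken on the $\sigma$-algebra generated by the evaluations $m\mapsto m(A)$, $A\in\mathcal P$. Theorem. The sequence $(X_n)_{n\ge1}$ is an exchangeable MVPS with strictly positive reinforcement (for some parameters $\theta,\nu,R$) if and only if there exist $\theta>0$, a probability measure $\nu$ on $\mathbb X$, a measurable space $(\Pi,\mathcal P)$ and a measurable map $\pi:\mathbb X\to\Pi$, with image measure $\nu_\pi=\nu\circ\pi^{-1}$, such that $\{q\}\in\mathcal P$ for $\nu_\pi$-almost every $q\in\Pi$, the $\sigma$-algebra $\sigma(\pi)$ is countably generated under $\nu$, and there exist $\Pi$-valued random variables $(\tilde p_n)_{n\ge1}$ and a random probability measure $\tilde Q$ on $\Pi$, all defined on $\Omega$, such that (a) conditionally on $\tilde Q$ and $(\tilde p_n)_{n\ge1}$, the variables $X_1,X_2,\dots$ are independent, and $X_n$ has law $\nu(\cdot\mid\pi=\tilde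 p_n)$, where $q\mapsto\nu(\cdot\mid\pi=q)$ is the regular conditional distribution of $\nu$ given $\pi$; (b) conditionally on $\tilde Q$, the variables $\tilde p_1,\tilde p_2,\dots$ are i.i.d. with law $\tilde Q$; (c) $\tilde Q\sim\mathrm{DP}(\theta,\nu_\pi)$. -/

import Mathlib

open MeasureTheory ProbabilityTheory
open scoped ENNReal

universe u v w

noncomputable section

/-- A sequence of random variables is exchangeable if, for every `n`, the law of its first `n`
terms is invariant under all permutations of these terms. -/
def IsExchangeable {Ω : Type u} {E : Type w} [MeasurableSpace Ω] [MeasurableSpace E]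
    (P : Measure Ω) (X : ℕ → Ω → E) : Prop :=
  ∀ (n : ℕ) (σ : Equiv.Perm (Fin n)),
    P.map (fun ω (i : Fin n) => X (σ i) ω) = P.map (fun ω (i : Fin n) => X i ω)

/-- `X 0, X 1, …` is a measure-valued Pólya sequence with parameters `θ`, `ν` and `R`: here
`θ > 0`, `ν` is a probability measure and `R` is a finite transition kernel, that is, every `R x`
has finite total mass (no uniform bound is imposed). The first observation is `X 0`. -/
structure IsMVPS {Ω : Type u} {E : Type w} [MeasurableSpace Ω] [MeasurableSpace E]
    (P : Measure Ω) (X : ℕ → Ω → E) (θ : ℝ) (ν : Measure E) (R : Kernel E E) : Prop where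
  theta_pos : 0 < θ
  isProbabilityMeasure : IsProbabilityMeasure ν
  finite_kernel : ∀ x, IsFiniteMeasure (R x)
  /-- The initial law is `ν`. -/
  map_zero : P.map (X 0) = ν
  /-- The predictive law given the first `n + 1` observations. -/
  predictive : ∀ (n : ℕ) (A : Set E), MeasurableSet A →
    P⟦X (n + 1) ⁻¹' A |
        MeasurableSpace.comap (fun ω (i : Fin (n + 1)) => X i ω) inferInstance⟧
      =ᵐ[P] fun ω =>
        (θ * ν.real A + ∑ i : Fin (n + 1), (R (X i ω)).real A) /
          (θ + ∑ i : Fin (n + 1), (R (X i ω)).real Set.univ)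

/-- The stick-breaking weights `V j = W j * ∏ i < j, (1 - W i)`. -/
def stickWeight (W : ℕ → ℝ) (j : ℕ) : ℝ :=
  W j * ∏ i ∈ Finset.range j, (1 - W i)

/-- The measure `∑ j, V j • δ_{U j}`, where `V` are the stick-breaking weights of `W`. -/
def stickBreaking {S : Type v} [MeasurableSpace S] (z : (ℕ → ℝ) × (ℕ → S)) : Measure S :=
  Measure.sum fun j => ENNReal.ofReal (stickWeight z.1 j) • Measure.dirac (z.2 j)

theorem measurable_stickBreaking {S : Type v} [MeasurableSpace S] :
    Measurable (stickBreaking (S := S)) := by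
  refine Measure.measurable_of_measurable_coe _ fun A hA => ?_
  have h : (fun z : (ℕ → ℝ) × (ℕ → S) => stickBreaking z A) = fun z =>
      ∑' j, ENNReal.ofReal (stickWeight z.1 j) * A.indicator 1 (z.2 j) := by
    funext z
    simp [stickBreaking, Measure.sum_apply _ hA, Measure.dirac_apply' _ hA]
  rw [h]
  refine Measurable.tsum fun j => ?_
  refine Measurable.mul ?_ ?_
  · unfold stickWeight
    fun_prop
  · exact (measurable_one.indicator hA).comp ((measurable_pi_apply j).comp measurable_snd)

/-- The Dirichlet process `DP(θ, μ)` with concentration `θ > 0` and base probability measure `μ`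
on an arbitrary measurable space, as a law on the space of measures (with the σ-algebra generated
by the evaluations): the law of `∑ j, V j • δ_{U j}`, where `V` are the stick-breaking weights of
i.i.d. `Beta(1, θ)` variables and, independently, `U` is i.i.d. with law `μ`. -/
def dirichletProcess {S : Type v} [MeasurableSpace S] (θ : ℝ) (μ : Measure S) :
    Measure (Measure S) :=
  ((Measure.infinitePi fun _ : ℕ => betaMeasure 1 θ).prod
    (Measure.infinitePi fun _ : ℕ => μ)).map stickBreaking

/-- A sub-σ-algebra `G` is countably generated under `ν` if its trace on some `C ∈ G` with
`ν C = 1` is countably generated. -/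
def IsCGUnder {E : Type w} [MeasurableSpace E] (ν : Measure E) (G : MeasurableSpace E) : Prop :=
  ∃ C : Set E, MeasurableSet[G] C ∧ ν C = 1 ∧
    @MeasurableSpace.CountablyGenerated C (G.comap Subtype.val)

/-- Conditionally on the σ-algebra `m`, the variables `Y 0, Y 1, …` are independent, and `Y i` has
the (random) law `η i`. -/
def CondIndepWithLaw {Ω : Type u} {S : Type v} [MeasurableSpace Ω] [MeasurableSpace S]
    (P : Measure Ω) (m : MeasurableSpace Ω) (Y : ℕ → Ω → S) (η : ℕ → Ω → Measure S) : Prop :=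
  ∀ (n : ℕ) (A : ℕ → Set S), (∀ i, MeasurableSet (A i)) →
    P⟦⋂ i ∈ Finset.range n, Y i ⁻¹' A i | m⟧
      =ᵐ[P] fun ω => ∏ i ∈ Finset.range n, (η i ω).real (A i)

/-- The hierarchical model
`X n ∣ p n, Q ∼ ν(· ∣ π = p n)` independently, `p n ∣ Q ∼ Q` i.i.d., `Q ∼ DP(θ, ν ∘ π⁻¹)`.
Here `Q` is a random probability measure on the parameter space `T`, and `condDistrib id π ν` is the kernel
`p ↦ ν(· ∣ π = p)`. -/
structure IsDPHierarchy {Ω : Type u} {E : Type w} {T : Type v}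
    [MeasurableSpace Ω] [MeasurableSpace E] [StandardBorelSpace E] [Nonempty E]
    [MeasurableSpace T] (P : Measure Ω) (X : ℕ → Ω → E) (θ : ℝ) (ν : Measure E)
    [IsProbabilityMeasure ν] (π : E → T) (p : ℕ → Ω → T) (Q : Kernel Ω T) : Prop where
  isMarkovKernel : IsMarkovKernel Q
  measurable_latent : ∀ n, Measurable (p n)
  obs_law : CondIndepWithLaw P
    (MeasurableSpace.comap (fun ω => Q ω) inferInstance ⊔
      MeasurableSpace.comap (fun ω n => p n ω) inferInstance)
    X (fun n ω => condDistrib id π ν (p n ω))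
  latent_law : CondIndepWithLaw P
    (MeasurableSpace.comap (fun ω => Q ω) inferInstance) p (fun _ ω => Q ω)
  prior_law : P.map (fun ω => Q ω) = dirichletProcess θ (ν.map π)

end

/-!
The theorem identifies exchangeable measure-valued Pólya sequences with Dirichlet process mixtures
whose components are the conditional laws `ν(· ∣ π = q)`. Both directions rest on the fact that the
Dirichlet process `DP(θ, μ)` is the mixing measure of the Blackwell–MacQueen urn started from `θμ`.
This is proved through mixed moments. The stick-breaking series is a mixture
`w δ_x + (1 - w) M` of its first atom and an independent copy `M` of itself, with `w ∼ Beta(1, θ)`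
and `x ∼ μ`; the moments of the urn satisfy the same fixed-point equation, since the copies of the
first draw `x` follow a two-colour Pólya urn (`polyaMoment_add_atom`). The equation has only one
solution because `E[(1 - w) ^ n] < 1` (`dirichletMoment_eq_polyaMoment`). Hence samples from the
Dirichlet process obey the predictive rule of the urn (`dirichletProcess_predictive`).

*From the hierarchical model to the Pólya sequence.* Given the random measure, the observations are
i.i.d., hence exchangeable. Integrating the predictive rule of the latent variables against
`ν(· ∣ π = q)`, and using `π(X_n) = p_n`, gives the predictive rule of the observations, with
`R_x = ν(· ∣ π = π(x))` (`IsDPHierarchy.isExchangeable`, `IsDPHierarchy.isMVPS`).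

*From the Pólya sequence to the hierarchical model.* By exchangeability two successive draws may be
swapped in the urns `θν`, `θν + R_x` and `θν + R_x + R_y`, for almost all `x`, `y`
(`IsUrnSequence.symmetricDraws`).

The first step is to see that the total mass `f(x) = R_x(E)` is almost surely constant, unless `R_x`
is always a multiple of `ν` and the sequence is i.i.d. (`SymmetricDraws.ae_const_or_ae_eq_smul`).
If `f` is not constant, its values have a gap. Swapping the draws in an urn `N`, tested against
`1_A(y) 1_B(z) / (f(z) - f(y))` with `A` below and `B` above the gap, expresses `N(A) N(B)` by
simpler terms, and the second difference in the directions `R_x`, `R_y` is a functional equation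
which forces `R_x(A) / f(x)` or `R_x(B) / f(x)` to be constant
(`ae_const_or_ae_const_of_symm_mul`). So `R_x` is proportional to `ν` on one side of the gap, and
then everywhere. In both cases the sequence is also an urn sequence with a Markov kernel as
reinforcement (`IsMVPS.exists_markov`).

For a Markov kernel, exchangeability of the draws means that `R` is reversible with respect to `ν`
and that `R_x R = R_x`. The variance of `y ↦ R_y(A)` under `R_x` then vanishes, so that `R_y = R_x`
for `R_x`-almost every `y` (`ae_ae_kernel_eq`), and `R_x` is the conditional law of `ν` given the
map `π` whose coordinates are the masses `R_x(A_n)` of a countable generating π-system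
(`exists_statistic`, `ae_condDistrib_id_eq`). The predictive laws are invariant under `R`, so all
observations may be resampled from `R` independently (`IsUrnSequence.lintegral_resample`), which is
the conditional law of the observations given the latent variables `p_n = π(X_n)`. The sequence
`π(X_n)` is a Blackwell–MacQueen urn (`IsUrnSequence.lintegral_prod_statistic`), hence a mixture of
i.i.d. sequences directed by the Dirichlet process, and by the law of large numbers the directing
measure is a function of the sequence (`exists_mixing_kernel`). It can therefore be defined on the
given probability space, and conditioning on it adds nothing to conditioning on the `π(X_n)`.
-/

noncomputable section

/-! ### Normalised measures and the moments of the Blackwell–MacQueen urn -/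

section PolyaMoments

variable {S : Type v} [MeasurableSpace S]

/-- Normalisation `m ↦ (m univ)⁻¹ • m` as a kernel from the space of all measures. By the
conventions of `ℝ≥0∞` it sends measures of infinite mass to `0`, so it is a finite kernel. -/
def normalizeKernel (S : Type v) [MeasurableSpace S] : Kernel (Measure S) S where
  toFun m := (m Set.univ)⁻¹ • m
  measurable' := by
    refine Measure.measurable_of_measurable_coe _ fun A hA => ?_
    simp only [Measure.smul_apply, smul_eq_mul]
    exact (Measure.measurable_coe MeasurableSet.univ).inv.mul (Measure.measurable_coe hA)

theorem normalizeKernel_apply (m : Measure S) : normalizeKernel S m = (m Set.univ)⁻¹ • m := rfl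

instance isFiniteKernel_normalizeKernel : IsFiniteKernel (normalizeKernel S) :=
  ⟨1, ENNReal.one_lt_top, fun m => by
    rw [normalizeKernel_apply, Measure.smul_apply, smul_eq_mul]
    exact ENNReal.inv_mul_le_one _⟩

theorem isProbabilityMeasure_normalizeKernel {m : Measure S} (h0 : m Set.univ ≠ 0)
    (h1 : m Set.univ ≠ ∞) : IsProbabilityMeasure (normalizeKernel S m) :=
  ⟨by rw [normalizeKernel_apply, Measure.smul_apply, smul_eq_mul, ENNReal.inv_mul_cancel h0 h1]⟩

theorem normalizeKernel_smul {c : ℝ≥0∞} (h0 : c ≠ 0) (h1 : c ≠ ∞) (m : Measure S) :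
    normalizeKernel S (c • m) = normalizeKernel S m := by
  simp only [normalizeKernel_apply, Measure.smul_apply, smul_eq_mul, smul_smul]
  rw [ENNReal.mul_inv (Or.inl h0) (Or.inl h1), mul_right_comm, ENNReal.inv_mul_cancel h0 h1,
    one_mul]

theorem normalizeKernel_of_isProbabilityMeasure (m : Measure S) [IsProbabilityMeasure m] :
    normalizeKernel S m = m := by
  simp [normalizeKernel_apply]

@[fun_prop]
theorem Measurable.measure_add {Z : Type*} [MeasurableSpace Z] {f g : Z → Measure S}
    (hf : Measurable f) (hg : Measurable g) : Measurable fun z => f z + g z := by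
  refine Measure.measurable_of_measurable_coe _ fun A hA => ?_
  simp only [Measure.add_apply]
  exact ((Measure.measurable_coe hA).comp hf).add ((Measure.measurable_coe hA).comp hg)

theorem Measurable.lintegral_normalizeKernel {Z : Type*} [MeasurableSpace Z] {a : Z → Measure S}
    (ha : Measurable a) {φ : Z → S → ℝ≥0∞} (hφ : Measurable (Function.uncurry φ)) :
    Measurable fun z => ∫⁻ y, φ z y ∂(normalizeKernel S (a z)) := by
  have := Measurable.lintegral_kernel_prod_right (κ := (normalizeKernel S).comap a ha) hφ
  simpa using this

/-- The mixed moments `E[g₁(Y₁) ⋯ gₙ(Yₙ)]` of the Blackwell–MacQueen urn with initial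
composition `m`, computed from the front: `Y₁` is drawn from the normalised composition and
`δ_{Y₁}` is added to it. -/
def polyaMoment : List (S → ℝ≥0∞) → Measure S → ℝ≥0∞
  | [], _ => 1
  | g :: l, m => ∫⁻ y, g y * polyaMoment l (m + Measure.dirac y) ∂(normalizeKernel S m)

theorem measurable_polyaMoment {l : List (S → ℝ≥0∞)} (hl : ∀ g ∈ l, Measurable g) :
    Measurable (polyaMoment l) := by
  induction l with
  | nil => exact measurable_const
  | cons g l ih =>
    have hg : Measurable g := hl g (by simp)
    have ih' := ih fun g hg => hl g (by simp [hg])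
    simp only [polyaMoment]
    exact Measurable.lintegral_normalizeKernel measurable_id
      ((hg.comp measurable_snd).mul (ih'.comp
        (measurable_fst.measure_add (Measure.measurable_dirac.comp measurable_snd))))

theorem lintegral_normalizeKernel (m : Measure S) (φ : S → ℝ≥0∞) :
    ∫⁻ y, φ y ∂(normalizeKernel S m) = (m Set.univ)⁻¹ * ∫⁻ y, φ y ∂m := by
  rw [normalizeKernel_apply, lintegral_smul_measure, smul_eq_mul]

theorem add_dirac_ne_zero (m : Measure S) (y : S) : m + Measure.dirac y ≠ 0 := fun h => by
  have h' := congrArg (fun n : Measure S => n Set.univ) h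
  simp at h'

theorem add_dirac_univ (m : Measure S) (y : S) :
    (m + Measure.dirac y) Set.univ = m Set.univ + 1 := by
  simp

/-- The first two draws of the Blackwell–MacQueen urn are exchangeable. -/
theorem lintegral_two_draws_swap (m : Measure S) [IsFiniteMeasure m] {φ : S → S → ℝ≥0∞}
    (hφ : Measurable (Function.uncurry φ)) :
    ∫⁻ y, ∫⁻ z, φ y z ∂(normalizeKernel S (m + Measure.dirac y)) ∂(normalizeKernel S m)
      = ∫⁻ y, ∫⁻ z, φ z y ∂(normalizeKernel S (m + Measure.dirac y)) ∂(normalizeKernel S m) := by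
  have key : ∀ ψ : S → S → ℝ≥0∞, Measurable (Function.uncurry ψ) →
      ∫⁻ y, ∫⁻ z, ψ y z ∂(normalizeKernel S (m + Measure.dirac y)) ∂(normalizeKernel S m)
      = (m Set.univ)⁻¹ * ((m Set.univ + 1)⁻¹ *
        (∫⁻ y, ∫⁻ z, ψ y z ∂m ∂m + ∫⁻ y, ψ y y ∂m)) := by
    intro ψ hψ
    simp only [lintegral_normalizeKernel, add_dirac_univ]
    have h2 : Measurable fun y => ∫⁻ z, ψ y z ∂m := hψ.lintegral_prod_right
    have h3 : Measurable fun y => ψ y y := hψ.comp (measurable_id.prodMk measurable_id)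
    have h4 : ∀ y, ∫⁻ z, ψ y z ∂(m + Measure.dirac y) = ∫⁻ z, ψ y z ∂m + ψ y y := by
      intro y
      rw [lintegral_add_measure, lintegral_dirac' y hψ.of_uncurry_left]
    simp only [h4]
    rw [lintegral_const_mul _ (h2.fun_add h3), lintegral_add_left h2]
  rw [key φ hφ, key (fun y z => φ z y) (hφ.comp measurable_swap),
    lintegral_lintegral_swap hφ.aemeasurable]

/-- Stationarity: dropping the first draw does not change the law of the urn sequence. -/
theorem polyaMoment_one_cons {l : List (S → ℝ≥0∞)} (hl : ∀ g ∈ l, Measurable g)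
    (m : Measure S) [IsFiniteMeasure m] (hm : m ≠ 0) :
    polyaMoment ((fun _ => 1) :: l) m = polyaMoment l m := by
  induction l generalizing m with
  | nil =>
    simp only [polyaMoment, mul_one, lintegral_const, one_mul]
    have := isProbabilityMeasure_normalizeKernel (m := m) (by simpa using hm) (measure_ne_top _ _)
    simp
  | cons g l ih =>
    have hg : Measurable g := hl g (by simp)
    have hl' : ∀ g ∈ l, Measurable g := fun g hg => hl g (by simp [hg])
    have hb := measurable_polyaMoment hl'
    have hmeas : Measurable fun q : S × S =>
        g q.2 * polyaMoment l (m + Measure.dirac q.1 + Measure.dirac q.2) :=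
      (hg.comp measurable_snd).mul (hb.comp
        ((measurable_const.measure_add (Measure.measurable_dirac.comp measurable_fst)).measure_add
          (Measure.measurable_dirac.comp measurable_snd)))
    calc polyaMoment ((fun _ => 1) :: g :: l) m
        = ∫⁻ y, ∫⁻ z, g z * polyaMoment l (m + Measure.dirac y + Measure.dirac z)
            ∂(normalizeKernel S (m + Measure.dirac y)) ∂(normalizeKernel S m) := by
          simp only [polyaMoment, one_mul]
      _ = ∫⁻ y, ∫⁻ z, g y * polyaMoment l (m + Measure.dirac z + Measure.dirac y)
            ∂(normalizeKernel S (m + Measure.dirac y)) ∂(normalizeKernel S m) :=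
          lintegral_two_draws_swap m hmeas
      _ = ∫⁻ y, g y * polyaMoment ((fun _ => 1) :: l) (m + Measure.dirac y)
            ∂(normalizeKernel S m) := by
          refine lintegral_congr fun y => ?_
          simp only [polyaMoment, one_mul]
          rw [lintegral_const_mul]
          · simp only [add_right_comm m (Measure.dirac y)]
          · exact hb.comp ((measurable_const.measure_add Measure.measurable_dirac).measure_add
              measurable_const)
      _ = polyaMoment (g :: l) m := by
          simp only [polyaMoment]
          refine lintegral_congr fun y => ?_
          have hne := add_dirac_ne_zero m y
          have := ih hl' (m + Measure.dirac y) hne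
          simp only [polyaMoment] at this
          rw [this]

/-- The predictive rule of the Blackwell–MacQueen urn: given the first draws, the next one comes
from the initial composition or repeats one of them. The draws are indexed by a list `l` without
repetitions. -/
theorem polyaMoment_append {I : Type*} [DecidableEq I] {l : List I} (hnd : l.Nodup)
    {g : I → S → ℝ≥0∞} (hg : ∀ i, Measurable (g i)) {h : S → ℝ≥0∞} (hh : Measurable h)
    (m : Measure S) [IsFiniteMeasure m] (hm : m ≠ 0) :
    (m Set.univ + l.length) * polyaMoment (l.map g ++ [h]) m
      = (∫⁻ y, h y ∂m) * polyaMoment (l.map g) m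
        + (l.map fun k =>
            polyaMoment (l.map (Function.update g k fun y => g k y * h y)) m).sum := by
  induction l generalizing m with
  | nil =>
    simp only [List.length_nil, Nat.cast_zero, add_zero, List.map_nil, List.nil_append,
      polyaMoment, mul_one, List.sum_nil, lintegral_normalizeKernel]
    rw [← mul_assoc, ENNReal.mul_inv_cancel (by simpa using hm) (measure_ne_top _ _), one_mul]
  | cons i l ih =>
    have hi : i ∉ l := (List.nodup_cons.1 hnd).1
    have hl := (List.nodup_cons.1 hnd).2
    have hupd : ∀ k j, Measurable (Function.update g k (fun y => g k y * h y) j) := by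
      intro k j
      by_cases hjk : j = k
      · subst hjk
        simpa using! (hg j).mul hh
      · simpa [hjk] using hg j
    have hM : ∀ (g' : I → S → ℝ≥0∞), (∀ j, Measurable (g' j)) →
        Measurable fun y => polyaMoment (l.map g') (m + Measure.dirac y) := by
      intro g' hg'
      refine (measurable_polyaMoment ?_).comp
        (measurable_const.measure_add Measure.measurable_dirac)
      simp only [List.mem_map]
      rintro _ ⟨j, _, rfl⟩
      exact hg' j
    have hstep : ∀ y, (m Set.univ + ((i :: l).length : ℕ)) *
        (g i y * polyaMoment (l.map g ++ [h]) (m + Measure.dirac y))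
        = (∫⁻ y, h y ∂m) * (g i y * polyaMoment (l.map g) (m + Measure.dirac y))
          + ((g i y * h y) * polyaMoment (l.map g) (m + Measure.dirac y)
          + (l.map fun k => g i y * polyaMoment
            (l.map (Function.update g k fun y => g k y * h y)) (m + Measure.dirac y)).sum) := by
      intro y
      have hne := add_dirac_ne_zero m y
      have := ih hl (m + Measure.dirac y) hne
      rw [add_dirac_univ, lintegral_add_measure, lintegral_dirac' y hh] at this
      rw [List.sum_map_mul_left]
      have e : m Set.univ + ((i :: l).length : ℕ) = m Set.univ + 1 + (l.length : ℕ) := by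
        simp only [List.length_cons, Nat.cast_add, Nat.cast_one]
        ring
      rw [e, mul_left_comm, this]
      ring
    have hsum : ∀ (L : List I), Measurable fun y => (L.map fun k => g i y * polyaMoment
        (l.map (Function.update g k fun y => g k y * h y)) (m + Measure.dirac y)).sum := by
      intro L
      induction L with
      | nil => simp
      | cons k L ihL =>
        simp only [List.map_cons, List.sum_cons]
        exact ((hg i).mul (hM _ (hupd k))).add ihL
    have hsumint : ∀ (L : List I), ∫⁻ y, (L.map fun k => g i y * polyaMoment
        (l.map (Function.update g k fun y => g k y * h y)) (m + Measure.dirac y)).sum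
          ∂(normalizeKernel S m) = (L.map fun k => ∫⁻ y, g i y * polyaMoment
        (l.map (Function.update g k fun y => g k y * h y)) (m + Measure.dirac y)
          ∂(normalizeKernel S m)).sum := by
      intro L
      induction L with
      | nil => simp
      | cons k L ihL =>
        simp only [List.map_cons, List.sum_cons]
        rw [lintegral_add_left ((hg i).fun_mul (hM _ (hupd k))), ihL]
    simp only [List.map_cons, List.cons_append, polyaMoment, List.sum_cons]
    rw [← lintegral_const_mul, lintegral_congr hstep, lintegral_add_left, lintegral_add_left,
      lintegral_const_mul, hsumint]
    · have e1 : l.map (Function.update g i fun y => g i y * h y) = l.map g :=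
        List.map_congr_left fun j hj => Function.update_of_ne (fun e : j = i => hi (e ▸ hj)) _ _
      have e2 : (l.map fun k => ∫⁻ y, g i y * polyaMoment
          (l.map (Function.update g k fun y => g k y * h y)) (m + Measure.dirac y)
            ∂(normalizeKernel S) m)
          = l.map fun k => ∫⁻ y, Function.update g k (fun y => g k y * h y) i y * polyaMoment
          (l.map (Function.update g k fun y => g k y * h y)) (m + Measure.dirac y)
            ∂(normalizeKernel S) m := by
        refine List.map_congr_left fun k hk => ?_
        rw [Function.update_of_ne (fun e : i = k => hi (e ▸ hk))]
      rw [e1, e2, Function.update_self]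
    · exact (hg i).fun_mul (hM g hg)
    · exact ((hg i).fun_mul hh).fun_mul (hM g hg)
    · exact ((hg i).fun_mul (hM g hg)).const_mul _
    · refine (hg i).fun_mul ((measurable_polyaMoment ?_).comp
        (measurable_const.measure_add Measure.measurable_dirac))
      simp only [List.mem_append, List.mem_map, List.mem_singleton]
      rintro _ (⟨j, _, rfl⟩ | rfl)
      · exact hg j
      · exact hh

end PolyaMoments

/-! ### Size-biasing of beta distributions -/

section Beta

theorem measurable_betaPDF (a b : ℝ) : Measurable (betaPDF a b) :=
  (measurable_betaPDFReal a b).ennreal_ofReal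

theorem betaMeasure_ae_mem_Ioo (a b : ℝ) : ∀ᵐ w ∂(betaMeasure a b), 0 < w ∧ w < 1 := by
  rw [betaMeasure, ae_withDensity_iff (measurable_betaPDF a b)]
  refine Filter.Eventually.of_forall fun w hw => ?_
  by_contra h
  exact hw (by simp [betaPDF_eq, h])

theorem beta_add_one_left {a b : ℝ} (ha : 0 < a) (hb : 0 < b) :
    beta (a + 1) b = a / (a + b) * beta a b := by
  rw [beta, beta, add_right_comm a 1 b, Real.Gamma_add_one ha.ne',
    Real.Gamma_add_one (add_pos ha hb).ne']
  have := (Real.Gamma_pos_of_pos (add_pos ha hb)).ne'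
  field_simp

theorem beta_comm' (a b : ℝ) : beta a b = beta b a := by
  rw [beta, beta, mul_comm, add_comm]

theorem beta_add_one_right {a b : ℝ} (ha : 0 < a) (hb : 0 < b) :
    beta a (b + 1) = b / (a + b) * beta a b := by
  rw [beta_comm', beta_add_one_left hb ha, beta_comm' b a, add_comm b a]

theorem ofReal_mul_betaPDF {a b : ℝ} (ha : 0 < a) (hb : 0 < b) (w : ℝ) :
    ENNReal.ofReal w * betaPDF a b w = ENNReal.ofReal (a / (a + b)) * betaPDF (a + 1) b w := by
  by_cases hw : 0 < w ∧ w < 1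
  · rw [betaPDF_of_pos_lt_one hw.1 hw.2, betaPDF_of_pos_lt_one hw.1 hw.2,
      ← ENNReal.ofReal_mul hw.1.le, ← ENNReal.ofReal_mul (by positivity), beta_add_one_left ha hb,
      add_sub_cancel_right]
    congr 1
    have h1 : w ^ a = w ^ (a - 1) * w := by
      rw [Real.rpow_sub_one hw.1.ne', div_mul_cancel₀ _ hw.1.ne']
    have := (beta_pos ha hb).ne'
    rw [h1]
    field_simp
  · simp [betaPDF_eq, hw]

theorem ofReal_one_sub_mul_betaPDF {a b : ℝ} (ha : 0 < a) (hb : 0 < b) (w : ℝ) :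
    ENNReal.ofReal (1 - w) * betaPDF a b w
      = ENNReal.ofReal (b / (a + b)) * betaPDF a (b + 1) w := by
  by_cases hw : 0 < w ∧ w < 1
  · have hw' : 0 < 1 - w := sub_pos.2 hw.2
    rw [betaPDF_of_pos_lt_one hw.1 hw.2, betaPDF_of_pos_lt_one hw.1 hw.2,
      ← ENNReal.ofReal_mul hw'.le, ← ENNReal.ofReal_mul (by positivity), beta_add_one_right ha hb,
      add_sub_cancel_right]
    congr 1
    have h1 : (1 - w) ^ b = (1 - w) ^ (b - 1) * (1 - w) := by
      rw [Real.rpow_sub_one hw'.ne', div_mul_cancel₀ _ hw'.ne']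
    have := (beta_pos ha hb).ne'
    rw [h1]
    field_simp
  · simp [betaPDF_eq, hw]

theorem lintegral_betaMeasure (a b : ℝ) {h : ℝ → ℝ≥0∞} (hh : Measurable h) :
    ∫⁻ w, h w ∂(betaMeasure a b) = ∫⁻ w, betaPDF a b w * h w :=
  lintegral_withDensity_eq_lintegral_mul _ (measurable_betaPDF a b) hh

/-- Size-biasing: `w · Beta(a, b)(dw) = a / (a + b) · Beta(a + 1, b)(dw)`. -/
theorem lintegral_betaMeasure_mul {a b : ℝ} (ha : 0 < a) (hb : 0 < b) {h : ℝ → ℝ≥0∞}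
    (hh : Measurable h) :
    ∫⁻ w, ENNReal.ofReal w * h w ∂(betaMeasure a b)
      = ENNReal.ofReal (a / (a + b)) * ∫⁻ w, h w ∂(betaMeasure (a + 1) b) := by
  rw [lintegral_betaMeasure _ _ (ENNReal.measurable_ofReal.fun_mul hh),
    lintegral_betaMeasure _ _ hh, ← lintegral_const_mul _
      ((measurable_betaPDF _ _).fun_mul hh)]
  refine lintegral_congr fun w => ?_
  rw [← mul_assoc, mul_comm (betaPDF a b w), ofReal_mul_betaPDF ha hb, mul_assoc]

/-- Size-biasing: `(1 - w) · Beta(a, b)(dw) = b / (a + b) · Beta(a, b + 1)(dw)`. -/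
theorem lintegral_betaMeasure_one_sub_mul {a b : ℝ} (ha : 0 < a) (hb : 0 < b) {h : ℝ → ℝ≥0∞}
    (hh : Measurable h) :
    ∫⁻ w, ENNReal.ofReal (1 - w) * h w ∂(betaMeasure a b)
      = ENNReal.ofReal (b / (a + b)) * ∫⁻ w, h w ∂(betaMeasure a (b + 1)) := by
  have h1 : Measurable fun w : ℝ => ENNReal.ofReal (1 - w) := by fun_prop
  rw [lintegral_betaMeasure _ _ (h1.fun_mul hh),
    lintegral_betaMeasure _ _ hh, ← lintegral_const_mul _
      ((measurable_betaPDF _ _).fun_mul hh)]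
  refine lintegral_congr fun w => ?_
  rw [← mul_assoc, mul_comm (betaPDF a b w), ofReal_one_sub_mul_betaPDF ha hb, mul_assoc]

end Beta

/-! ### Splitting off one atom -/

section MixMoment

variable {S : Type v} [MeasurableSpace S]

/-- If `β` gives the mixed moments of a random measure `M`, then `mixMoment β w x acc l` is the
expectation of `∏ g ∈ acc, M(g)` times `∏ g ∈ l, (w δ_x + (1 - w) M)(g)`. -/
def mixMoment (β : List (S → ℝ≥0∞) → ℝ≥0∞) (w : ℝ) (x : S) :
    List (S → ℝ≥0∞) → List (S → ℝ≥0∞) → ℝ≥0∞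
  | acc, [] => β acc
  | acc, g :: l => ENNReal.ofReal w * g x * mixMoment β w x acc l
      + ENNReal.ofReal (1 - w) * mixMoment β w x (acc ++ [g]) l

theorem measurable_mixMoment {Z : Type*} [MeasurableSpace Z]
    {β : Z → List (S → ℝ≥0∞) → ℝ≥0∞}
    (hβ : ∀ acc, (∀ g ∈ acc, Measurable g) → Measurable fun z => β z acc)
    {w : Z → ℝ} (hw : Measurable w) {x : Z → S} (hx : Measurable x)
    {acc l : List (S → ℝ≥0∞)} (hacc : ∀ g ∈ acc, Measurable g) (hl : ∀ g ∈ l, Measurable g) :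
    Measurable fun z => mixMoment (β z) (w z) (x z) acc l := by
  induction l generalizing acc with
  | nil => exact hβ acc hacc
  | cons g l ih =>
    have hg : Measurable g := hl g (by simp)
    have hl' : ∀ g ∈ l, Measurable g := fun g hg => hl g (by simp [hg])
    have hacc' : ∀ g' ∈ acc ++ [g], Measurable g' := by
      simp only [List.mem_append, List.mem_singleton]
      rintro g' (h | rfl)
      · exact hacc g' h
      · exact hg
    simp only [mixMoment]
    exact ((hw.ennreal_ofReal.mul (hg.comp hx)).mul (ih hacc hl')).add
      ((measurable_const.sub hw).ennreal_ofReal.mul (ih hacc' hl'))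

theorem mixMoment_lintegral {Z : Type*} [MeasurableSpace Z] (ρ : Measure Z)
    {β : Z → List (S → ℝ≥0∞) → ℝ≥0∞}
    (hβ : ∀ acc, (∀ g ∈ acc, Measurable g) → Measurable fun z => β z acc) (w : ℝ) (x : S)
    {acc l : List (S → ℝ≥0∞)} (hacc : ∀ g ∈ acc, Measurable g) (hl : ∀ g ∈ l, Measurable g) :
    mixMoment (fun acc => ∫⁻ z, β z acc ∂ρ) w x acc l = ∫⁻ z, mixMoment (β z) w x acc l ∂ρ := by
  induction l generalizing acc with
  | nil => rfl
  | cons g l ih =>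
    have hg : Measurable g := hl g (by simp)
    have hl' : ∀ g ∈ l, Measurable g := fun g hg => hl g (by simp [hg])
    have hacc' : ∀ g' ∈ acc ++ [g], Measurable g' := by
      simp only [List.mem_append, List.mem_singleton]
      rintro g' (h | rfl)
      · exact hacc g' h
      · exact hg
    simp only [mixMoment]
    have m1 := measurable_mixMoment hβ (measurable_const (a := w)) (measurable_const (a := x))
      hacc hl'
    have m2 := measurable_mixMoment hβ (measurable_const (a := w)) (measurable_const (a := x))
      hacc' hl'
    rw [ih hacc hl', ih hacc' hl', lintegral_add_left (m1.const_mul _),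
      lintegral_const_mul _ m1, lintegral_const_mul _ m2]

/-- If the first factor is assigned to the urn, then it is the first draw `y`, and the remaining
factors see the urn reinforced by `δ_y`. -/
theorem mixMoment_polyaMoment_cons (m : Measure S) (w : ℝ) (x : S) {g : S → ℝ≥0∞}
    (hg : Measurable g) {acc l : List (S → ℝ≥0∞)} (hacc : ∀ g ∈ acc, Measurable g)
    (hl : ∀ g ∈ l, Measurable g) :
    mixMoment (fun l => polyaMoment l m) w x (g :: acc) l
      = ∫⁻ y, g y * mixMoment (fun l => polyaMoment l (m + Measure.dirac y)) w x acc l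
          ∂(normalizeKernel S m) := by
  induction l generalizing acc with
  | nil => rfl
  | cons h l ih =>
    have hh : Measurable h := hl h (by simp)
    have hl' : ∀ g ∈ l, Measurable g := fun g hg => hl g (by simp [hg])
    have hacc' : ∀ g' ∈ acc ++ [h], Measurable g' := by
      simp only [List.mem_append, List.mem_singleton]
      rintro g' (h | rfl)
      · exact hacc g' h
      · exact hh
    have hβ : ∀ acc, (∀ g ∈ acc, Measurable g) →
        Measurable fun y : S => polyaMoment acc (m + Measure.dirac y) := fun acc h =>
      (measurable_polyaMoment h).comp (measurable_const.measure_add Measure.measurable_dirac)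
    have m1 := measurable_mixMoment hβ (measurable_const (a := w)) (measurable_const (a := x))
      hacc hl'
    have m2 := measurable_mixMoment hβ (measurable_const (a := w)) (measurable_const (a := x))
      hacc' hl'
    simp only [mixMoment, List.cons_append]
    rw [ih hacc hl', ih hacc' hl', ← lintegral_const_mul _ (hg.fun_mul m1),
      ← lintegral_const_mul _ (hg.fun_mul m2), ← lintegral_add_left ((hg.fun_mul m1).const_mul _)]
    refine lintegral_congr fun y => ?_
    ring

/-- The urn that starts with `k` extra copies of the colour `x` behaves like the mixture
`w δ_x + (1 - w) M` of that colour and the original urn `M`, with weight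
`w ∼ Beta(k, θ)`: a classical two-colour Pólya urn governs the draws of the extra copies. -/
theorem polyaMoment_add_atom {l : List (S → ℝ≥0∞)} (hl : ∀ g ∈ l, Measurable g) (x : S)
    {θ : ℝ} (hθ : 0 < θ) (m : Measure S) (hm : m Set.univ = ENNReal.ofReal θ) {k : ℕ}
    (hk : 0 < k) :
    polyaMoment l (m + (k : ℝ≥0∞) • Measure.dirac x)
      = ∫⁻ w, mixMoment (fun l => polyaMoment l m) w x [] l ∂(betaMeasure k θ) := by
  induction l generalizing θ m k with
  | nil =>
    have := isProbabilityMeasureBeta (α := k) (β := θ) (by exact_mod_cast hk) hθ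
    simp [polyaMoment, mixMoment]
  | cons g l ih =>
    have hg : Measurable g := hl g (by simp)
    have hl' : ∀ g ∈ l, Measurable g := fun g hg => hl g (by simp [hg])
    have hk' : (0 : ℝ) < k := by exact_mod_cast hk
    have : IsFiniteMeasure m := ⟨by simp [hm]⟩
    have hβ : ∀ acc, (∀ g ∈ acc, Measurable g) →
        Measurable fun y : S => polyaMoment acc (m + Measure.dirac y) := fun acc h =>
      (measurable_polyaMoment h).comp (measurable_const.measure_add Measure.measurable_dirac)
    have mw : Measurable fun w => mixMoment (fun l => polyaMoment l m) w x [] l :=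
      measurable_mixMoment (β := fun _ l => polyaMoment l m) (acc := [])
        (fun _ _ => measurable_const) measurable_id measurable_const (by simp) hl'
    have mwg : Measurable fun w => mixMoment (fun l => polyaMoment l m) w x [g] l :=
      measurable_mixMoment (β := fun _ l => polyaMoment l m) (acc := [g])
        (fun _ _ => measurable_const) measurable_id measurable_const (by simpa using hg) hl'
    have mwy : Measurable fun q : ℝ × S =>
        g q.2 * mixMoment (fun l => polyaMoment l (m + Measure.dirac q.2)) q.1 x [] l :=
      (hg.comp measurable_snd).mul (measurable_mixMoment (acc := [])
        (fun acc h => (hβ acc h).comp measurable_snd) measurable_fst measurable_const (by simp) hl')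
    have hprob := isProbabilityMeasureBeta (α := k) (β := θ + 1) hk' (by linarith)
    -- The first draw is either one of the `k` copies of `x`, which leads to `Beta(k + 1, θ)`, or a
    -- draw `y` from `m`, which leads to `Beta(k, θ + 1)`.
    have e1 : ∀ y, polyaMoment l (m + Measure.dirac y + (k : ℝ≥0∞) • Measure.dirac x)
        = ∫⁻ w, mixMoment (fun l => polyaMoment l (m + Measure.dirac y)) w x [] l
          ∂(betaMeasure k (θ + 1)) := fun y => by
      refine ih hl' (by linarith) _ ?_ hk
      rw [add_dirac_univ, hm, ENNReal.ofReal_add hθ.le zero_le_one, ENNReal.ofReal_one]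
    have e2 : polyaMoment l (m + (k : ℝ≥0∞) • Measure.dirac x + Measure.dirac x)
        = ∫⁻ w, mixMoment (fun l => polyaMoment l m) w x [] l ∂(betaMeasure (k + 1) θ) := by
      have := ih hl' hθ m hm (Nat.succ_pos k)
      rw [Nat.cast_succ, add_smul, one_smul, ← add_assoc] at this
      rw [this, Nat.cast_succ]
    have hmass : (m + (k : ℝ≥0∞) • Measure.dirac x) Set.univ = ENNReal.ofReal (k + θ) := by
      rw [ENNReal.ofReal_add hk'.le hθ.le, add_comm]
      simp [hm]
    have hinv : ∀ c : ℝ, 0 ≤ c →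
        ENNReal.ofReal (c / (k + θ)) = (ENNReal.ofReal (k + θ))⁻¹ * ENNReal.ofReal c := by
      intro c hc
      rw [ENNReal.ofReal_div_of_pos (by linarith), ENNReal.div_eq_inv_mul]
    have mp : Measurable fun y => g y * polyaMoment l (m + (k : ℝ≥0∞) • Measure.dirac x +
        Measure.dirac y) := hg.fun_mul ((measurable_polyaMoment hl').comp
          (measurable_const.measure_add Measure.measurable_dirac))
    calc polyaMoment (g :: l) (m + (k : ℝ≥0∞) • Measure.dirac x)
        = (ENNReal.ofReal (k + θ))⁻¹ * (∫⁻ y, g y * polyaMoment l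
              (m + Measure.dirac y + (k : ℝ≥0∞) • Measure.dirac x) ∂m
            + k * (g x * polyaMoment l (m + (k : ℝ≥0∞) • Measure.dirac x + Measure.dirac x))) := by
          simp only [polyaMoment]
          rw [lintegral_normalizeKernel, hmass, lintegral_add_measure, lintegral_smul_measure,
            lintegral_dirac' x mp, smul_eq_mul]
          have hcomm : ∀ y, m + (k : ℝ≥0∞) • Measure.dirac x + Measure.dirac y
              = m + Measure.dirac y + (k : ℝ≥0∞) • Measure.dirac x := fun y =>
            add_right_comm _ _ _
          simp only [hcomm]
      _ = (ENNReal.ofReal (k + θ))⁻¹ * (∫⁻ w, ∫⁻ y, g y *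
              mixMoment (fun l => polyaMoment l (m + Measure.dirac y)) w x [] l ∂m
              ∂(betaMeasure k (θ + 1))
            + k * (g x * ∫⁻ w, mixMoment (fun l => polyaMoment l m) w x [] l
              ∂(betaMeasure (k + 1) θ))) := by
          rw [lintegral_lintegral_swap mwy.aemeasurable, e2]
          congr 2
          refine lintegral_congr fun y => ?_
          rw [e1, lintegral_const_mul]
          exact measurable_mixMoment (β := fun _ l => polyaMoment l (m + Measure.dirac y))
            (acc := []) (fun _ _ => measurable_const) measurable_id measurable_const (by simp) hl'
      _ = ∫⁻ w, mixMoment (fun l => polyaMoment l m) w x [] (g :: l) ∂(betaMeasure k θ) := by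
          simp only [mixMoment, List.nil_append, mul_assoc]
          rw [lintegral_add_left (ENNReal.measurable_ofReal.fun_mul (mw.const_mul _)),
            lintegral_betaMeasure_mul hk' hθ (mw.const_mul _),
            lintegral_betaMeasure_one_sub_mul hk' hθ mwg, lintegral_const_mul _ mw,
            hinv _ hk'.le, hinv _ hθ.le, ENNReal.ofReal_natCast]
          have e3 : ∀ w, mixMoment (fun l => polyaMoment l m) w x [g] l = (ENNReal.ofReal θ)⁻¹ *
              ∫⁻ y, g y * mixMoment (fun l => polyaMoment l (m + Measure.dirac y)) w x [] l ∂m := by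
            intro w
            rw [mixMoment_polyaMoment_cons m w x hg (by simp) hl', lintegral_normalizeKernel, hm]
          simp only [e3]
          rw [lintegral_const_mul _ mwy.lintegral_prod_right, mul_assoc (_)⁻¹ (ENNReal.ofReal θ),
            ← mul_assoc (ENNReal.ofReal θ), ENNReal.mul_inv_cancel (by simpa using hθ)
            ENNReal.ofReal_ne_top]
          ring

/-- The moments of the urn satisfy the distributional fixed-point equation of the Dirichlet
process. Stationarity lets the first draw `x` be inserted for free; it then plays the role of the
first atom. -/
theorem polyaMoment_eq_lintegral_mixMoment {l : List (S → ℝ≥0∞)} (hl : ∀ g ∈ l, Measurable g)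
    {θ : ℝ} (hθ : 0 < θ) (μ : Measure S) [IsProbabilityMeasure μ] :
    polyaMoment l (ENNReal.ofReal θ • μ)
      = ∫⁻ x, ∫⁻ w, mixMoment (fun l => polyaMoment l (ENNReal.ofReal θ • μ)) w x [] l
          ∂(betaMeasure 1 θ) ∂μ := by
  have hθ' : ENNReal.ofReal θ ≠ 0 := by simpa using hθ
  have : IsFiniteMeasure (ENNReal.ofReal θ • μ) := ⟨by simp⟩
  rw [← polyaMoment_one_cons hl (ENNReal.ofReal θ • μ) (by
    intro h
    have h' := congrArg (fun n : Measure S => n Set.univ) h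
    simp [hθ.not_ge] at h')]
  simp only [polyaMoment, one_mul]
  rw [normalizeKernel_smul hθ' ENNReal.ofReal_ne_top, normalizeKernel_of_isProbabilityMeasure]
  refine lintegral_congr fun x => ?_
  have := polyaMoment_add_atom hl x hθ (ENNReal.ofReal θ • μ) (by simp) one_pos
  rwa [Nat.cast_one, one_smul, Nat.cast_one] at this

end MixMoment

/-! ### Laws of sequences -/

section Sequences

variable {S : Type*} [MeasurableSpace S]

theorem measurableSet_seqBox {A : ℕ → Set S} (hA : ∀ i, MeasurableSet (A i)) (n : ℕ) :
    MeasurableSet {s : ℕ → S | ∀ i < n, s i ∈ A i} := by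
  have : {s : ℕ → S | ∀ i < n, s i ∈ A i} = Set.pi (Finset.range n) A := by
    ext s; simp
  rw [this]
  exact MeasurableSet.pi (Finset.countable_toSet _) fun i _ => hA i

/-- The boxes in a sequence space that restrict an initial segment of the coordinates. -/
def seqBoxes (S : Type*) [MeasurableSpace S] : Set (Set (ℕ → S)) :=
  {B | ∃ (n : ℕ) (A : ℕ → Set S), (∀ i, MeasurableSet (A i)) ∧ B = {s | ∀ i < n, s i ∈ A i}}

theorem generateFrom_seqBoxes :
    (MeasurableSpace.pi : MeasurableSpace (ℕ → S)) = .generateFrom (seqBoxes S) := by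
  refine le_antisymm ?_ (MeasurableSpace.generateFrom_le ?_)
  · refine iSup_le fun i => ?_
    rintro _ ⟨B, hB, rfl⟩
    refine MeasurableSpace.measurableSet_generateFrom
      ⟨i + 1, fun j => if j = i then B else Set.univ, fun j => ?_, ?_⟩
    · dsimp only
      split_ifs
      exacts [hB, MeasurableSet.univ]
    · ext s
      simp only [Set.mem_preimage, Set.mem_ofPred_eq]
      refine ⟨fun hs j _ => ?_, fun hs => by simpa using hs i (Nat.lt_succ_self i)⟩
      split_ifs with hj
      · exact hj ▸ hs
      · trivial
  · rintro _ ⟨n, A, hA, rfl⟩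
    exact measurableSet_seqBox hA n

theorem isPiSystem_seqBoxes : IsPiSystem (seqBoxes S) := by
  rintro _ ⟨n, A, hA, rfl⟩ _ ⟨n', A', hA', rfl⟩ -
  refine ⟨max n n', fun i => (if i < n then A i else Set.univ) ∩
    (if i < n' then A' i else Set.univ), fun i => ?_, ?_⟩
  · refine MeasurableSet.inter ?_ ?_ <;> split_ifs
    exacts [hA i, MeasurableSet.univ, hA' i, MeasurableSet.univ]
  · ext s
    simp only [Set.mem_inter_iff, Set.mem_ofPred_eq]
    constructor
    · rintro ⟨h1, h2⟩ i _
      constructor <;> split_ifs with hi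
      exacts [h1 i hi, trivial, h2 i hi, trivial]
    · intro hs
      refine ⟨fun i hi => ?_, fun i hi => ?_⟩
      · simpa [hi] using (hs i (lt_max_of_lt_left hi)).1
      · simpa [hi] using (hs i (lt_max_of_lt_right hi)).2

/-- Finite measures on a sequence space are determined by the boxes that restrict an initial
segment of the coordinates. -/
theorem ext_of_seqBox {μ ν : Measure (ℕ → S)} [IsFiniteMeasure μ]
    (h : ∀ (n : ℕ) (A : ℕ → Set S), (∀ i, MeasurableSet (A i)) →
      μ {s | ∀ i < n, s i ∈ A i} = ν {s | ∀ i < n, s i ∈ A i}) : μ = ν := by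
  refine ext_of_generate_finite (seqBoxes S) generateFrom_seqBoxes isPiSystem_seqBoxes ?_ ?_
  · rintro _ ⟨n, A, hA, rfl⟩
    exact h n A hA
  · simpa using h 0 (fun _ => Set.univ) fun _ => MeasurableSet.univ

theorem infinitePi_seqBox (η : ℕ → Measure S) [∀ i, IsProbabilityMeasure (η i)]
    {A : ℕ → Set S} (hA : ∀ i, MeasurableSet (A i)) (n : ℕ) :
    Measure.infinitePi η {s | ∀ i < n, s i ∈ A i} = ∏ i ∈ Finset.range n, η i (A i) := by
  rw [← Measure.infinitePi_pi (μ := η) (s := Finset.range n) fun i _ => hA i]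
  congr 1
  ext s
  simp

theorem lintegral_infinitePi_prod (η : ℕ → Measure S) [∀ i, IsProbabilityMeasure (η i)]
    {g : ℕ → S → ℝ≥0∞} (hg : ∀ i, Measurable (g i)) (n : ℕ) :
    ∫⁻ s, ∏ i ∈ Finset.range n, g i (s i) ∂(Measure.infinitePi η)
      = ∏ i ∈ Finset.range n, ∫⁻ y, g i y ∂(η i) := by
  rw [lintegral_prod_eq_prod_lintegral_of_indepFun (Finset.range n) (fun i (s : ℕ → S) => g i (s i))
    (iIndepFun_infinitePi hg) fun i => (hg i).comp (measurable_pi_apply i)]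
  refine Finset.prod_congr rfl fun i _ => ?_
  rw [← lintegral_map (hg i) (measurable_pi_apply i), Measure.infinitePi_map_eval]

/-- The product of a sequence of Markov kernels, as a kernel into the sequence space. -/
def infinitePiKernel {Z : Type*} [MeasurableSpace Z] (η : ℕ → Kernel Z S)
    [∀ i, IsMarkovKernel (η i)] : Kernel Z (ℕ → S) where
  toFun z := Measure.infinitePi fun i => η i z
  measurable' := by
    refine Measurable.measure_of_isPiSystem_of_isProbabilityMeasure generateFrom_seqBoxes
      isPiSystem_seqBoxes ?_
    rintro _ ⟨n, A, hA, rfl⟩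
    simp only [infinitePi_seqBox _ hA]
    exact Finset.measurable_prod _ fun i _ => Kernel.measurable_coe (η i) (hA i)

theorem infinitePiKernel_apply {Z : Type*} [MeasurableSpace Z] (η : ℕ → Kernel Z S)
    [∀ i, IsMarkovKernel (η i)] (z : Z) :
    infinitePiKernel η z = Measure.infinitePi fun i => η i z := rfl

instance isMarkovKernel_infinitePiKernel {Z : Type*} [MeasurableSpace Z] (η : ℕ → Kernel Z S)
    [∀ i, IsMarkovKernel (η i)] : IsMarkovKernel (infinitePiKernel η) :=
  ⟨fun z => by rw [infinitePiKernel_apply]; infer_instance⟩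

/-- Prepend a term to a sequence. -/
def consSeq (z : S × (ℕ → S)) : ℕ → S
  | 0 => z.1
  | n + 1 => z.2 n

theorem measurable_consSeq : Measurable (consSeq (S := S)) := by
  refine measurable_pi_lambda _ fun n => ?_
  cases n with
  | zero => exact measurable_fst
  | succ n => exact (measurable_pi_apply n).comp measurable_snd

theorem map_consSeq_infinitePi (μ : Measure S) [IsProbabilityMeasure μ] :
    (μ.prod (Measure.infinitePi fun _ : ℕ => μ)).map consSeq
      = Measure.infinitePi fun _ : ℕ => μ := by
  have : IsProbabilityMeasure ((μ.prod (Measure.infinitePi fun _ : ℕ => μ)).map consSeq) :=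
    Measure.isProbabilityMeasure_map measurable_consSeq.aemeasurable
  refine ext_of_seqBox fun n A hA => ?_
  rw [Measure.map_apply measurable_consSeq (measurableSet_seqBox hA n), infinitePi_seqBox _ hA]
  cases n with
  | zero => simp
  | succ n =>
    have : consSeq ⁻¹' {s | ∀ i < n + 1, s i ∈ A i}
        = A 0 ×ˢ {s : ℕ → S | ∀ i < n, s i ∈ A (i + 1)} := by
      ext z
      simp only [Set.mem_preimage, Set.mem_ofPred_eq, Set.mem_prod]
      refine ⟨fun h => ⟨h 0 (Nat.succ_pos n), fun i hi => h (i + 1) (by omega)⟩, ?_⟩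
      rintro ⟨h0, h1⟩ i hi
      cases i with
      | zero => exact h0
      | succ i => exact h1 i (by omega)
    rw [this, Measure.prod_prod, infinitePi_seqBox _ fun i => hA (i + 1), Finset.prod_range_succ',
      mul_comm]

theorem lintegral_infinitePi_consSeq (μ : Measure S) [IsProbabilityMeasure μ]
    {F : (ℕ → S) → ℝ≥0∞} (hF : Measurable F) :
    ∫⁻ s, F s ∂(Measure.infinitePi fun _ : ℕ => μ)
      = ∫⁻ x, ∫⁻ s, F (consSeq (x, s)) ∂(Measure.infinitePi fun _ : ℕ => μ) ∂μ := by
  conv_lhs => rw [← map_consSeq_infinitePi μ]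
  have hFc : Measurable fun z => F (consSeq z) := hF.comp measurable_consSeq
  rw [lintegral_map hF measurable_consSeq, lintegral_prod _ hFc.aemeasurable]

end Sequences

/-! ### Moments of the Dirichlet process -/

section Dirichlet

variable {S : Type v} [MeasurableSpace S]

theorem lintegral_stickBreaking (z : (ℕ → ℝ) × (ℕ → S)) {g : S → ℝ≥0∞} (hg : Measurable g) :
    ∫⁻ y, g y ∂(stickBreaking z) = ∑' j, ENNReal.ofReal (stickWeight z.1 j) * g (z.2 j) := by
  simp [stickBreaking, lintegral_sum_measure, lintegral_dirac' _ hg]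

/-- Self-similarity of stick breaking: after the first break, the rest is a stick-breaking measure
scaled by `1 - w`. -/
theorem lintegral_stickBreaking_consSeq {w : ℝ} (hw : w ≤ 1) (x : S) (W : ℕ → ℝ) (U : ℕ → S)
    {g : S → ℝ≥0∞} (hg : Measurable g) :
    ∫⁻ y, g y ∂(stickBreaking (consSeq (w, W), consSeq (x, U)))
      = ENNReal.ofReal w * g x + ENNReal.ofReal (1 - w) * ∫⁻ y, g y ∂(stickBreaking (W, U)) := by
  rw [lintegral_stickBreaking _ hg, lintegral_stickBreaking _ hg,
    tsum_eq_zero_add' ENNReal.summable]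
  congr 1
  · simp [stickWeight, consSeq]
  · rw [← ENNReal.tsum_mul_left]
    refine tsum_congr fun j => ?_
    rw [← mul_assoc, ← ENNReal.ofReal_mul (by linarith)]
    congr 2
    simp only [stickWeight, consSeq, Finset.prod_range_succ']
    ring

theorem sum_range_stickWeight (W : ℕ → ℝ) (n : ℕ) :
    ∑ j ∈ Finset.range n, stickWeight W j = 1 - ∏ i ∈ Finset.range n, (1 - W i) := by
  induction n with
  | zero => simp
  | succ n ih =>
    rw [Finset.sum_range_succ, ih, Finset.prod_range_succ, stickWeight]
    ring

theorem stickBreaking_univ_le_one {z : (ℕ → ℝ) × (ℕ → S)} (hz : ∀ i, 0 < z.1 i ∧ z.1 i < 1) :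
    stickBreaking z Set.univ ≤ 1 := by
  have h0 : ∀ n, 0 ≤ ∏ i ∈ Finset.range n, (1 - z.1 i) := fun n =>
    Finset.prod_nonneg fun i _ => sub_nonneg.2 (hz i).2.le
  have hpos : ∀ j, 0 ≤ stickWeight z.1 j := fun j => mul_nonneg (hz j).1.le (h0 j)
  rw [← lintegral_one, lintegral_stickBreaking z measurable_const]
  simp only [mul_one]
  refine ENNReal.tsum_le_of_sum_range_le fun n => ?_
  rw [← ENNReal.ofReal_sum_of_nonneg fun j _ => hpos j, sum_range_stickWeight]
  exact ENNReal.ofReal_le_one.2 (by linarith [h0 n])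

theorem isProbabilityMeasure_dirichletProcess {θ : ℝ} (hθ : 0 < θ) (μ : Measure S)
    [IsProbabilityMeasure μ] : IsProbabilityMeasure (dirichletProcess θ μ) := by
  have := isProbabilityMeasureBeta one_pos hθ
  exact Measure.isProbabilityMeasure_map measurable_stickBreaking.aemeasurable

theorem dirichletProcess_ae_univ_le_one {θ : ℝ} (hθ : 0 < θ) (μ : Measure S)
    [IsProbabilityMeasure μ] : ∀ᵐ m ∂(dirichletProcess θ μ), m Set.univ ≤ 1 := by
  have := isProbabilityMeasureBeta one_pos hθ
  rw [dirichletProcess, ae_map_iff measurable_stickBreaking.aemeasurable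
    (measurableSet_le (Measure.measurable_coe MeasurableSet.univ) measurable_const)]
  have h : ∀ᵐ W ∂(Measure.infinitePi fun _ : ℕ => betaMeasure 1 θ), ∀ i, 0 < W i ∧ W i < 1 := by
    rw [ae_all_iff]
    intro i
    have h1 := betaMeasure_ae_mem_Ioo 1 θ
    rw [← Measure.infinitePi_map_eval (fun _ : ℕ => betaMeasure 1 θ) i] at h1
    exact ae_of_ae_map (measurable_pi_apply i).aemeasurable h1
  have h2 := (Measure.quasiMeasurePreserving_fst
    (μ := Measure.infinitePi fun _ : ℕ => betaMeasure 1 θ)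
    (ν := Measure.infinitePi fun _ : ℕ => μ)).ae h
  filter_upwards [h2] with z hz using stickBreaking_univ_le_one hz

/-- The mixed moments `E[m(g₁) ⋯ m(gₙ)]` of the Dirichlet process. -/
def dirichletMoment (θ : ℝ) (μ : Measure S) (l : List (S → ℝ≥0∞)) : ℝ≥0∞ :=
  ∫⁻ m, (l.map fun g => ∫⁻ y, g y ∂m).prod ∂(dirichletProcess θ μ)

theorem measurable_prod_lintegral {l : List (S → ℝ≥0∞)} (hl : ∀ g ∈ l, Measurable g) :
    Measurable fun m : Measure S => (l.map fun g => ∫⁻ y, g y ∂m).prod := by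
  induction l with
  | nil => exact measurable_const
  | cons g l ih =>
    simp only [List.map_cons, List.prod_cons]
    exact (Measure.measurable_lintegral (hl g (by simp))).mul
      (ih fun g hg => hl g (by simp [hg]))

theorem mixMoment_prod (m : Measure S) (w : ℝ) (x : S) (acc l : List (S → ℝ≥0∞)) :
    mixMoment (fun l => (l.map fun g => ∫⁻ y, g y ∂m).prod) w x acc l
      = (acc.map fun g => ∫⁻ y, g y ∂m).prod
        * (l.map fun g => ENNReal.ofReal w * g x + ENNReal.ofReal (1 - w) * ∫⁻ y, g y ∂m).prod := by
  induction l generalizing acc with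
  | nil => simp [mixMoment]
  | cons g l ih =>
    simp only [mixMoment, ih, List.map_append, List.prod_append, List.map_cons, List.prod_cons,
      List.map_nil, List.prod_nil]
    ring

/-- The stick-breaking series is self-similar: removing its first atom leaves an independent copy of
the series, scaled by `1 - w`. In terms of moments this is a fixed-point equation. -/
theorem dirichletMoment_eq_lintegral_mixMoment {l : List (S → ℝ≥0∞)}
    (hl : ∀ g ∈ l, Measurable g) {θ : ℝ} (hθ : 0 < θ) (μ : Measure S) [IsProbabilityMeasure μ] :
    dirichletMoment θ μ l
      = ∫⁻ x, ∫⁻ w, mixMoment (dirichletMoment θ μ) w x [] l ∂(betaMeasure 1 θ) ∂μ := by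
  have := isProbabilityMeasureBeta one_pos hθ
  set B := betaMeasure 1 θ
  set BI := Measure.infinitePi fun _ : ℕ => B
  set MI := Measure.infinitePi fun _ : ℕ => μ
  let F : Measure S → ℝ≥0∞ := fun m => (l.map fun g => ∫⁻ y, g y ∂m).prod
  have hF : Measurable F := measurable_prod_lintegral hl
  have hFS : Measurable fun z => F (stickBreaking z) := hF.comp measurable_stickBreaking
  have hdp : ∀ l : List (S → ℝ≥0∞), (∀ g ∈ l, Measurable g) → dirichletMoment θ μ l
      = ∫⁻ z, (l.map fun g => ∫⁻ y, g y ∂(stickBreaking z)).prod ∂(BI.prod MI) := fun l hl => by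
    rw [dirichletMoment, dirichletProcess,
      lintegral_map (measurable_prod_lintegral hl) measurable_stickBreaking]
  have hmeas4 : Measurable fun q : (ℝ × (ℕ → ℝ)) × (S × (ℕ → S)) =>
      F (stickBreaking (consSeq q.1, consSeq q.2)) :=
    hFS.comp ((measurable_consSeq.comp measurable_fst).prodMk
      (measurable_consSeq.comp measurable_snd))
  calc dirichletMoment θ μ l = ∫⁻ W, ∫⁻ U, F (stickBreaking (W, U)) ∂MI ∂BI := by
        rw [hdp l hl, lintegral_prod _ hFS.aemeasurable]
    _ = ∫⁻ w, ∫⁻ W, ∫⁻ x, ∫⁻ U, F (stickBreaking (consSeq (w, W), consSeq (x, U))) ∂MI ∂μ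
          ∂BI ∂B := by
        rw [lintegral_infinitePi_consSeq B hFS.lintegral_prod_right]
        refine lintegral_congr fun w => lintegral_congr fun W => ?_
        exact lintegral_infinitePi_consSeq μ (hFS.comp measurable_prodMk_left)
    _ = ∫⁻ w, ∫⁻ x, ∫⁻ W, ∫⁻ U, F (stickBreaking (consSeq (w, W), consSeq (x, U))) ∂MI ∂BI
          ∂μ ∂B := by
        refine lintegral_congr fun w => ?_
        refine lintegral_lintegral_swap (Measurable.aemeasurable ?_)
        refine Measurable.lintegral_prod_right (f := fun (p : (ℕ → ℝ) × S) (U : ℕ → S) =>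
          F (stickBreaking (consSeq (w, p.1), consSeq (p.2, U)))) ?_
        exact hmeas4.comp (f := fun q : ((ℕ → ℝ) × S) × (ℕ → S) => ((w, q.1.1), (q.1.2, q.2)))
          (by fun_prop)
    _ = ∫⁻ x, ∫⁻ w, ∫⁻ W, ∫⁻ U, F (stickBreaking (consSeq (w, W), consSeq (x, U))) ∂MI ∂BI
          ∂B ∂μ := by
        refine lintegral_lintegral_swap (Measurable.aemeasurable ?_)
        refine Measurable.lintegral_prod_right (f := fun (p : ℝ × S) (W : ℕ → ℝ) =>
          ∫⁻ U, F (stickBreaking (consSeq (p.1, W), consSeq (p.2, U))) ∂MI) ?_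
        refine Measurable.lintegral_prod_right (f := fun (p : (ℝ × S) × (ℕ → ℝ)) (U : ℕ → S) =>
          F (stickBreaking (consSeq (p.1.1, p.2), consSeq (p.1.2, U)))) ?_
        exact hmeas4.comp (f := fun q : ((ℝ × S) × (ℕ → ℝ)) × (ℕ → S) =>
          ((q.1.1.1, q.1.2), (q.1.1.2, q.2))) (by fun_prop)
    _ = ∫⁻ x, ∫⁻ w, mixMoment (dirichletMoment θ μ) w x [] l ∂B ∂μ := by
        refine lintegral_congr fun x => lintegral_congr_ae ?_
        filter_upwards [betaMeasure_ae_mem_Ioo 1 θ] with w hw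
        have hβ : ∀ acc : List (S → ℝ≥0∞), (∀ g ∈ acc, Measurable g) → Measurable
            fun z => (acc.map fun g => ∫⁻ y, g y ∂(stickBreaking z)).prod := fun acc h =>
          (measurable_prod_lintegral h).comp measurable_stickBreaking
        have hmix : mixMoment (dirichletMoment θ μ) w x [] l
            = ∫⁻ z, mixMoment (fun acc => (acc.map fun g => ∫⁻ y, g y ∂(stickBreaking z)).prod)
              w x [] l ∂(BI.prod MI) := by
          rw [← mixMoment_lintegral (BI.prod MI) hβ w x (acc := []) (by simp) hl]
          have hcongr : ∀ acc l : List (S → ℝ≥0∞), (∀ g ∈ acc, Measurable g) →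
              (∀ g ∈ l, Measurable g) → mixMoment (dirichletMoment θ μ) w x acc l
                = mixMoment (fun acc => ∫⁻ z, (acc.map fun g =>
                  ∫⁻ y, g y ∂(stickBreaking z)).prod ∂(BI.prod MI)) w x acc l := by
            intro acc l
            induction l generalizing acc with
            | nil => exact fun h _ => hdp acc h
            | cons g l ih =>
              intro hacc hl
              have hg : Measurable g := hl g (by simp)
              have hl' : ∀ g ∈ l, Measurable g := fun g hg => hl g (by simp [hg])
              simp only [mixMoment]
              rw [ih acc hacc hl', ih (acc ++ [g]) (by
                simp only [List.mem_append, List.mem_singleton]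
                rintro g' (h | rfl)
                · exact hacc g' h
                · exact hg) hl']
          exact hcongr [] l (by simp) hl
        rw [hmix, lintegral_prod _ (measurable_mixMoment hβ (measurable_const (a := w))
          (measurable_const (a := x)) (acc := []) (by simp) hl).aemeasurable]
        refine lintegral_congr fun W => lintegral_congr fun U => ?_
        rw [mixMoment_prod]
        simp only [List.map_nil, List.prod_nil, one_mul, F]
        congr 1
        refine List.map_congr_left fun g hg => ?_
        exact lintegral_stickBreaking_consSeq hw.2.le x W U (hl g hg)

theorem dirichletMoment_le_one {l : List (S → ℝ≥0∞)} (hl : ∀ g ∈ l, ∀ y, g y ≤ 1)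
    {θ : ℝ} (hθ : 0 < θ) (μ : Measure S) [IsProbabilityMeasure μ] :
    dirichletMoment θ μ l ≤ 1 := by
  have := isProbabilityMeasure_dirichletProcess hθ μ
  calc dirichletMoment θ μ l ≤ ∫⁻ _, 1 ∂(dirichletProcess θ μ) := by
        refine lintegral_mono_ae ?_
        filter_upwards [dirichletProcess_ae_univ_le_one hθ μ] with m hm
        induction l with
        | nil => simp
        | cons g l ih =>
          rw [List.map_cons, List.prod_cons]
          refine mul_le_one' ?_ (ih fun g hg => hl g (by simp [hg]))
          calc ∫⁻ y, g y ∂m ≤ ∫⁻ _, 1 ∂m := lintegral_mono fun y => hl g (by simp) y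
            _ ≤ 1 := by simpa using hm
    _ = 1 := by simp

theorem polyaMoment_le_one {l : List (S → ℝ≥0∞)} (hl : ∀ g ∈ l, ∀ y, g y ≤ 1) (m : Measure S) :
    polyaMoment l m ≤ 1 := by
  induction l generalizing m with
  | nil => exact le_rfl
  | cons g l ih =>
    have hl' : ∀ g ∈ l, ∀ y, g y ≤ 1 := fun g hg => hl g (by simp [hg])
    calc polyaMoment (g :: l) m ≤ ∫⁻ _, 1 ∂(normalizeKernel S m) :=
          lintegral_mono fun y => mul_le_one' (hl g (by simp) y) (ih hl' _)
      _ ≤ 1 := by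
          rw [lintegral_one, normalizeKernel_apply, Measure.smul_apply, smul_eq_mul]
          exact ENNReal.inv_mul_le_one _

theorem mixMoment_congr_of_length_lt {T : Type*} {p : (T → ℝ≥0∞) → Prop}
    {β β' : List (T → ℝ≥0∞) → ℝ≥0∞} {n : ℕ}
    (h : ∀ l, (∀ g ∈ l, p g) → l.length < n → β l = β' l) (w : ℝ) (x : T)
    {acc l : List (T → ℝ≥0∞)} (hacc : ∀ g ∈ acc, p g) (hl : ∀ g ∈ l, p g)
    (hn : acc.length + l.length < n) : mixMoment β w x acc l = mixMoment β' w x acc l := by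
  induction l generalizing acc with
  | nil => exact h acc hacc hn
  | cons g l ih =>
    have hl' : ∀ g ∈ l, p g := fun g hg => hl g (by simp [hg])
    have hg := hl g (by simp)
    simp only [List.length_cons] at hn
    simp only [mixMoment]
    rw [ih hacc hl' (by omega), ih (acc := acc ++ [g]) _ hl' (by simp; omega)]
    simp only [List.mem_append, List.mem_singleton]
    rintro g' (h | rfl)
    · exact hacc g' h
    · exact hg

/-- Two moment functionals that agree on short lists have mixtures that differ only through the
term in which the split-off atom is never used. -/
theorem mixMoment_add_of_length_eq {T : Type*} {p : (T → ℝ≥0∞) → Prop}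
    {β β' : List (T → ℝ≥0∞) → ℝ≥0∞} {n : ℕ}
    (h : ∀ l, (∀ g ∈ l, p g) → l.length < n → β l = β' l) (w : ℝ) (x : T)
    {acc l : List (T → ℝ≥0∞)} (hacc : ∀ g ∈ acc, p g) (hl : ∀ g ∈ l, p g)
    (hn : acc.length + l.length = n) :
    mixMoment β w x acc l + ENNReal.ofReal (1 - w) ^ l.length * β' (acc ++ l)
      = mixMoment β' w x acc l + ENNReal.ofReal (1 - w) ^ l.length * β (acc ++ l) := by
  induction l generalizing acc with
  | nil => simp [mixMoment, add_comm]
  | cons g l ih =>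
    have hl' : ∀ g ∈ l, p g := fun g hg => hl g (by simp [hg])
    have hg := hl g (by simp)
    simp only [List.length_cons] at hn
    have ih' := ih (acc := acc ++ [g]) (by
      simp only [List.mem_append, List.mem_singleton]
      rintro g' (h | rfl)
      · exact hacc g' h
      · exact hg) hl' (by simp; omega)
    simp only [List.append_assoc, List.singleton_append] at ih'
    simp only [mixMoment, List.length_cons, pow_succ']
    rw [mixMoment_congr_of_length_lt h w x hacc hl' (by omega), add_assoc, add_assoc, mul_assoc,
      mul_assoc (ENNReal.ofReal (1 - w)), ← mul_add, ih', mul_add,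
      mul_assoc (ENNReal.ofReal (1 - w))]

/-- The mixed moments of the Dirichlet process are those of the Blackwell–MacQueen urn: both solve
the same fixed-point equation, whose solution is unique because the coefficient
`E[(1 - w) ^ n]` of the term of full length is less than `1`. -/
theorem dirichletMoment_eq_polyaMoment {l : List (S → ℝ≥0∞)}
    (hl : ∀ g ∈ l, Measurable g ∧ ∀ y, g y ≤ 1) {θ : ℝ} (hθ : 0 < θ) (μ : Measure S)
    [IsProbabilityMeasure μ] :
    dirichletMoment θ μ l = polyaMoment l (ENNReal.ofReal θ • μ) := by
  obtain ⟨n, hn⟩ : ∃ n, l.length = n := ⟨_, rfl⟩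
  induction n using Nat.strong_induction_on generalizing l with
  | _ n ih =>
    have hB := isProbabilityMeasureBeta one_pos hθ
    have hDP := isProbabilityMeasure_dirichletProcess hθ μ
    rcases Nat.eq_zero_or_pos n with rfl | hpos
    · rw [List.length_eq_zero_iff] at hn
      subst hn
      simp [dirichletMoment, polyaMoment]
    have hlm : ∀ g ∈ l, Measurable g := fun g hg => (hl g hg).1
    have hl1 : ∀ g ∈ l, ∀ y, g y ≤ 1 := fun g hg => (hl g hg).2
    set D := dirichletMoment θ μ with hD
    let b : List (S → ℝ≥0∞) → ℝ≥0∞ := fun l => polyaMoment l (ENNReal.ofReal θ • μ)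
    change D l = b l
    set c : ℝ≥0∞ := ∫⁻ w, ENNReal.ofReal (1 - w) ^ n ∂(betaMeasure 1 θ) with hc
    have hpowm : Measurable fun w : ℝ => ENNReal.ofReal (1 - w) ^ n := by fun_prop
    have hc1 : c < 1 := by
      calc c ≤ ∫⁻ w, ENNReal.ofReal (1 - w) * 1 ∂(betaMeasure 1 θ) := by
            refine lintegral_mono_ae ?_
            filter_upwards [betaMeasure_ae_mem_Ioo 1 θ] with w hw
            rw [mul_one]
            exact pow_le_of_le_one zero_le
              (ENNReal.ofReal_le_one.2 (by linarith [hw.1])) hpos.ne'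
        _ < 1 := by
            have := isProbabilityMeasureBeta (α := 1) (β := θ + 1) one_pos (by linarith)
            rw [lintegral_betaMeasure_one_sub_mul one_pos hθ measurable_const, lintegral_one,
              measure_univ, mul_one]
            exact ENNReal.ofReal_lt_one.2 ((div_lt_one (by linarith)).2 (by linarith))
    have hmD : ∀ x, Measurable fun w => mixMoment D w x [] l := fun x =>
      measurable_mixMoment (β := fun _ => D) (acc := []) (fun _ _ => measurable_const)
        measurable_id measurable_const (by simp) hlm
    have hmb : ∀ x, Measurable fun w => mixMoment b w x [] l := fun x =>
      measurable_mixMoment (β := fun _ => b) (acc := []) (fun _ _ => measurable_const)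
        measurable_id measurable_const (by simp) hlm
    have hmD2 : Measurable fun x => ∫⁻ w, mixMoment D w x [] l ∂(betaMeasure 1 θ) :=
      Measurable.lintegral_prod_right (f := fun x w => mixMoment D w x [] l)
        (measurable_mixMoment (β := fun _ => D) (acc := []) (fun _ _ => measurable_const)
        measurable_snd measurable_fst (by simp) hlm)
    have hmb2 : Measurable fun x => ∫⁻ w, mixMoment b w x [] l ∂(betaMeasure 1 θ) :=
      Measurable.lintegral_prod_right (f := fun x w => mixMoment b w x [] l)
        (measurable_mixMoment (β := fun _ => b) (acc := []) (fun _ _ => measurable_const)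
        measurable_snd measurable_fst (by simp) hlm)
    have key : D l + c * b l = b l + c * D l := by
      -- By induction the two functionals agree on shorter lists, so subtracting the fixed-point
      -- equations leaves `(1 - c) (D l - b l) = 0`, written here without subtraction in `ℝ≥0∞`.
      have e1 : D l = ∫⁻ x, ∫⁻ w, mixMoment D w x [] l ∂(betaMeasure 1 θ) ∂μ :=
        dirichletMoment_eq_lintegral_mixMoment hlm hθ μ
      have e2 : b l = ∫⁻ x, ∫⁻ w, mixMoment b w x [] l ∂(betaMeasure 1 θ) ∂μ :=
        polyaMoment_eq_lintegral_mixMoment hlm hθ μ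
      have e3 : ∀ r : ℝ≥0∞, c * r
          = ∫⁻ _ : S, ∫⁻ w, ENNReal.ofReal (1 - w) ^ n * r ∂(betaMeasure 1 θ) ∂μ := by
        intro r
        rw [lintegral_const, measure_univ, mul_one, lintegral_mul_const _ hpowm]
      nth_rw 1 [e1]
      nth_rw 2 [e2]
      rw [e3, e3, ← lintegral_add_left hmD2, ← lintegral_add_left hmb2]
      refine lintegral_congr fun x => ?_
      rw [← lintegral_add_left (hmD x), ← lintegral_add_left (hmb x)]
      refine lintegral_congr fun w => ?_
      have := mixMoment_add_of_length_eq (p := fun g => Measurable g ∧ ∀ y, g y ≤ 1) (β := D)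
        (β' := b) (n := n) (fun l' hl' hlt => ih _ hlt hl' rfl) w x (acc := []) (by simp) hl
        (by simpa using hn)
      rwa [List.nil_append, hn] at this
    have hDf : D l ≠ ∞ := ((dirichletMoment_le_one hl1 hθ μ).trans_lt ENNReal.one_lt_top).ne
    have hbf : b l ≠ ∞ := ((polyaMoment_le_one hl1 _).trans_lt ENNReal.one_lt_top).ne
    have hcf : c ≠ ∞ := (hc1.trans ENNReal.one_lt_top).ne
    have key' := congrArg ENNReal.toReal key
    rw [ENNReal.toReal_add hDf (ENNReal.mul_ne_top hcf hbf),
      ENNReal.toReal_add hbf (ENNReal.mul_ne_top hcf hDf), ENNReal.toReal_mul,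
      ENNReal.toReal_mul] at key'
    have hc1' : c.toReal < 1 := by
      rw [← ENNReal.toReal_one]
      exact (ENNReal.toReal_lt_toReal hcf ENNReal.one_ne_top).2 hc1
    rw [← ENNReal.toReal_eq_toReal_iff' hDf hbf]
    have : (1 - c.toReal) * ((D l).toReal - (b l).toReal) = 0 := by linarith
    rcases mul_eq_zero.1 this with h | h <;> linarith

theorem dirichletMoment_map_range {θ : ℝ} {μ : Measure S} (g : ℕ → S → ℝ≥0∞) (n : ℕ) :
    ∫⁻ m, ∏ i ∈ Finset.range n, ∫⁻ y, g i y ∂m ∂(dirichletProcess θ μ)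
      = dirichletMoment θ μ ((List.range n).map g) := by
  rw [dirichletMoment]
  refine lintegral_congr fun m => ?_
  rw [List.map_map]
  rfl

/-- The predictive rule for a sample from the Dirichlet process, in terms of mixed moments. -/
theorem dirichletProcess_predictive {θ : ℝ} (hθ : 0 < θ) (μ : Measure S)
    [IsProbabilityMeasure μ] {g : ℕ → S → ℝ≥0∞} (hg : ∀ i, Measurable (g i))
    (hg1 : ∀ i y, g i y ≤ 1) (n : ℕ) :
    (ENNReal.ofReal θ + n) *
        ∫⁻ m, ∏ i ∈ Finset.range (n + 1), ∫⁻ y, g i y ∂m ∂(dirichletProcess θ μ)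
      = ENNReal.ofReal θ * (∫⁻ y, g n y ∂μ) *
          ∫⁻ m, ∏ i ∈ Finset.range n, ∫⁻ y, g i y ∂m ∂(dirichletProcess θ μ)
        + ∑ k ∈ Finset.range n, ∫⁻ m, ∏ i ∈ Finset.range n,
            ∫⁻ y, Function.update g k (fun y => g k y * g n y) i y ∂m
              ∂(dirichletProcess θ μ) := by
  have hupd : ∀ k j, Measurable (Function.update g k (fun y => g k y * g n y) j) ∧
      ∀ y, Function.update g k (fun y => g k y * g n y) j y ≤ 1 := by
    intro k j
    by_cases hjk : j = k
    · subst hjk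
      simp only [Function.update_self]
      exact ⟨(hg j).mul (hg n), fun y => mul_le_one' (hg1 j y) (hg1 n y)⟩
    · rw [Function.update_of_ne hjk]
      exact ⟨hg j, hg1 j⟩
  have : IsFiniteMeasure (ENNReal.ofReal θ • μ) := ⟨by simp⟩
  have hne : ENNReal.ofReal θ • μ ≠ 0 := by
    intro h
    have h' := congrArg (fun n : Measure S => n Set.univ) h
    simp [hθ.not_ge] at h'
  have key := polyaMoment_append (List.nodup_range (n := n)) hg (hg n) _ hne
  have hmem : ∀ (L : List ℕ) (g' : ℕ → S → ℝ≥0∞), (∀ j, Measurable (g' j) ∧ ∀ y, g' j y ≤ 1) →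
      ∀ f ∈ L.map g', Measurable f ∧ ∀ y, f y ≤ 1 := by
    intro L g' h
    simp only [List.mem_map]
    rintro _ ⟨j, _, rfl⟩
    exact h j
  simp only [dirichletMoment_map_range]
  rw [dirichletMoment_eq_polyaMoment (hmem _ g fun j => ⟨hg j, hg1 j⟩) hθ μ,
    dirichletMoment_eq_polyaMoment (hmem _ g fun j => ⟨hg j, hg1 j⟩) hθ μ,
    Finset.sum_congr rfl fun k _ => dirichletMoment_eq_polyaMoment (hmem _ _ (hupd k)) hθ μ]
  rw [lintegral_smul_measure] at key
  simp only [Measure.smul_apply, measure_univ, smul_eq_mul, mul_one, List.length_range] at key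
  rw [List.range_succ, List.map_append, List.map_singleton, key]
  rfl

theorem dirichletProcess_ae_isProbabilityMeasure {θ : ℝ} (hθ : 0 < θ) (μ : Measure S)
    [IsProbabilityMeasure μ] : ∀ᵐ m ∂(dirichletProcess θ μ), IsProbabilityMeasure m := by
  have hDP := isProbabilityMeasure_dirichletProcess hθ μ
  -- The total mass is at most `1` and has mean `1`, by the predictive rule for a single draw.
  have h1 : ∫⁻ m, m Set.univ ∂(dirichletProcess θ μ) = ∫⁻ _, 1 ∂(dirichletProcess θ μ) := by
    have := dirichletProcess_predictive hθ μ (g := fun _ _ => 1) (fun _ => measurable_const)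
      (fun _ _ => le_rfl) 0
    simp only [zero_add, Finset.range_one, Finset.prod_singleton, lintegral_one, measure_univ,
      Nat.cast_zero, add_zero, Finset.range_zero, Finset.prod_empty, Finset.sum_empty,
      mul_one] at this
    rw [lintegral_one, measure_univ]
    exact (ENNReal.mul_right_inj (by simpa using hθ) ENNReal.ofReal_ne_top).1 (by simpa using this)
  have h2 := ae_eq_of_ae_le_of_lintegral_le (dirichletProcess_ae_univ_le_one hθ μ)
    (by rw [h1]; simp) aemeasurable_const h1.ge
  filter_upwards [h2] with m hm using ⟨hm⟩

end Dirichlet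

/-! ### Conditional independence in terms of integrals -/

section Conditional

variable {Ω : Type*} {S : Type*} {m : MeasurableSpace Ω} [mΩ : MeasurableSpace Ω]
  [MeasurableSpace S] {P : Measure Ω} [IsProbabilityMeasure P]

theorem measure_inter_eq_setLIntegral_of_condExp (hm : m ≤ mΩ) {B : Set Ω}
    (hB : MeasurableSet B) {f : Ω → ℝ} (hf0 : ∀ ω, 0 ≤ f ω) (h : P⟦B | m⟧ =ᵐ[P] f)
    {C : Set Ω} (hC : MeasurableSet[m] C) :
    P (C ∩ B) = ∫⁻ ω in C, ENNReal.ofReal (f ω) ∂P := by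
  have hint : Integrable (B.indicator fun _ => (1 : ℝ)) P := (integrable_const 1).indicator hB
  have hf : Integrable f P := integrable_condExp.congr h
  have h1 : ∫ ω in C, f ω ∂P = P.real (C ∩ B) := by
    rw [← setIntegral_congr_ae (hm _ hC) (h.mono fun ω hω _ => hω), setIntegral_condExp hm hint hC,
      integral_indicator_const _ hB, smul_eq_mul, mul_one, measureReal_restrict_apply hB,
      Set.inter_comm]
  rw [← ofReal_integral_eq_lintegral_ofReal hf.integrableOn (Filter.Eventually.of_forall hf0), h1,
    ofReal_measureReal]

theorem condExp_eq_of_measure_inter_eq (hm : m ≤ mΩ) {B : Set Ω}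
    (hB : MeasurableSet B) {f : Ω → ℝ} (hfm : Measurable[m] f) (hf0 : ∀ ω, 0 ≤ f ω)
    (h : ∀ C, MeasurableSet[m] C → P (C ∩ B) = ∫⁻ ω in C, ENNReal.ofReal (f ω) ∂P) :
    P⟦B | m⟧ =ᵐ[P] f := by
  have hint : Integrable (B.indicator fun _ => (1 : ℝ)) P := (integrable_const 1).indicator hB
  have hfm' : Measurable f := hfm.mono hm le_rfl
  have hf : Integrable f P := by
    refine ⟨hfm'.aestronglyMeasurable, ?_⟩
    rw [hasFiniteIntegral_iff_ofReal (Filter.Eventually.of_forall hf0)]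
    have := h Set.univ MeasurableSet.univ
    rw [Measure.restrict_univ] at this
    rw [← this]
    exact measure_lt_top _ _
  refine (ae_eq_condExp_of_forall_setIntegral_eq hm hint (fun _ _ _ => hf.integrableOn)
    (fun C hC _ => ?_) hfm.stronglyMeasurable.aestronglyMeasurable).symm
  rw [integral_indicator_const _ hB, smul_eq_mul, mul_one, measureReal_restrict_apply hB,
    integral_eq_lintegral_of_nonneg_ae (Filter.Eventually.of_forall hf0)
      hfm'.aestronglyMeasurable, ← h C hC, Set.inter_comm, measureReal_def]

theorem ofReal_prod_measureReal {η : ℕ → Measure S} [∀ i, IsProbabilityMeasure (η i)]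
    (A : ℕ → Set S) (n : ℕ) :
    ENNReal.ofReal (∏ i ∈ Finset.range n, (η i).real (A i))
      = ∏ i ∈ Finset.range n, η i (A i) := by
  rw [ENNReal.ofReal_prod_of_nonneg fun _ _ => measureReal_nonneg]
  exact Finset.prod_congr rfl fun i _ => ofReal_measureReal

theorem iInter_range_preimage {α β : Type*} {Y : ℕ → α → β} (A : ℕ → Set β) (n : ℕ) :
    ⋂ i ∈ Finset.range n, Y i ⁻¹' A i = (fun ω i => Y i ω) ⁻¹' {s | ∀ i < n, s i ∈ A i} := by
  ext ω
  simp

/-- Conditional independence with Markov kernels as conditional laws, in integrated form. -/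
theorem CondIndepWithLaw.setLIntegral_prod (hm : m ≤ mΩ) {Y : ℕ → Ω → S}
    (hY : ∀ i, Measurable (Y i)) (η : ℕ → Kernel Ω S) [∀ i, IsMarkovKernel (η i)]
    (h : CondIndepWithLaw P m Y fun i ω => η i ω) {C : Set Ω} (hC : MeasurableSet[m] C)
    {g : ℕ → S → ℝ≥0∞} (hg : ∀ i, Measurable (g i)) (n : ℕ) :
    ∫⁻ ω in C, ∏ i ∈ Finset.range n, g i (Y i ω) ∂P
      = ∫⁻ ω in C, ∏ i ∈ Finset.range n, ∫⁻ y, g i y ∂(η i ω) ∂P := by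
  have hYm : Measurable fun ω i => Y i ω := measurable_pi_lambda _ hY
  have hlaw : (P.restrict C).map (fun ω i => Y i ω)
      = (P.restrict C).bind (infinitePiKernel η) := by
    refine ext_of_seqBox fun n A hA => ?_
    have hbox := measurableSet_seqBox hA n
    rw [Measure.map_apply hYm hbox, Measure.restrict_apply (hYm hbox),
      Measure.bind_apply hbox (Kernel.measurable _).aemeasurable]
    have := measure_inter_eq_setLIntegral_of_condExp hm (hYm hbox)
      (fun ω => Finset.prod_nonneg fun i _ => measureReal_nonneg)
      (iInter_range_preimage (Y := Y) A n ▸ h n A hA) hC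
    rw [Set.inter_comm, this]
    refine lintegral_congr fun ω => ?_
    rw [ofReal_prod_measureReal, infinitePiKernel_apply, infinitePi_seqBox _ hA]
  have hgm : Measurable fun s : ℕ → S => ∏ i ∈ Finset.range n, g i (s i) :=
    Finset.measurable_fun_prod _ fun i _ => (hg i).comp (measurable_pi_apply i)
  have e1 := lintegral_map (μ := P.restrict C) hgm hYm
  rw [hlaw, Measure.lintegral_bind (Kernel.measurable _).aemeasurable hgm.aemeasurable] at e1
  rw [← e1]
  refine lintegral_congr fun ω => ?_
  rw [infinitePiKernel_apply, lintegral_infinitePi_prod _ hg]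

/-- Conditional independence with prescribed laws may be checked by integrating over the sets of the
conditioning σ-algebra. -/
theorem condIndepWithLaw_of_measure_inter_eq (hm : m ≤ mΩ) {Y : ℕ → Ω → S}
    (hY : ∀ i, Measurable (Y i)) {η : ℕ → Ω → Measure S} (hη : ∀ i, Measurable[m] (η i))
    [∀ i ω, IsProbabilityMeasure (η i ω)]
    (h : ∀ (n : ℕ) (A : ℕ → Set S), (∀ i, MeasurableSet (A i)) → ∀ C, MeasurableSet[m] C →
      P (C ∩ (fun ω i => Y i ω) ⁻¹' {s | ∀ i < n, s i ∈ A i})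
        = ∫⁻ ω in C, ∏ i ∈ Finset.range n, η i ω (A i) ∂P) :
    CondIndepWithLaw P m Y η := by
  intro n A hA
  rw [iInter_range_preimage]
  refine condExp_eq_of_measure_inter_eq hm
    (measurable_pi_lambda _ hY (measurableSet_seqBox hA n)) ?_
    (fun ω => Finset.prod_nonneg fun i _ => measureReal_nonneg) fun C hC => ?_
  · refine Finset.measurable_prod _ fun i _ => ?_
    exact ((Measure.measurable_coe (hA i)).comp (hη i)).ennreal_toReal
  · rw [h n A hA C hC]
    simp only [ofReal_prod_measureReal]

end Conditional

/-! ### From the hierarchical model to the Pólya sequence -/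

section FiniteBoxes

variable {S : Type*} [MeasurableSpace S]

theorem measurableSet_finBox {n : ℕ} {A : Fin n → Set S} (hA : ∀ i, MeasurableSet (A i)) :
    MeasurableSet {x : Fin n → S | ∀ i, x i ∈ A i} := by
  have : {x : Fin n → S | ∀ i, x i ∈ A i} = Set.pi Set.univ A := by
    ext x; simp
  rw [this]
  exact MeasurableSet.univ_pi hA

theorem ext_of_finBox {n : ℕ} {μ ν : Measure (Fin n → S)} [IsFiniteMeasure μ]
    (h : ∀ A : Fin n → Set S, (∀ i, MeasurableSet (A i)) →
      μ {x | ∀ i, x i ∈ A i} = ν {x | ∀ i, x i ∈ A i}) : μ = ν := by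
  have hbox : ∀ A : Fin n → Set S, {x : Fin n → S | ∀ i, x i ∈ A i} = Set.pi Set.univ A := by
    intro A
    ext x
    simp
  refine ext_of_generate_finite _ generateFrom_pi.symm isPiSystem_pi ?_ ?_
  · rintro _ ⟨A, hA, rfl⟩
    rw [← hbox]
    exact h A fun i => hA i trivial
  · simpa using h (fun _ => Set.univ) fun _ => MeasurableSet.univ

theorem prod_indicator_one {α : Type*} {n : ℕ} (A : ℕ → Set α) (s : ℕ → α) :
    ∏ i ∈ Finset.range n, (A i).indicator (1 : α → ℝ≥0∞) (s i)
      = {s : ℕ → α | ∀ i < n, s i ∈ A i}.indicator 1 s := by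
  by_cases hs : ∀ i < n, s i ∈ A i
  · rw [Set.indicator_of_mem (by exact hs)]
    exact Finset.prod_eq_one fun i hi => by simp [hs i (Finset.mem_range.1 hi)]
  · rw [Set.indicator_of_notMem (by exact hs)]
    push Not at hs
    obtain ⟨i, hi, his⟩ := hs
    exact Finset.prod_eq_zero (Finset.mem_range.2 hi) (by simp [his])

theorem lintegral_prod_indicator {Ω : Type*} [MeasurableSpace Ω] {P : Measure Ω} {X : ℕ → Ω → S}
    (hX : ∀ i, Measurable (X i)) {A : ℕ → Set S} (hA : ∀ i, MeasurableSet (A i)) (n : ℕ) :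
    ∫⁻ ω, ∏ i ∈ Finset.range n, (A i).indicator (1 : S → ℝ≥0∞) (X i ω) ∂P
      = P {ω | ∀ i < n, X i ω ∈ A i} := by
  have hm : MeasurableSet {ω | ∀ i < n, X i ω ∈ A i} :=
    measurable_pi_lambda (fun ω i => X i ω) hX (measurableSet_seqBox hA n)
  rw [← lintegral_indicator_one hm]
  exact lintegral_congr fun ω => prod_indicator_one A fun i => X i ω

end FiniteBoxes

section CondDistrib

variable {E : Type w} {T : Type v} [MeasurableSpace E] [StandardBorelSpace E] [Nonempty E]
  [MeasurableSpace T] {ν : Measure E} [IsProbabilityMeasure ν] {π : E → T}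

/-- Disintegration of `ν` along `π`. -/
theorem lintegral_condDistrib_id (hπ : Measurable π) {F : T → ℝ≥0∞} (hF : Measurable F)
    {g : E → ℝ≥0∞} (hg : Measurable g) :
    ∫⁻ q, F q * ∫⁻ y, g y ∂(condDistrib id π ν q) ∂(ν.map π) = ∫⁻ x, F (π x) * g x ∂ν := by
  have h := compProd_map_condDistrib (X := π) (Y := @id E) (μ := ν) (mβ := ‹_›)
    measurable_id.aemeasurable
  have hm : Measurable fun r : T × E => F r.1 * g r.2 :=
    (hF.comp measurable_fst).mul (hg.comp measurable_snd)
  have h2 : ∫⁻ r, F r.1 * g r.2 ∂(ν.map fun a => (π a, id a)) = ∫⁻ x, F (π x) * g x ∂ν :=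
    lintegral_map hm (hπ.prodMk measurable_id)
  rw [← h2, ← h, Measure.lintegral_compProd hm]
  exact lintegral_congr fun q => (lintegral_const_mul _ hg).symm

/-- Given `π = q`, functions of `π` are constant. -/
theorem condDistrib_id_mul_comp (hπ : Measurable π) {h : T → ℝ≥0∞} (hh : Measurable h)
    {g : E → ℝ≥0∞} (hg : Measurable g) :
    (fun q => ∫⁻ y, g y * h (π y) ∂(condDistrib id π ν q))
      =ᵐ[ν.map π] fun q => (∫⁻ y, g y ∂(condDistrib id π ν q)) * h q := by
  have : IsProbabilityMeasure (ν.map π) := Measure.isProbabilityMeasure_map hπ.aemeasurable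
  have hgh : Measurable fun y => g y * h (π y) := hg.mul (hh.comp hπ)
  refine ae_eq_of_forall_setLIntegral_eq_of_sigmaFinite hgh.lintegral_kernel
    (hg.lintegral_kernel.mul hh) fun D hD _ => ?_
  have hD1 : Measurable (D.indicator (1 : T → ℝ≥0∞)) := measurable_one.indicator hD
  have e1 := lintegral_condDistrib_id (ν := ν) hπ hD1 hgh
  have e2 := lintegral_condDistrib_id (ν := ν) hπ (hD1.mul hh) hg
  rw [← lintegral_indicator hD, ← lintegral_indicator hD]
  have s1 : ∀ (f : T → ℝ≥0∞) (q : T), D.indicator f q = D.indicator 1 q * f q := by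
    intro f q
    by_cases hq : q ∈ D <;> simp [hq]
  rw [lintegral_congr (s1 _), lintegral_congr (s1 _), e1]
  calc ∫⁻ x, D.indicator 1 (π x) * (g x * h (π x)) ∂ν
      = ∫⁻ x, (D.indicator (1 : T → ℝ≥0∞) * h) (π x) * g x ∂ν := lintegral_congr fun x => by
        simp only [Pi.mul_apply]
        ring
    _ = _ := by
        rw [← e2]
        refine lintegral_congr fun q => ?_
        simp only [Pi.mul_apply]
        ring

end CondDistrib

section Backward

variable {Ω : Type u} {E : Type w} {T : Type v} [MeasurableSpace Ω]
  [MeasurableSpace E] [StandardBorelSpace E] [Nonempty E] [MeasurableSpace T]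
  {P : Measure Ω} [IsProbabilityMeasure P] {X : ℕ → Ω → E} {θ : ℝ} {ν : Measure E}
  [IsProbabilityMeasure ν] {π : E → T} {p : ℕ → Ω → T} {Q : Kernel Ω T}

/-- The mean measure of the Dirichlet process is its base measure. -/
theorem lintegral_dirichletProcess_lintegral (hθ : 0 < θ) (μ : Measure T) [IsProbabilityMeasure μ]
    {g : T → ℝ≥0∞} (hg : Measurable g) (hg1 : ∀ y, g y ≤ 1) :
    ∫⁻ m, ∫⁻ y, g y ∂m ∂(dirichletProcess θ μ) = ∫⁻ y, g y ∂μ := by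
  have hDP := isProbabilityMeasure_dirichletProcess hθ μ
  have := dirichletProcess_predictive hθ μ (g := fun _ => g) (fun _ => hg) (fun _ => hg1) 0
  simp only [zero_add, Finset.range_one, Finset.prod_singleton, lintegral_one, measure_univ,
    Nat.cast_zero, add_zero, Finset.range_zero, Finset.prod_empty, Finset.sum_empty,
    mul_one] at this
  exact (ENNReal.mul_right_inj (by simpa using hθ) ENNReal.ofReal_ne_top).1 this

theorem lintegral_le_one_of_le_one {m : Measure T} [IsProbabilityMeasure m] {g : T → ℝ≥0∞}
    (hg1 : ∀ y, g y ≤ 1) : ∫⁻ y, g y ∂m ≤ 1 :=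
  (lintegral_mono hg1).trans (by simp)

namespace IsDPHierarchy

/-- The latent variables are a mixture of i.i.d. sequences directed by the Dirichlet process. -/
theorem lintegral_latent (h : IsDPHierarchy P X θ ν π p Q)
    {g : ℕ → T → ℝ≥0∞} (hg : ∀ i, Measurable (g i)) (n : ℕ) :
    ∫⁻ ω, ∏ i ∈ Finset.range n, g i (p i ω) ∂P
      = ∫⁻ m, ∏ i ∈ Finset.range n, ∫⁻ y, g i y ∂m ∂(dirichletProcess θ (ν.map π)) := by
  have := h.isMarkovKernel
  have h1 := h.latent_law.setLIntegral_prod Q.measurable.comap_le h.measurable_latent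
    (fun _ => Q) MeasurableSet.univ hg n
  rw [Measure.restrict_univ] at h1
  rw [h1, ← h.prior_law, lintegral_map _ Q.measurable]
  exact Finset.measurable_fun_prod _ fun i _ => Measure.measurable_lintegral (hg i)

theorem lintegral_obs_eq_latent (h : IsDPHierarchy P X θ ν π p Q)
    (hX : ∀ i, Measurable (X i)) {g : ℕ → E → ℝ≥0∞} (hg : ∀ i, Measurable (g i)) (n : ℕ) :
    ∫⁻ ω, ∏ i ∈ Finset.range n, g i (X i ω) ∂P
      = ∫⁻ ω, ∏ i ∈ Finset.range n, ∫⁻ y, g i y ∂(condDistrib id π ν (p i ω)) ∂P := by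
  have hp : Measurable fun ω n => p n ω := measurable_pi_lambda _ h.measurable_latent
  have h1 := CondIndepWithLaw.setLIntegral_prod (sup_le Q.measurable.comap_le hp.comap_le) hX
    (fun i => (condDistrib id π ν).comap (p i) (h.measurable_latent i)) h.obs_law
    MeasurableSet.univ hg n
  rw [Measure.restrict_univ] at h1
  exact h1

/-- The observations are a mixture of i.i.d. sequences: given `Q = m`, each has law
`∫ ν(· ∣ π = q) m(dq)`. -/
theorem lintegral_obs (h : IsDPHierarchy P X θ ν π p Q)
    (hX : ∀ i, Measurable (X i)) {g : ℕ → E → ℝ≥0∞} (hg : ∀ i, Measurable (g i)) (n : ℕ) :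
    ∫⁻ ω, ∏ i ∈ Finset.range n, g i (X i ω) ∂P
      = ∫⁻ m, ∏ i ∈ Finset.range n, ∫⁻ q, ∫⁻ y, g i y ∂(condDistrib id π ν q) ∂m
          ∂(dirichletProcess θ (ν.map π)) := by
  rw [h.lintegral_obs_eq_latent hX hg,
    h.lintegral_latent (g := fun i q => ∫⁻ y, g i y ∂(condDistrib id π ν q))
      (fun i => (hg i).lintegral_kernel)]

theorem map_latent (h : IsDPHierarchy P X θ ν π p Q) (hθ : 0 < θ) (hπ : Measurable π) (k : ℕ) :
    P.map (p k) = ν.map π := by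
  have hpr : IsProbabilityMeasure (ν.map π) := Measure.isProbabilityMeasure_map hπ.aemeasurable
  have hQ := h.isMarkovKernel
  ext A hA
  have h1 := h.lintegral_latent
    (g := fun i => if i = k then A.indicator 1 else 1) (fun i => by
      split_ifs
      exacts [measurable_one.indicator hA, measurable_one]) (k + 1)
  have hprob := dirichletProcess_ae_isProbabilityMeasure hθ (ν.map π)
  have e1 : ∀ ω, ∏ i ∈ Finset.range (k + 1),
      (if i = k then A.indicator (1 : T → ℝ≥0∞) else 1) (p i ω) = A.indicator 1 (p k ω) := by
    intro ω
    rw [Finset.prod_eq_single k]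
    · simp
    · intro i _ hi
      simp [hi]
    · simp
  have e2 : ∀ᵐ m ∂(dirichletProcess θ (ν.map π)), ∏ i ∈ Finset.range (k + 1),
      ∫⁻ y, (if i = k then A.indicator (1 : T → ℝ≥0∞) else 1) y ∂m
        = ∫⁻ y, A.indicator 1 y ∂m := by
    filter_upwards [hprob] with m hm
    rw [Finset.prod_eq_single k]
    · simp
    · intro i _ hi
      simp [hi]
    · simp
  simp only [e1] at h1
  rw [lintegral_congr_ae e2, lintegral_dirichletProcess_lintegral hθ _ (measurable_one.indicator hA)
    (fun y => Set.indicator_le_self' (fun _ _ => zero_le_one) y), lintegral_indicator_one hA] at h1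
  rw [← h1, Measure.map_apply (h.measurable_latent k) hA, ← lintegral_indicator_one
    (h.measurable_latent k hA)]
  rfl

/-- A mixture of i.i.d. sequences is exchangeable. -/
theorem isExchangeable (h : IsDPHierarchy P X θ ν π p Q) (hX : ∀ i, Measurable (X i)) :
    IsExchangeable P X := by
  have key : ∀ (n : ℕ) (A : Fin n → Set E), (∀ i, MeasurableSet (A i)) →
      P {ω | ∀ i : Fin n, X i ω ∈ A i} = ∫⁻ m, ∏ i : Fin n,
        ∫⁻ q, condDistrib id π ν q (A i) ∂m ∂(dirichletProcess θ (ν.map π)) := by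
    intro n A hA
    let A' : ℕ → Set E := fun i => if hi : i < n then A ⟨i, hi⟩ else Set.univ
    have hA' : ∀ i, MeasurableSet (A' i) := by
      intro i
      dsimp only [A']
      split_ifs
      exacts [hA _, MeasurableSet.univ]
    have hA'' : ∀ i : Fin n, A' i = A i := fun i => by simp [A']
    have h1 := h.lintegral_obs hX (g := fun i => (A' i).indicator 1)
      (fun i => measurable_one.indicator (hA' i)) n
    rw [lintegral_prod_indicator hX hA'] at h1
    have e : {ω | ∀ i : Fin n, X i ω ∈ A i} = {ω | ∀ i < n, X i ω ∈ A' i} := by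
      ext ω
      simp only [Set.mem_ofPred_eq]
      exact ⟨fun hω i hi => by simpa [A', hi] using hω ⟨i, hi⟩,
        fun hω i => hA'' i ▸ hω i i.2⟩
    rw [e, h1]
    refine lintegral_congr fun m => ?_
    rw [Finset.prod_range]
    refine Finset.prod_congr rfl fun i _ => lintegral_congr fun q => ?_
    rw [hA'', lintegral_indicator_one (hA i)]
  intro n σ
  have hm1 : Measurable fun ω (i : Fin n) => X (σ i) ω := measurable_pi_lambda _ fun i => hX _
  have hm2 : Measurable fun ω (i : Fin n) => X i ω := measurable_pi_lambda _ fun i => hX _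
  have : IsProbabilityMeasure (P.map fun ω (i : Fin n) => X (σ i) ω) :=
    Measure.isProbabilityMeasure_map hm1.aemeasurable
  refine ext_of_finBox fun A hA => ?_
  rw [Measure.map_apply hm1 (measurableSet_finBox hA), Measure.map_apply hm2
    (measurableSet_finBox hA)]
  have e1 : (fun ω (i : Fin n) => X (σ i) ω) ⁻¹' {x | ∀ i, x i ∈ A i}
      = {ω | ∀ i : Fin n, X i ω ∈ A (σ.symm i)} := by
    ext ω
    simp only [Set.mem_preimage, Set.mem_ofPred_eq]
    exact ⟨fun hω i => by simpa using hω (σ.symm i), fun hω i => by simpa using hω (σ i)⟩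
  rw [e1, key n (fun i => A (σ.symm i)) fun i => hA _]
  refine Eq.trans (lintegral_congr fun m => ?_) (key n A hA).symm
  exact Equiv.prod_comp σ.symm fun i => ∫⁻ q, condDistrib id π ν q (A i) ∂m

/-- The predictive rule of the observations in the hierarchical model. -/
theorem predictive (h : IsDPHierarchy P X θ ν π p Q) (hθ : 0 < θ) (hπ : Measurable π)
    (hX : ∀ i, Measurable (X i)) {g : ℕ → E → ℝ≥0∞} (hg : ∀ i, Measurable (g i))
    (hg1 : ∀ i y, g i y ≤ 1) (n : ℕ) :
    (ENNReal.ofReal θ + n) * ∫⁻ ω, ∏ i ∈ Finset.range (n + 1), g i (X i ω) ∂P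
      = ∫⁻ ω, (∏ i ∈ Finset.range n, g i (X i ω)) * (ENNReal.ofReal θ * (∫⁻ y, g n y ∂ν)
        + ∑ k ∈ Finset.range n, ∫⁻ y, g n y ∂(condDistrib id π ν (π (X k ω)))) ∂P := by
  have hpr : IsProbabilityMeasure (ν.map π) := Measure.isProbabilityMeasure_map hπ.aemeasurable
  set κ := condDistrib id π ν with hκ
  let G : ℕ → T → ℝ≥0∞ := fun i q => ∫⁻ y, g i y ∂(κ q)
  have hG : ∀ i, Measurable (G i) := fun i => (hg i).lintegral_kernel
  have hG1 : ∀ i q, G i q ≤ 1 := fun i q => lintegral_le_one_of_le_one (hg1 i)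
  have hprod : Measurable fun ω => ∏ i ∈ Finset.range n, g i (X i ω) :=
    Finset.measurable_fun_prod _ fun i _ => (hg i).comp (hX i)
  have hGX : ∀ k, Measurable fun ω => G n (π (X k ω)) := fun k =>
    (hG n).comp (hπ.comp (hX k))
  have hν : ∫⁻ q, G n q ∂(ν.map π) = ∫⁻ y, g n y ∂ν := by
    have := lintegral_condDistrib_id (ν := ν) hπ measurable_const (F := fun _ => 1) (hg n)
    simpa [G, one_mul] using this
  have hk : ∀ k ∈ Finset.range n,
      ∫⁻ ω, (∏ i ∈ Finset.range n, g i (X i ω)) * G n (π (X k ω)) ∂P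
      = ∫⁻ m, ∏ i ∈ Finset.range n,
            ∫⁻ y, Function.update G k (fun y => G k y * G n y) i y ∂m
              ∂(dirichletProcess θ (ν.map π)) := by
    intro k hk
    have hu : ∀ i, Measurable (Function.update g k (fun y => g k y * G n (π y)) i) := by
      intro i
      by_cases hik : i = k
      · subst hik
        simpa using! (hg i).mul ((hG n).comp hπ)
      · simpa [hik] using hg i
    have hu' : ∀ i, Measurable (Function.update G k (fun y => G k y * G n y) i) := by
      intro i
      by_cases hik : i = k
      · subst hik
        simpa using! (hG i).mul (hG n)
      · simpa [hik] using hG i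
    -- The extra factor is a function of `π (X k)`. It is absorbed into the `k`-th factor, and
    -- `π (X k) = p k` almost surely turns it into a function of the latent variable.
    have e1 : ∀ ω, (∏ i ∈ Finset.range n, g i (X i ω)) * G n (π (X k ω))
        = ∏ i ∈ Finset.range n, Function.update g k (fun y => g k y * G n (π y)) i (X i ω) := by
      intro ω
      rw [← Finset.mul_prod_erase _ _ hk, ← Finset.mul_prod_erase _ _ hk, Function.update_self,
        mul_right_comm]
      congr 1
      refine Finset.prod_congr rfl fun i hi => ?_
      rw [Function.update_of_ne (Finset.ne_of_mem_erase hi)]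
    simp only [e1]
    rw [h.lintegral_obs_eq_latent hX hu, ← h.lintegral_latent hu']
    have hae := condDistrib_id_mul_comp (ν := ν) hπ (hG n) (hg k)
    rw [← h.map_latent hθ hπ k] at hae
    have hae' := ae_of_ae_map (h.measurable_latent k).aemeasurable hae
    refine lintegral_congr_ae ?_
    filter_upwards [hae'] with ω hω
    refine Finset.prod_congr rfl fun i _ => ?_
    by_cases hik : i = k
    · subst hik
      simp only [Function.update_self]
      exact hω
    · simp only [Function.update_of_ne hik]
      rfl
  have key := dirichletProcess_predictive hθ (ν.map π) hG hG1 n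
  rw [h.lintegral_obs hX hg, key, hν]
  simp only [mul_add, Finset.mul_sum]
  rw [lintegral_add_left (hprod.mul_const _), lintegral_mul_const _ hprod,
    lintegral_finsetSum _ fun k _ => hprod.fun_mul (hGX k), h.lintegral_obs hX hg,
    mul_comm (ENNReal.ofReal θ * _)]
  congr 1
  exact (Finset.sum_congr rfl hk).symm

/-- The observations of the hierarchical model form a measure-valued Pólya sequence, with
reinforcement `R_x = ν(· ∣ π = π(x))`. -/
theorem isMVPS (h : IsDPHierarchy P X θ ν π p Q) (hθ : 0 < θ) (hπ : Measurable π)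
    (hX : ∀ i, Measurable (X i)) : IsMVPS P X θ ν ((condDistrib id π ν).comap π hπ) where
  theta_pos := hθ
  isProbabilityMeasure := inferInstance
  finite_kernel _ := inferInstance
  map_zero := by
    have hθ' : ENNReal.ofReal θ ≠ 0 := by simpa using hθ
    ext A hA
    have := h.predictive hθ hπ hX (g := fun _ => A.indicator 1)
      (fun _ => measurable_one.indicator hA)
      (fun _ y => Set.indicator_le_self' (fun _ _ => zero_le_one) y) 0
    simp only [Nat.cast_zero, add_zero, zero_add, Finset.range_one, Finset.prod_singleton,
      Finset.range_zero, Finset.prod_empty, Finset.sum_empty, one_mul, lintegral_const,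
      measure_univ, mul_one, lintegral_indicator_one hA] at this
    rw [ENNReal.mul_right_inj hθ' ENNReal.ofReal_ne_top] at this
    rw [← this, Measure.map_apply (hX 0) hA, ← lintegral_indicator_one (hX 0 hA)]
    rfl
  predictive n A hA := by
    have hXm : Measurable fun ω (i : Fin (n + 1)) => X i ω := measurable_pi_lambda _ fun i => hX _
    set κ := condDistrib id π ν with hκ
    have hmass : ∀ ω, θ + ∑ i : Fin (n + 1), ((κ.comap π hπ) (X i ω)).real Set.univ
        = θ + (n + 1) := by
      intro ω
      simp
    simp only [hmass]
    have hpos : 0 < θ + (n + 1) := by positivity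
    -- the predictive probability as a function of the first `n + 1` observations
    let f : (Fin (n + 1) → E) → ℝ := fun x =>
      (θ * ν.real A + ∑ i : Fin (n + 1), (κ (π (x i))).real A) / (θ + (n + 1))
    have hfm : Measurable f := by
      refine (measurable_const.add (Finset.measurable_fun_sum _ fun i _ => ?_)).div_const _
      exact ((Kernel.measurable_coe κ hA).comp (hπ.comp (measurable_pi_apply i))).ennreal_toReal
    have hf0 : ∀ x, 0 ≤ f x := fun x => by positivity
    have hfeq : ∀ x, ENNReal.ofReal (f x) = (ENNReal.ofReal θ + ((n + 1 : ℕ) : ℝ≥0∞))⁻¹ *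
        (ENNReal.ofReal θ * ν A + ∑ i : Fin (n + 1), κ (π (x i)) A) := by
      intro x
      rw [ENNReal.ofReal_div_of_pos hpos, ENNReal.div_eq_inv_mul,
        ENNReal.ofReal_add hθ.le (by positivity), ENNReal.ofReal_add
        (by positivity : 0 ≤ θ * ν.real A) (by positivity), ENNReal.ofReal_mul hθ.le,
        ofReal_measureReal,
        ENNReal.ofReal_sum_of_nonneg fun _ _ => measureReal_nonneg,
        Finset.sum_congr rfl fun (i : Fin (n + 1)) _ => ofReal_measureReal (μ := κ (π (x i)))]
      congr 3
      exact_mod_cast ENNReal.ofReal_natCast (n + 1)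
    have hlaw : (P.restrict (X (n + 1) ⁻¹' A)).map (fun ω (i : Fin (n + 1)) => X i ω)
        = (P.map (fun ω (i : Fin (n + 1)) => X i ω)).withDensity
          fun x => ENNReal.ofReal (f x) := by
      refine ext_of_finBox fun B hB => ?_
      have hbox := measurableSet_finBox hB
      rw [Measure.map_apply hXm hbox, Measure.restrict_apply (hXm hbox),
        withDensity_apply _ hbox, setLIntegral_map hbox hfm.ennreal_ofReal hXm]
      -- The predictive rule is applied to the box `B` for the first `n + 1` observations, followed
      -- by `A` for the next one.
      let B' : ℕ → Set E := fun i => if hi : i < n + 1 then B ⟨i, hi⟩ else A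
      have hB' : ∀ i, MeasurableSet (B' i) := by
        intro i
        dsimp only [B']
        split_ifs
        exacts [hB _, hA]
      have hB0 : ∀ i (hi : i < n + 1), B' i = B ⟨i, hi⟩ := fun i hi => dif_pos hi
      have hBn : B' (n + 1) = A := by simp [B']
      have hmem : ∀ ω, ω ∈ (fun ω (i : Fin (n + 1)) => X i ω) ⁻¹' {x | ∀ i, x i ∈ B i}
          ↔ ∀ i < n + 1, X i ω ∈ B' i := by
        intro ω
        simp only [Set.mem_preimage, Set.mem_ofPred_eq]
        exact ⟨fun hω i hi => hB0 i hi ▸ hω ⟨i, hi⟩, fun hω i => hB0 i i.2 ▸ hω i i.2⟩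
      have key := h.predictive hθ hπ hX (g := fun i => (B' i).indicator 1)
        (fun i => measurable_one.indicator (hB' i))
        (fun i y => Set.indicator_le_self' (fun _ _ => zero_le_one) y) (n + 1)
      rw [lintegral_prod_indicator hX hB'] at key
      have e1 : {ω | ∀ i < n + 1 + 1, X i ω ∈ B' i}
          = (fun ω (i : Fin (n + 1)) => X i ω) ⁻¹' {x | ∀ i, x i ∈ B i} ∩ X (n + 1) ⁻¹' A := by
        ext ω
        rw [Set.mem_inter_iff, hmem, Set.mem_ofPred_eq, Set.mem_preimage, Nat.forall_lt_succ_right,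
          hBn]
      rw [← e1]
      have hc0 : ENNReal.ofReal θ + ((n + 1 : ℕ) : ℝ≥0∞) ≠ 0 := by simp
      have hct : ENNReal.ofReal θ + ((n + 1 : ℕ) : ℝ≥0∞) ≠ ∞ :=
        ENNReal.add_ne_top.2 ⟨ENNReal.ofReal_ne_top, ENNReal.natCast_ne_top _⟩
      rw [← ENNReal.mul_right_inj hc0 hct, key, ← lintegral_indicator (hXm hbox),
        ← lintegral_const_mul' _ _ hct]
      refine lintegral_congr fun ω => ?_
      rw [prod_indicator_one B' fun i => X i ω]
      by_cases hω : ∀ i < n + 1, X i ω ∈ B' i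
      · rw [Set.indicator_of_mem (by exact hω), Set.indicator_of_mem ((hmem ω).2 hω), hfeq,
          ← mul_assoc, ENNReal.mul_inv_cancel hc0 hct, hBn, Finset.sum_range]
        simp only [Pi.one_apply, lintegral_indicator_one hA, one_mul, hκ]
      · rw [Set.indicator_of_notMem (by exact hω),
          Set.indicator_of_notMem (fun hh => hω ((hmem ω).1 hh))]
        simp
    refine condExp_eq_of_measure_inter_eq hXm.comap_le (hX _ hA)
      (f := fun ω => f fun i => X i ω) (hfm.comp (comap_measurable _)) (fun ω => hf0 _) ?_
    rintro _ ⟨B, hB, rfl⟩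
    have := congrArg (fun μ : Measure (Fin (n + 1) → E) => μ B) hlaw
    simp only [withDensity_apply _ hB] at this
    rwa [Measure.map_apply hXm hB, Measure.restrict_apply (hXm hB),
      setLIntegral_map hB hfm.ennreal_ofReal hXm] at this

end IsDPHierarchy

end Backward

/-! ### Joint laws of Pólya sequences -/

section UrnSequence

variable {Ω : Type u} {E : Type w} [MeasurableSpace Ω] [MeasurableSpace E]
  {P : Measure Ω} {X : ℕ → Ω → E} {θ : ℝ} {ν : Measure E}
  {R : Kernel E E}

/-- The unnormalised predictive measure `θ ν + ∑ i, R_{x i}` given the observations `x`. -/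
def urnState (θ : ℝ) (ν : Measure E) (R : Kernel E E) {n : ℕ} (x : Fin n → E) : Measure E :=
  ENNReal.ofReal θ • ν + ∑ i, R (x i)

theorem urnState_apply {n : ℕ} (x : Fin n → E) (A : Set E) :
    urnState θ ν R x A = ENNReal.ofReal θ * ν A + ∑ i, R (x i) A := by
  simp [urnState]

theorem measurable_urnState {n : ℕ} : Measurable (urnState θ ν R (n := n)) := by
  refine Measure.measurable_of_measurable_coe _ fun A hA => ?_
  simp only [urnState_apply]
  exact measurable_const.add (Finset.measurable_fun_sum _ fun i _ =>
    (Kernel.measurable_coe R hA).comp (measurable_pi_apply i))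

theorem urnState_snoc {n : ℕ} (X : ℕ → E) :
    urnState θ ν R (fun i : Fin (n + 1) => X i)
      = urnState θ ν R (fun i : Fin n => X i) + R (X n) := by
  simp [urnState, Fin.sum_univ_castSucc, add_assoc]

/-- The predictive law given the first `n` observations, as a kernel. -/
def urnKernel (θ : ℝ) (ν : Measure E) (R : Kernel E E) (n : ℕ) : Kernel (Fin n → E) E :=
  (normalizeKernel E).comap (urnState θ ν R) measurable_urnState

theorem urnKernel_apply {n : ℕ} (x : Fin n → E) :
    urnKernel θ ν R n x = normalizeKernel E (urnState θ ν R x) := rfl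

instance isFiniteKernel_urnKernel (n : ℕ) : IsFiniteKernel (urnKernel θ ν R n) := by
  unfold urnKernel
  infer_instance

/-- The predictive rule of a measure-valued Pólya sequence, as a family of joint laws. It includes
the law of the first observation. -/
def IsUrnSequence (P : Measure Ω) (X : ℕ → Ω → E) (θ : ℝ) (ν : Measure E) (R : Kernel E E) :
    Prop :=
  ∀ n : ℕ, P.map (fun ω => ((fun i : Fin n => X i ω), X n ω))
    = (P.map fun ω (i : Fin n) => X i ω) ⊗ₘ urnKernel θ ν R n

theorem measurable_prefix (hX : ∀ i, Measurable (X i)) (n : ℕ) :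
    Measurable fun ω (i : Fin n) => X i ω :=
  measurable_pi_lambda _ fun i => hX i

theorem IsMVPS.isUrnSequence [IsProbabilityMeasure P] (h : IsMVPS P X θ ν R)
    (hX : ∀ i, Measurable (X i)) :
    IsUrnSequence P X θ ν R := by
  have hν := h.isProbabilityMeasure
  have hRf := h.finite_kernel
  have hθ := h.theta_pos
  intro n
  have hpre := measurable_prefix hX n
  refine Measure.ext_prod fun {B A} hB hA => ?_
  rw [Measure.map_apply (hpre.prodMk (hX n)) (hB.prod hA), Measure.compProd_apply_prod hB hA,
    setLIntegral_map hB (Kernel.measurable_coe _ hA) hpre]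
  have e : (fun ω => ((fun i : Fin n => X i ω), X n ω)) ⁻¹' B ×ˢ A
      = (fun ω (i : Fin n) => X i ω) ⁻¹' B ∩ X n ⁻¹' A := rfl
  rw [e]
  cases n with
  | zero =>
    have e0 : ∀ ω, urnKernel θ ν R 0 (fun i => X i ω) A = ν A := by
      intro ω
      rw [urnKernel_apply, urnState, Finset.univ_eq_empty, Finset.sum_empty, add_zero,
        normalizeKernel_smul (by simpa using hθ) ENNReal.ofReal_ne_top,
        normalizeKernel_of_isProbabilityMeasure]
    simp only [e0]
    rw [setLIntegral_const]
    rcases Subsingleton.set_cases (p := fun B => B = ∅ ∨ B = Set.univ) (by simp) (by simp) B with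
      rfl | rfl
    · simp
    · simp only [Set.preimage_univ, Set.univ_inter, measure_univ, mul_one]
      rw [← h.map_zero, Measure.map_apply (hX 0) hA]
  | succ n =>
    rw [measure_inter_eq_setLIntegral_of_condExp hpre.comap_le (hX _ hA)
      (fun ω => by positivity) (h.predictive n A hA) ⟨B, hB, rfl⟩]
    refine lintegral_congr fun ω => ?_
    have hs : ∀ A : Set E, ENNReal.ofReal (∑ i : Fin (n + 1), (R (X i ω)).real A)
        = ∑ i : Fin (n + 1), R (X i ω) A := fun A => by
      rw [ENNReal.ofReal_sum_of_nonneg fun _ _ => measureReal_nonneg]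
      exact Finset.sum_congr rfl fun i _ => ofReal_measureReal
    rw [urnKernel_apply, normalizeKernel_apply, Measure.smul_apply, smul_eq_mul, urnState_apply,
      urnState_apply, measure_univ, mul_one, ENNReal.ofReal_div_of_pos (by positivity),
      ENNReal.div_eq_inv_mul, ENNReal.ofReal_add hθ.le (by positivity),
      ENNReal.ofReal_add (by positivity) (by positivity), ENNReal.ofReal_mul hθ.le,
      ofReal_measureReal, hs, hs]

/-- The joint law of the first `n` observations together with the next one. -/
theorem IsUrnSequence.lintegral_succ [IsProbabilityMeasure P] (h : IsUrnSequence P X θ ν R)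
    (hX : ∀ i, Measurable (X i)) (n : ℕ) {φ : (Fin n → E) → E → ℝ≥0∞}
    (hφ : Measurable (Function.uncurry φ)) :
    ∫⁻ ω, φ (fun i => X i ω) (X n ω) ∂P
      = ∫⁻ ω, ∫⁻ y, φ (fun i => X i ω) y
          ∂(normalizeKernel E (urnState θ ν R fun i : Fin n => X i ω)) ∂P := by
  have hpre := measurable_prefix hX n
  have h1 := lintegral_map (μ := P) hφ (hpre.prodMk (hX n))
  rw [h n, Measure.lintegral_compProd hφ] at h1
  simp only [Function.uncurry_apply_pair] at h1
  rw [lintegral_map (Measurable.lintegral_kernel_prod_right (κ := urnKernel θ ν R n) hφ) hpre] at h1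
  exact h1.symm

/-- The joint law of the initial observations together with the next two. -/
theorem IsUrnSequence.lintegral_succ_succ [IsProbabilityMeasure P] (h : IsUrnSequence P X θ ν R)
    (hX : ∀ i, Measurable (X i)) (n : ℕ) {φ : (Fin n → E) → E → E → ℝ≥0∞}
    (hφ : Measurable fun q : (Fin n → E) × E × E => φ q.1 q.2.1 q.2.2) :
    ∫⁻ ω, φ (fun i => X i ω) (X n ω) (X (n + 1) ω) ∂P
      = ∫⁻ ω, ∫⁻ y, ∫⁻ z, φ (fun i => X i ω) y z
          ∂(normalizeKernel E ((urnState θ ν R fun i : Fin n => X i ω) + R y))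
          ∂(normalizeKernel E (urnState θ ν R fun i : Fin n => X i ω)) ∂P := by
  have h1 := h.lintegral_succ hX (n + 1)
    (φ := fun x z => φ (fun i => x i.castSucc) (x (Fin.last n)) z) (hφ.comp
      (f := fun q : (Fin (n + 1) → E) × E => ((fun i : Fin n => q.1 i.castSucc),
        q.1 (Fin.last n), q.2)) (by fun_prop))
  simp only [Fin.val_castSucc, Fin.val_last] at h1
  have hst : ∀ ω, urnState θ ν R (fun i : Fin (n + 1) => X i ω)
      = urnState θ ν R (fun i : Fin n => X i ω) + R (X n ω) := fun ω =>
    urnState_snoc fun i => X i ω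
  simp only [hst] at h1
  rw [h1]
  refine h.lintegral_succ hX n (φ := fun x y => ∫⁻ z, φ x y z
    ∂(normalizeKernel E (urnState θ ν R x + R y))) ?_
  exact Measurable.lintegral_normalizeKernel (a := fun q : (Fin n → E) × E =>
    urnState θ ν R q.1 + R q.2) (φ := fun q z => φ q.1 q.2 z)
    ((measurable_urnState.comp measurable_fst).measure_add (R.measurable.comp measurable_snd))
    (hφ.comp (f := fun q : ((Fin n → E) × E) × E => (q.1.1, q.1.2, q.2)) (by fun_prop))

/-- The first two draws from the urn with composition `m` and reinforcement `R` are
exchangeable. -/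
def SymmetricDraws (R : Kernel E E) (m : Measure E) : Prop :=
  ∀ φ : E → E → ℝ≥0∞, Measurable (Function.uncurry φ) →
    ∫⁻ y, ∫⁻ z, φ y z ∂(normalizeKernel E (m + R y)) ∂(normalizeKernel E m)
      = ∫⁻ y, ∫⁻ z, φ z y ∂(normalizeKernel E (m + R y)) ∂(normalizeKernel E m)

theorem IsExchangeable.lintegral_swap (h : IsExchangeable P X) (hX : ∀ i, Measurable (X i))
    (n : ℕ) {φ : (Fin n → E) → E → E → ℝ≥0∞}
    (hφ : Measurable fun q : (Fin n → E) × E × E => φ q.1 q.2.1 q.2.2) :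
    ∫⁻ ω, φ (fun i => X i ω) (X n ω) (X (n + 1) ω) ∂P
      = ∫⁻ ω, φ (fun i => X i ω) (X (n + 1) ω) (X n ω) ∂P := by
  let a : Fin (n + 2) := ⟨n, by omega⟩
  let b : Fin (n + 2) := ⟨n + 1, by omega⟩
  let c : Fin n → Fin (n + 2) := fun i => ⟨i, by omega⟩
  have hψ : Measurable fun x : Fin (n + 2) → E => φ (fun i => x (c i)) (x a) (x b) :=
    hφ.comp (f := fun x : Fin (n + 2) → E => ((fun i => x (c i)), x a, x b)) (by fun_prop)
  have h1 := lintegral_map (μ := P) hψ (measurable_prefix hX (n + 2))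
  have h2 := lintegral_map (μ := P) hψ
    (measurable_pi_lambda (fun ω i => X (Equiv.swap a b i) ω) fun i => hX _)
  rw [h (n + 2) (Equiv.swap a b), h1] at h2
  refine h2.trans (lintegral_congr fun ω => ?_)
  have hc : ∀ i, Equiv.swap a b (c i) = c i := fun i =>
    Equiv.swap_apply_of_ne_of_ne (by simp [a, c, Fin.ext_iff]; omega)
      (by simp [b, c, Fin.ext_iff]; omega)
  simp only [hc, Equiv.swap_apply_left, Equiv.swap_apply_right]
  rfl

variable [StandardBorelSpace E]

/-- In an exchangeable urn sequence the next two draws are exchangeable given the past. -/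
theorem IsUrnSequence.ae_symmetricDraws [IsProbabilityMeasure P] (h : IsUrnSequence P X θ ν R)
    (hX : ∀ i, Measurable (X i)) (hex : IsExchangeable P X) (n : ℕ) :
    ∀ᵐ x ∂(P.map fun ω (i : Fin n) => X i ω), SymmetricDraws R (urnState θ ν R x) := by
  have hpre := measurable_prefix hX n
  have hm2 : Measurable fun q : (Fin n → E) × E => urnState θ ν R q.1 + R q.2 :=
    (measurable_urnState.comp measurable_fst).measure_add (R.measurable.comp measurable_snd)
  let K : Kernel (Fin n → E) (E × E) :=
    urnKernel θ ν R n ⊗ₖ (normalizeKernel E).comap _ hm2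
  have hK : ∀ (x : Fin n → E) (ψ : E × E → ℝ≥0∞), Measurable ψ → ∫⁻ r, ψ r ∂(K x)
      = ∫⁻ y, ∫⁻ z, ψ (y, z) ∂(normalizeKernel E (urnState θ ν R x + R y))
        ∂(normalizeKernel E (urnState θ ν R x)) := fun x ψ hψ =>
    Kernel.lintegral_compProd _ _ _ hψ
  have hfin : IsFiniteMeasure (P.map fun ω (i : Fin n) => X i ω) := inferInstance
  -- `K` is the law of the next two draws given the past. Exchangeability says that swapping them
  -- does not change the joint law with the past, and disintegrations are almost surely unique.
  have heq : (P.map fun ω (i : Fin n) => X i ω) ⊗ₘ K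
      = (P.map fun ω (i : Fin n) => X i ω) ⊗ₘ (K.map Prod.swap) := by
    refine Measure.ext fun B hB => ?_
    have hφ : Measurable fun q : (Fin n → E) × E × E =>
        B.indicator (1 : (Fin n → E) × E × E → ℝ≥0∞) q :=
      measurable_one.indicator hB
    have hφs : Measurable fun q : (Fin n → E) × E × E =>
        B.indicator (1 : (Fin n → E) × E × E → ℝ≥0∞) (q.1, q.2.2, q.2.1) :=
      hφ.comp (f := fun q : (Fin n → E) × E × E => (q.1, q.2.2, q.2.1)) (by fun_prop)
    rw [← lintegral_indicator_one hB, ← lintegral_indicator_one hB,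
      Measure.lintegral_compProd hφ, Measure.lintegral_compProd hφ,
      lintegral_map (Measurable.lintegral_kernel_prod_right' (κ := K) hφ) hpre,
      lintegral_map (Measurable.lintegral_kernel_prod_right' (κ := K.map Prod.swap) hφ) hpre]
    have e1 := h.lintegral_succ_succ hX n (φ := fun x y z => B.indicator 1 (x, y, z)) hφ
    have e2 := h.lintegral_succ_succ hX n (φ := fun x y z => B.indicator 1 (x, z, y)) hφs
    have e3 := hex.lintegral_swap hX n (φ := fun x y z => B.indicator 1 (x, y, z)) hφ
    rw [e1, e2] at e3
    refine Eq.trans (lintegral_congr fun ω => ?_) (e3.trans (lintegral_congr fun ω => ?_))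
    · exact hK _ _ (hφ.comp measurable_prodMk_left)
    · rw [Kernel.map_apply _ measurable_swap, lintegral_map
        (f := fun r => B.indicator 1 ((fun i : Fin n => X i ω), r))
        (hφ.comp measurable_prodMk_left) measurable_swap]
      exact (hK _ _ (hφs.comp measurable_prodMk_left)).symm
  filter_upwards [Kernel.ae_eq_of_compProd_eq heq] with x hx φ hφ
  have := hK x (Function.uncurry φ) hφ
  simp only [Function.uncurry_apply_pair] at this
  rw [← this, hx, Kernel.map_apply _ measurable_swap, lintegral_map hφ measurable_swap,
    hK x (fun r => Function.uncurry φ r.swap) (hφ.comp measurable_swap)]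
  rfl

end UrnSequence

/-! ### A functional equation forces one of two functions to be constant -/

section FunctionalEquation

variable {α : Type*} [MeasurableSpace α] {ν : Measure α} [IsProbabilityMeasure ν]

theorem integrable_of_bounded {f : α → ℝ} (hf : Measurable f) {C : ℝ} (hC : ∀ x, |f x| ≤ C) :
    Integrable f ν :=
  Integrable.of_bound hf.aestronglyMeasurable C (Filter.Eventually.of_forall hC)

/-- If `u ⊗ v + v ⊗ u` is a sum of functions of one variable, then `u` or `v` is constant.
After centring the right-hand side vanishes, and integrating against `u ⊗ v` gives
`Var u · Var v + Cov(u, v)² = 0`. -/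
theorem ae_const_or_ae_const_of_symm_mul {u v d : α → ℝ} (hu : Measurable u) (hv : Measurable v)
    (hd : Measurable d) {C : ℝ} (huC : ∀ x, |u x| ≤ C) (hvC : ∀ x, |v x| ≤ C)
    (hdC : ∀ x, |d x| ≤ C)
    (h : ∀ᵐ x ∂ν, ∀ᵐ y ∂ν, u x * v y + u y * v x + d x + d y = 0) :
    (∃ c, ∀ᵐ x ∂ν, u x = c) ∨ ∃ c, ∀ᵐ x ∂ν, v x = c := by
  have iu := integrable_of_bounded (ν := ν) hu huC
  have iv := integrable_of_bounded (ν := ν) hv hvC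
  have id' := integrable_of_bounded (ν := ν) hd hdC
  set a := ∫ x, u x ∂ν with ha
  set b := ∫ x, v x ∂ν with hb
  set e := ∫ x, d x ∂ν with he
  -- Averaging over `y`, and then over both variables, expresses `d` through `u` and `v`.
  have h1 : ∀ᵐ x ∂ν, u x * b + a * v x + d x + e = 0 := by
    filter_upwards [h] with x hx
    have h0 : ∫ y, (u x * v y + u y * v x + d x + d y) ∂ν = 0 := integral_eq_zero_of_ae hx
    rw [integral_add (by fun_prop) id', integral_add (by fun_prop) (by fun_prop),
      integral_add (by fun_prop) (by fun_prop), integral_const_mul, integral_mul_const] at h0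
    simpa using h0
  have h2 : a * b + a * b + e + e = 0 := by
    have h0 : ∫ x, (u x * b + a * v x + d x + e) ∂ν = 0 := integral_eq_zero_of_ae h1
    rw [integral_add (by fun_prop) (by fun_prop), integral_add (by fun_prop) (by fun_prop),
      integral_add (by fun_prop) (by fun_prop), integral_const_mul, integral_mul_const] at h0
    simpa using h0
  have h3 : ∀ᵐ x ∂ν, ∀ᵐ y ∂ν, (u x - a) * (v y - b) + (u y - a) * (v x - b) = 0 := by
    filter_upwards [h, h1] with x hx hx1
    filter_upwards [hx, h1] with y hy hy1
    linear_combination hy - hx1 - hy1 + h2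
  have hC0 : ∀ x, |u x - a| ≤ C + |a| := fun x => (abs_sub _ _).trans (by gcongr; exact huC x)
  have hC1 : ∀ x, |v x - b| ≤ C + |b| := fun x => (abs_sub _ _).trans (by gcongr; exact hvC x)
  have hCa : 0 ≤ C + |a| := (abs_nonneg _).trans (hC0 (Classical.choice ν.nonempty_of_neZero))
  have hCb : 0 ≤ C + |b| := (abs_nonneg _).trans (hC1 (Classical.choice ν.nonempty_of_neZero))
  have ivv : Integrable (fun y => (v y - b) * (v y - b)) ν :=
    integrable_of_bounded (by fun_prop) (C := (C + |b|) * (C + |b|)) fun x => by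
      rw [abs_mul]
      exact mul_le_mul (hC1 x) (hC1 x) (abs_nonneg _) hCb
  have iuv : Integrable (fun y => (u y - a) * (v y - b)) ν :=
    integrable_of_bounded (by fun_prop) (C := (C + |a|) * (C + |b|)) fun x => by
      rw [abs_mul]
      exact mul_le_mul (hC0 x) (hC1 x) (abs_nonneg _) hCa
  have iuu : Integrable (fun y => (u y - a) * (u y - a)) ν :=
    integrable_of_bounded (by fun_prop) (C := (C + |a|) * (C + |a|)) fun x => by
      rw [abs_mul]
      exact mul_le_mul (hC0 x) (hC0 x) (abs_nonneg _) hCa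
  set V := ∫ y, (v y - b) * (v y - b) ∂ν with hV
  set W := ∫ y, (u y - a) * (v y - b) ∂ν with hW
  set U := ∫ y, (u y - a) * (u y - a) ∂ν with hU
  -- Integrate against `v y - b` in `y`, then against `u x - a` in `x`.
  have h4 : ∀ᵐ x ∂ν, (u x - a) * V + W * (v x - b) = 0 := by
    filter_upwards [h3] with x hx
    have h0 : ∫ y, ((u x - a) * ((v y - b) * (v y - b)) + (u y - a) * (v y - b) * (v x - b)) ∂ν
        = 0 := by
      refine integral_eq_zero_of_ae ?_
      filter_upwards [hx] with y hy
      simp only [Pi.zero_apply]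
      linear_combination (v y - b) * hy
    rwa [integral_add (ivv.const_mul _) (iuv.mul_const _), integral_const_mul,
      integral_mul_const] at h0
  have h5 : U * V + W * W = 0 := by
    have h0 : ∫ x, ((u x - a) * (u x - a) * V + W * ((u x - a) * (v x - b))) ∂ν = 0 := by
      refine integral_eq_zero_of_ae ?_
      filter_upwards [h4] with y hy
      simp only [Pi.zero_apply]
      linear_combination (u y - a) * hy
    rwa [integral_add (iuu.mul_const _) (iuv.const_mul _), integral_const_mul,
      integral_mul_const] at h0
  have hU0 : 0 ≤ U := integral_nonneg fun x => mul_self_nonneg _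
  have hV0 : 0 ≤ V := integral_nonneg fun x => mul_self_nonneg _
  have h6 : U * V = 0 := by nlinarith [mul_nonneg hU0 hV0, mul_self_nonneg W]
  rcases mul_eq_zero.1 h6 with h | h
  · refine Or.inl ⟨a, ?_⟩
    filter_upwards [(integral_eq_zero_iff_of_nonneg (fun x => mul_self_nonneg _) iuu).1 h] with x hx
    exact sub_eq_zero.1 (mul_self_eq_zero.1 hx)
  · refine Or.inr ⟨b, ?_⟩
    filter_upwards [(integral_eq_zero_iff_of_nonneg (fun x => mul_self_nonneg _) ivv).1 h] with x hx
    exact sub_eq_zero.1 (mul_self_eq_zero.1 hx)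

/-- A function that is not almost surely constant takes values on both sides of some gap. -/
theorem exists_gap_of_not_ae_const {f : α → ℝ} (hf0 : ∀ x, 0 ≤ f x)
    (h : ¬ ∃ c, ∀ᵐ x ∂ν, f x = c) :
    ∃ s t K : ℝ, s < t ∧ ν {x | f x ≤ s} ≠ 0 ∧ ν {x | t ≤ f x ∧ f x ≤ K} ≠ 0 := by
  by_contra! H
  have hK : ∀ s t, s < t → ν {x | f x ≤ s} ≠ 0 → ∀ᵐ x ∂ν, f x < t := by
    intro s t hst hs
    have h1 : ∀ᵐ x ∂ν, ∀ K : ℕ, ¬ (t ≤ f x ∧ f x ≤ K) := by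
      rw [ae_all_iff]
      intro K
      have := H s t K hst hs
      rw [ae_iff]
      simpa only [not_not] using this
    filter_upwards [h1] with x hx
    obtain ⟨K, hK⟩ := exists_nat_ge (f x)
    by_contra hxt
    exact hx K ⟨not_lt.1 hxt, hK⟩
  set S : Set ℝ := {s | ν {x | f x ≤ s} = 0} with hS
  have hne : (-1) ∈ S := by
    have : {x | f x ≤ -1} = ∅ := by
      ext x
      simpa using (by linarith [hf0 x] : -1 < f x)
    rw [hS, Set.mem_ofPred_eq, this, measure_empty]
  obtain ⟨n, hn⟩ : ∃ n : ℕ, (n : ℝ) ∉ S := by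
    by_contra! hall
    have : ∀ᵐ x ∂ν, ∀ n : ℕ, ¬ f x ≤ n := by
      rw [ae_all_iff]
      intro n
      rw [ae_iff]
      simp only [not_not]
      exact hall n
    obtain ⟨x, hx⟩ := this.exists
    obtain ⟨K, hK⟩ := exists_nat_ge (f x)
    exact hx K hK
  have hmono : ∀ s ∈ S, ∀ r ≤ s, r ∈ S := fun s hs r hr =>
    measure_mono_null (fun x (hx : f x ≤ r) => hx.trans hr) hs
  have hbdd : BddAbove S := ⟨n, fun s hs => by
    by_contra hlt
    exact hn (hmono s hs n (not_le.1 hlt).le)⟩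
  -- Without a gap, `f` is almost surely equal to the supremum of the levels that it almost surely
  -- exceeds: mass strictly above this supremum would leave a gap.
  refine h ⟨sSup S, ?_⟩
  have hlow : ∀ᵐ x ∂ν, ∀ q : ℚ, (q : ℝ) < sSup S → ¬ f x ≤ q := by
    rw [ae_all_iff]
    intro q
    by_cases hq : (q : ℝ) < sSup S
    · obtain ⟨s, hs, hqs⟩ := exists_lt_of_lt_csSup ⟨_, hne⟩ hq
      have hq0 : ν {x | f x ≤ q} = 0 := hmono s hs q hqs.le
      rw [ae_iff]
      simpa [hq] using hq0
    · exact Filter.Eventually.of_forall fun x hx => absurd hx hq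
  have hup : ∀ᵐ x ∂ν, ∀ q : ℚ, sSup S < q → f x < q := by
    rw [ae_all_iff]
    intro q
    by_cases hq : sSup S < q
    · obtain ⟨r, hr1, hr2⟩ := exists_between hq
      have hr : ν {x | f x ≤ r} ≠ 0 := fun h0 => absurd (le_csSup hbdd h0) (not_le.2 hr1)
      filter_upwards [hK r q hr2 hr] with x hx _ using hx
    · exact Filter.Eventually.of_forall fun x hx => absurd hx hq
  filter_upwards [hlow, hup] with x h1 h2
  refine le_antisymm (le_of_forall_gt_imp_ge_of_dense fun r hr => ?_)
    (le_of_forall_lt_imp_le_of_dense fun r hr => ?_)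
  · obtain ⟨q, hq1, hq2⟩ := exists_rat_btwn hr
    exact ((h2 q hq1).trans hq2).le
  · obtain ⟨q, hq1, hq2⟩ := exists_rat_btwn hr
    exact (hq1.trans (not_le.1 (h1 q hq2))).le

end FunctionalEquation


/-! ### Urns with two exchangeable draws: testing across a gap of the total masses -/

section Gap

variable {E : Type w} [MeasurableSpace E] {R : Kernel E E}

/-- A kernel into finite measures is s-finite, even if the masses are not uniformly bounded. -/
theorem isSFiniteKernel_of_isFiniteMeasure (hR : ∀ x, IsFiniteMeasure (R x)) :
    IsSFiniteKernel R := by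
  have hf : Measurable (Function.uncurry fun (x _ : E) => R x Set.univ) :=
    (R.measurable_coe MeasurableSet.univ).comp measurable_fst
  have h : R = Kernel.withDensity ((normalizeKernel E).comap R R.measurable)
      (fun x _ => R x Set.univ) := by
    ext x A hA
    rw [Kernel.withDensity_apply' _ hf, lintegral_const, Measure.restrict_apply_univ,
      Kernel.comap_apply, normalizeKernel_apply, Measure.smul_apply, smul_eq_mul, ← mul_assoc]
    by_cases h0 : R x Set.univ = 0
    · simp [measure_mono_null (Set.subset_univ A) h0, h0]
    · rw [ENNReal.mul_inv_cancel h0 (measure_ne_top _ _), one_mul]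
  rw [h]
  exact Kernel.IsSFiniteKernel.withDensity _ fun x _ => measure_ne_top (R x) _

/-- Exchangeability of the first two draws, with the normalising denominators cleared by the choice
of the test function. -/
theorem SymmetricDraws.lintegral_swap (hR : ∀ x, IsFiniteMeasure (R x)) {N : Measure E}
    [IsFiniteMeasure N] (hN : N ≠ 0) (h : SymmetricDraws R N) {ψ : E → E → ℝ≥0∞}
    (hψ : Measurable (Function.uncurry ψ)) :
    ∫⁻ y, ∫⁻ z, ψ y z * (N Set.univ + R z Set.univ) ∂(N + R y) ∂N
      = ∫⁻ y, ∫⁻ z, ψ z y * (N Set.univ + R z Set.univ) ∂(N + R y) ∂N := by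
  have hN0 : N Set.univ ≠ 0 := by simpa using hN
  have hf : Measurable fun x => N Set.univ + R x Set.univ :=
    measurable_const.add (R.measurable_coe MeasurableSet.univ)
  have hne : ∀ x, N Set.univ + R x Set.univ ≠ ∞ := fun x =>
    ENNReal.add_ne_top.2 ⟨measure_ne_top _ _, measure_ne_top _ _⟩
  have hne0 : ∀ x, N Set.univ + R x Set.univ ≠ 0 := fun x h => hN0 (add_eq_zero.1 h).1
  have h1 := h (fun y z => ψ y z * (N Set.univ + R z Set.univ) * (N Set.univ + R y Set.univ))
    ((hψ.mul (hf.comp measurable_snd)).mul (hf.comp measurable_fst))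
  have key : ∀ (φ : E → E → ℝ≥0∞), Measurable (Function.uncurry φ) →
      ∫⁻ y, ∫⁻ z, φ y z * (N Set.univ + R y Set.univ) ∂(normalizeKernel E (N + R y))
        ∂(normalizeKernel E N) = (N Set.univ)⁻¹ * ∫⁻ y, ∫⁻ z, φ y z ∂(N + R y) ∂N := by
    intro φ hφ
    rw [lintegral_normalizeKernel]
    congr 1
    refine lintegral_congr fun y => ?_
    rw [lintegral_mul_const _ hφ.of_uncurry_left, lintegral_normalizeKernel, Measure.add_apply,
      mul_comm, ← mul_assoc, ENNReal.mul_inv_cancel (hne0 y) (hne y), one_mul]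
  have h2 : ∫⁻ y, ∫⁻ z, ψ z y * (N Set.univ + R y Set.univ) * (N Set.univ + R z Set.univ)
        ∂(normalizeKernel E (N + R y)) ∂(normalizeKernel E N)
      = ∫⁻ y, ∫⁻ z, ψ z y * (N Set.univ + R z Set.univ) * (N Set.univ + R y Set.univ)
        ∂(normalizeKernel E (N + R y)) ∂(normalizeKernel E N) :=
    lintegral_congr fun y => lintegral_congr fun z => by ring
  replace h1 := h1.trans h2
  rw [key (fun y z => ψ y z * (N Set.univ + R z Set.univ)) (hψ.mul (hf.comp measurable_snd)),
    key (fun y z => ψ z y * (N Set.univ + R z Set.univ))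
      ((hψ.comp measurable_swap).mul (hf.comp measurable_snd))] at h1
  exact (ENNReal.mul_right_inj (ENNReal.inv_ne_zero.2 (measure_ne_top _ _))
    (ENNReal.inv_ne_top.2 hN0)).1 h1

/-- If the total masses are at most `s` on `A` and between `t > s` and `K` on `B`, then
exchangeability tested against `1_A(y) 1_B(z) / (R_z(E) - R_y(E))` isolates the product
`N(A) N(B)`, up to terms that are affine in the composition `N` or a product of its total mass
and a linear term. -/
theorem exists_bounded_symmetricDraws_gap (hR : ∀ x, IsFiniteMeasure (R x)) {A B : Set E}
    (hA : MeasurableSet A) (hB : MeasurableSet B) {s t K : ℝ≥0∞} (hst : s < t) (htK : t ≤ K)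
    (hK : K ≠ ∞) (hAs : ∀ y ∈ A, R y Set.univ ≤ s)
    (hBt : ∀ z ∈ B, t ≤ R z Set.univ ∧ R z Set.univ ≤ K) :
    ∃ (D : ℝ≥0∞) (U V U' V' : E → ℝ≥0∞), D ≠ ∞ ∧ Measurable U ∧ Measurable V ∧ Measurable U' ∧
      Measurable V' ∧ (∀ x, U x ≤ D) ∧ (∀ x, V x ≤ D) ∧ (∀ x, U' x ≤ D) ∧ (∀ x, V' x ≤ D) ∧
      ∀ N : Measure E, IsFiniteMeasure N → N ≠ 0 → SymmetricDraws R N →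
        N A * N B + (N Set.univ * ∫⁻ x, U x ∂N + ∫⁻ x, V x ∂N)
          = N Set.univ * ∫⁻ x, U' x ∂N + ∫⁻ x, V' x ∂N := by
  have := isSFiniteKernel_of_isFiniteMeasure hR
  have hf : Measurable fun x => R x Set.univ := R.measurable_coe MeasurableSet.univ
  set f : E → ℝ≥0∞ := fun x => R x Set.univ with hfdef
  have hδ0 : t - s ≠ 0 := (tsub_pos_of_lt hst).ne'
  have hsK : s ≤ K := hst.le.trans htK
  -- The test function. On `A × B` one has `f y ≤ s < t ≤ f z`, so that the truncated subtraction is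
  -- an honest one and `w` is bounded.
  set w : E → E → ℝ≥0∞ := fun y z => A.indicator 1 y * B.indicator 1 z * (f z - f y)⁻¹ with hw
  have hwm : Measurable (Function.uncurry w) :=
    (((measurable_one.indicator hA).comp measurable_fst).mul
      ((measurable_one.indicator hB).comp measurable_snd)).mul
      ((hf.comp measurable_snd).sub (hf.comp measurable_fst)).inv
  have hwm' : Measurable (Function.uncurry fun y z => w z y) := hwm.comp measurable_swap
  have hwA : ∀ y z, y ∉ A → w y z = 0 := fun y z hy => by simp [hw, hy]
  have hwB : ∀ y z, z ∉ B → w y z = 0 := fun y z hz => by simp [hw, hz]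
  have hwb : ∀ y z, w y z ≤ (t - s)⁻¹ := by
    intro y z
    by_cases hy : y ∈ A
    · by_cases hz : z ∈ B
      · simp only [hw, hy, hz, Set.indicator_of_mem, Pi.one_apply, one_mul]
        exact ENNReal.inv_le_inv.2 (tsub_le_tsub (hBt z hz).1 (hAs y hy))
      · simp [hwB y z hz]
    · simp [hwA y z hy]
  -- This identity is the reason for the choice of `w`: it produces the product `1_A(y) 1_B(z)`.
  have hwf : ∀ y z, w y z * f z = w y z * f y + A.indicator 1 y * B.indicator 1 z := by
    intro y z
    by_cases hy : y ∈ A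
    · by_cases hz : z ∈ B
      · simp only [hw, hy, hz, Set.indicator_of_mem, Pi.one_apply, one_mul]
        have hlt : f y < f z := (hAs y hy).trans_lt (hst.trans_le (hBt z hz).1)
        have h1 : (f z - f y)⁻¹ * (f z - f y) = 1 :=
          ENNReal.inv_mul_cancel (tsub_pos_of_lt hlt).ne'
            (ENNReal.sub_ne_top (measure_ne_top _ _))
        calc (f z - f y)⁻¹ * f z = (f z - f y)⁻¹ * (f z - f y + f y) := by
              rw [tsub_add_cancel_of_le hlt.le]
          _ = _ := by rw [mul_add, h1, add_comm]
      · simp [hwB y z hz, hz]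
    · simp [hwA y z hy, hy]
  have hfK : ∀ y z, w y z * f z ≤ w y z * K := by
    intro y z
    by_cases hz : z ∈ B
    · gcongr
      exact (hBt z hz).2
    · simp [hwB y z hz]
  have hfK' : ∀ y z, w y z * f y ≤ w y z * K := by
    intro y z
    by_cases hy : y ∈ A
    · gcongr
      exact (hAs y hy).trans hsK
    · simp [hwA y z hy]
  set D : ℝ≥0∞ := (t - s)⁻¹ * K with hD
  have hDtop : D ≠ ∞ := ENNReal.mul_ne_top (ENNReal.inv_ne_top.2 hδ0) hK
  have hU : ∀ y, ∫⁻ z, w y z ∂(R y) ≤ D := by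
    intro y
    by_cases hy : y ∈ A
    · refine (lintegral_mono fun z => hwb y z).trans ?_
      rw [lintegral_const]
      exact mul_le_mul_right ((hAs y hy).trans hsK) _
    · simp [hwA y _ hy]
  have hU' : ∀ y, ∫⁻ z, w z y ∂(R y) ≤ D := by
    intro y
    by_cases hy : y ∈ B
    · refine (lintegral_mono fun z => hwb z y).trans ?_
      rw [lintegral_const]
      exact mul_le_mul_right (hBt y hy).2 _
    · simp [hwB _ y hy]
  have hV : ∀ y, ∫⁻ z, w y z * f z ∂(R y) ≤ D * K := fun y =>
    (lintegral_mono fun z => hfK y z).trans (by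
      rw [lintegral_mul_const _ hwm.of_uncurry_left]
      exact mul_le_mul_left (hU y) K)
  have hV' : ∀ y, ∫⁻ z, w z y * f z ∂(R y) ≤ D * K := fun y =>
    (lintegral_mono fun z => hfK' z y).trans (by
      rw [lintegral_mul_const _ hwm'.of_uncurry_left]
      exact mul_le_mul_left (hU' y) K)
  have mU : Measurable fun y => ∫⁻ z, w y z ∂(R y) :=
    Measurable.lintegral_kernel_prod_right (κ := R) hwm
  have mU' : Measurable fun y => ∫⁻ z, w z y ∂(R y) :=
    Measurable.lintegral_kernel_prod_right (κ := R) hwm'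
  have mV : Measurable fun y => ∫⁻ z, w y z * f z ∂(R y) :=
    Measurable.lintegral_kernel_prod_right (κ := R) (f := fun y z => w y z * f z)
      (hwm.mul (hf.comp measurable_snd))
  have mV' : Measurable fun y => ∫⁻ z, w z y * f z ∂(R y) :=
    Measurable.lintegral_kernel_prod_right (κ := R) (f := fun y z => w z y * f z)
      (hwm'.mul (hf.comp measurable_snd))
  refine ⟨max D (D * K), _, _, _, _, max_ne_top hDtop (ENNReal.mul_ne_top hDtop hK),
    mU, mV, mU', mV', fun x => (hU x).trans (le_max_left _ _),
    fun x => (hV x).trans (le_max_right _ _), fun x => (hU' x).trans (le_max_left _ _),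
    fun x => (hV' x).trans (le_max_right _ _), fun N hNf hN0 hN => ?_⟩
  have h1 := hN.lintegral_swap hR hN0 hwm
  have hsplit : ∀ φ : E → E → ℝ≥0∞, Measurable (Function.uncurry φ) →
      ∫⁻ y, ∫⁻ z, φ y z * (N Set.univ + f z) ∂(N + R y) ∂N
        = ∫⁻ y, ∫⁻ z, φ y z * (N Set.univ + f z) ∂N ∂N
          + (N Set.univ * ∫⁻ y, ∫⁻ z, φ y z ∂(R y) ∂N + ∫⁻ y, ∫⁻ z, φ y z * f z ∂(R y) ∂N) := by
    intro φ hφ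
    have hφm : Measurable (Function.uncurry fun y z => φ y z * (N Set.univ + f z)) :=
      hφ.mul (measurable_const.add (hf.comp measurable_snd))
    simp only [lintegral_add_measure]
    rw [lintegral_add_left hφm.lintegral_prod_right]
    congr 1
    rw [← lintegral_const_mul _ (Measurable.lintegral_kernel_prod_right (κ := R) hφ),
      ← lintegral_add_left ((Measurable.lintegral_kernel_prod_right (κ := R) hφ).const_mul _)]
    refine lintegral_congr fun y => ?_
    rw [← lintegral_const_mul _ hφ.of_uncurry_left,
      ← lintegral_add_left (hφ.of_uncurry_left.const_mul _)]
    exact lintegral_congr fun z => by ring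
  rw [hsplit w hwm, hsplit (fun y z => w z y) hwm'] at h1
  have hLm : Measurable (Function.uncurry fun y z => w y z * (N Set.univ + f y)) :=
    hwm.mul (measurable_const.add (hf.comp measurable_fst))
  -- The part quadratic in `N` of the two sides is `L + N A * N B` and `L`. Since `L` is finite, it
  -- cancels.
  set L := ∫⁻ y, ∫⁻ z, w y z * (N Set.univ + f y) ∂N ∂N with hL
  have hL2 : ∫⁻ y, ∫⁻ z, w z y * (N Set.univ + f z) ∂N ∂N = L :=
    (lintegral_lintegral_swap (f := fun y z => w y z * (N Set.univ + f y)) hLm.aemeasurable).symm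
  have hL1 : ∫⁻ y, ∫⁻ z, w y z * (N Set.univ + f z) ∂N ∂N = L + N A * N B := by
    have e : ∀ y z, w y z * (N Set.univ + f z)
        = w y z * (N Set.univ + f y) + A.indicator 1 y * B.indicator 1 z := fun y z => by
      rw [mul_add, hwf, mul_add, add_assoc]
    simp only [e]
    rw [hL, ← lintegral_indicator_one hA, ← lintegral_indicator_one hB,
      ← lintegral_mul_const _ (measurable_one.indicator hA),
      ← lintegral_add_left hLm.lintegral_prod_right]
    refine lintegral_congr fun y => ?_
    rw [lintegral_add_left hLm.of_uncurry_left,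
      lintegral_const_mul _ (measurable_one.indicator hB)]
  have hLtop : L ≠ ∞ := by
    have hle : ∀ y z, w y z * (N Set.univ + f y) ≤ (t - s)⁻¹ * (N Set.univ + K) := fun y z => by
      rw [mul_add, mul_add]
      exact add_le_add (mul_le_mul_left (hwb y z) _)
        ((hfK' y z).trans (mul_le_mul_left (hwb y z) _))
    refine ne_top_of_le_ne_top ?_ (lintegral_mono fun y => lintegral_mono fun z => hle y z)
    simp only [lintegral_const]
    exact ENNReal.mul_ne_top (ENNReal.mul_ne_top (ENNReal.mul_ne_top (ENNReal.inv_ne_top.2 hδ0)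
      (ENNReal.add_ne_top.2 ⟨measure_ne_top _ _, hK⟩)) (measure_ne_top _ _)) (measure_ne_top _ _)
  rw [hL1, hL2, add_assoc] at h1
  exact (ENNReal.add_right_inj hLtop).1 h1

/-- The second difference of the identity of `exists_bounded_symmetricDraws_gap` along two
directions `ρ`, `σ`. The terms `V`, `V'` cancel. -/
theorem second_difference_of_quadratic_identity {A B : Set E} {U V U' V' : E → ℝ≥0∞} {D : ℝ≥0∞}
    (hD : D ≠ ∞) (hU : ∀ x, U x ≤ D) (hV : ∀ x, V x ≤ D) (hU' : ∀ x, U' x ≤ D)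
    (hV' : ∀ x, V' x ≤ D) {α ρ σ : Measure E} [IsFiniteMeasure α] [IsFiniteMeasure ρ]
    [IsFiniteMeasure σ]
    (h : ∀ N ∈ ({α, α + ρ, α + σ, α + ρ + σ} : Set (Measure E)),
      N A * N B + (N Set.univ * ∫⁻ x, U x ∂N + ∫⁻ x, V x ∂N)
          = N Set.univ * ∫⁻ x, U' x ∂N + ∫⁻ x, V' x ∂N) :
    ρ.real A * σ.real B + σ.real A * ρ.real B
      + ρ.real Set.univ * ((∫⁻ x, U x ∂σ).toReal - (∫⁻ x, U' x ∂σ).toReal)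
      + σ.real Set.univ * ((∫⁻ x, U x ∂ρ).toReal - (∫⁻ x, U' x ∂ρ).toReal) = 0 := by
  have fin : ∀ {g : E → ℝ≥0∞} (N : Measure E) [IsFiniteMeasure N], (∀ x, g x ≤ D) →
      ∫⁻ x, g x ∂N ≠ ∞ := fun N _ hg => by
    refine ne_top_of_le_ne_top ?_ (lintegral_mono hg)
    rw [lintegral_const]
    exact ENNReal.mul_ne_top hD (measure_ne_top _ _)
  have real : ∀ (N : Measure E) [IsFiniteMeasure N],
      N ∈ ({α, α + ρ, α + σ, α + ρ + σ} : Set (Measure E)) →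
      N.real A * N.real B + (N.real Set.univ * (∫⁻ x, U x ∂N).toReal + (∫⁻ x, V x ∂N).toReal)
        = N.real Set.univ * (∫⁻ x, U' x ∂N).toReal + (∫⁻ x, V' x ∂N).toReal := by
    intro N _ hN
    have h1 := congrArg ENNReal.toReal (h N hN)
    have hm : ∀ S T : Set E, N S * N T ≠ ∞ := fun S T =>
      ENNReal.mul_ne_top (measure_ne_top _ _) (measure_ne_top _ _)
    have hmU := ENNReal.mul_ne_top (measure_ne_top N Set.univ) (fin N hU)
    have hmU' := ENNReal.mul_ne_top (measure_ne_top N Set.univ) (fin N hU')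
    rw [ENNReal.toReal_add (hm _ _) (ENNReal.add_ne_top.2 ⟨hmU, fin N hV⟩),
      ENNReal.toReal_add hmU (fin N hV), ENNReal.toReal_add hmU' (fin N hV')] at h1
    simpa only [ENNReal.toReal_mul, Measure.real] using h1
  have add : ∀ {g : E → ℝ≥0∞} (N N' : Measure E) [IsFiniteMeasure N] [IsFiniteMeasure N'],
      (∀ x, g x ≤ D) → (∫⁻ x, g x ∂(N + N')).toReal
        = (∫⁻ x, g x ∂N).toReal + (∫⁻ x, g x ∂N').toReal := fun N N' _ _ hg => by
    rw [lintegral_add_measure, ENNReal.toReal_add (fin N hg) (fin N' hg)]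
  have e1 := real α (by simp)
  have e2 := real (α + ρ) (by simp)
  have e3 := real (α + σ) (by simp)
  have e4 := real (α + ρ + σ) (by simp)
  have radd : ∀ (N N' : Measure E) [IsFiniteMeasure N] [IsFiniteMeasure N'] (S : Set E),
      (N + N').real S = N.real S + N'.real S := fun N N' _ _ S => measureReal_add_apply
  simp only [radd, add _ _ hU, add _ _ hV, add _ _ hU', add _ _ hV'] at e1 e2 e3 e4
  linear_combination e4 - e3 - e2 + e1

end Gap

/-! ### The reinforcement is a multiple of a Markov kernel, or the sequence is i.i.d. -/

section PiSystem

variable (E : Type w) [MeasurableSpace E] [MeasurableSpace.CountablyGenerated E]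

/-- A countably generated σ-algebra is generated by a sequence of sets that form a π-system. -/
theorem exists_piSystem_seq : ∃ A : ℕ → Set E, (∀ n, MeasurableSet (A n)) ∧
    IsPiSystem (Set.range A) ∧ ‹MeasurableSpace E› = MeasurableSpace.generateFrom (Set.range A) ∧
    Set.univ ∈ Set.range A := by
  set 𝒜 := generateSetAlgebra (MeasurableSpace.countableGeneratingSet E)
  have hc : 𝒜.Countable :=
    countable_generateSetAlgebra MeasurableSpace.countable_countableGeneratingSet
  have halg : IsSetAlgebra 𝒜 := isSetAlgebra_generateSetAlgebra
  obtain ⟨A, hA⟩ := hc.exists_eq_range ⟨_, halg.univ_mem⟩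
  have hgen : ‹MeasurableSpace E› = MeasurableSpace.generateFrom 𝒜 := by
    rw [generateFrom_generateSetAlgebra_eq, MeasurableSpace.generateFrom_countableGeneratingSet]
  refine ⟨A, fun n => ?_, ?_, ?_, ?_⟩
  · rw [hgen]
    exact MeasurableSpace.measurableSet_generateFrom (hA ▸ Set.mem_range_self n)
  · rw [← hA]
    exact fun s hs t ht _ => halg.inter_mem hs ht
  · rw [← hA]
    exact hgen
  · rw [← hA]
    exact halg.univ_mem

variable {E}

theorem ae_eq_of_forall_ae_measure_eq {α : Type*} [MeasurableSpace α] {μ : Measure α}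
    {κ η : α → Measure E} (hκ : ∀ x, IsFiniteMeasure (κ x))
    (h : ∀ A, MeasurableSet A → ∀ᵐ x ∂μ, κ x A = η x A) : ∀ᵐ x ∂μ, κ x = η x := by
  obtain ⟨A, hAm, hpi, hgen, n, hn⟩ := exists_piSystem_seq E
  have h1 : ∀ᵐ x ∂μ, ∀ n, κ x (A n) = η x (A n) := ae_all_iff.2 fun n => h _ (hAm n)
  filter_upwards [h1] with x hx
  have := hκ x
  refine ext_of_generate_finite _ hgen hpi ?_ (by simpa [hn] using hx n)
  rintro _ ⟨n, rfl⟩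
  exact hx n

end PiSystem

section TwoDraws

variable {E : Type w} [MeasurableSpace E] {R : Kernel E E}

/-- Exchangeability of the first two draws, tested on rectangles. -/
theorem SymmetricDraws.setLIntegral_swap {N : Measure E} [IsFiniteMeasure N] (hN : N ≠ 0)
    (h : SymmetricDraws R N) {A B : Set E} (hA : MeasurableSet A) (hB : MeasurableSet B) :
    ∫⁻ y in A, (N Set.univ + R y Set.univ)⁻¹ * (N B + R y B) ∂N
      = ∫⁻ y in B, (N Set.univ + R y Set.univ)⁻¹ * (N A + R y A) ∂N := by
  have h1 := h (fun y z => A.indicator 1 y * B.indicator 1 z)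
    (((measurable_one.indicator hA).comp measurable_fst).mul
      ((measurable_one.indicator hB).comp measurable_snd))
  have key : ∀ {S T : Set E}, MeasurableSet S → MeasurableSet T →
      ∫⁻ y, ∫⁻ z, S.indicator 1 y * T.indicator 1 z ∂(normalizeKernel E (N + R y))
        ∂(normalizeKernel E N) = (N Set.univ)⁻¹ *
          ∫⁻ y in S, (N Set.univ + R y Set.univ)⁻¹ * (N T + R y T) ∂N := by
    intro S T hS hT
    rw [lintegral_normalizeKernel, ← lintegral_indicator hS]
    congr 1
    refine lintegral_congr fun y => ?_
    rw [lintegral_const_mul _ (measurable_one.indicator hT), lintegral_normalizeKernel,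
      lintegral_indicator_one hT]
    by_cases hy : y ∈ S <;> simp [hy]
  rw [key hA hB] at h1
  simp only [mul_comm (A.indicator (1 : E → ℝ≥0∞) _)] at h1
  rw [key hB hA] at h1
  exact (ENNReal.mul_right_inj (ENNReal.inv_ne_zero.2 (measure_ne_top _ _))
    (ENNReal.inv_ne_top.2 (by simpa using hN))).1 h1

/-- Strictly positive reinforcement in the form used for cancellation. -/
theorem setLIntegral_ratio_ne_zero {ν : Measure E} (hR : ∀ x, IsFiniteMeasure (R x))
    (hf0 : ν {x | R x Set.univ = 0} = 0) {G : Set E} (hG0 : ν G ≠ 0) (M : ℝ≥0∞) (hM : M ≠ ∞) :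
    ∫⁻ y in G, (M + R y Set.univ)⁻¹ * R y Set.univ ∂ν ≠ 0 := by
  intro h
  have hm : Measurable fun y => (M + R y Set.univ)⁻¹ * R y Set.univ :=
    (measurable_const.add (R.measurable_coe MeasurableSet.univ)).inv.mul
      (R.measurable_coe MeasurableSet.univ)
  rw [lintegral_eq_zero_iff hm] at h
  apply hG0
  have hf0' : ∀ᵐ x ∂(ν.restrict G), R x Set.univ ≠ 0 :=
    ae_restrict_of_ae (measure_eq_zero_iff_ae_notMem.1 hf0)
  have : ∀ᵐ x ∂(ν.restrict G), False := by
    filter_upwards [h, hf0'] with x hx hx0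
    have hx' : (M + R x Set.univ)⁻¹ * R x Set.univ = 0 := hx
    rw [mul_eq_zero, ENNReal.inv_eq_zero] at hx'
    rcases hx' with h | h
    · exact ENNReal.add_ne_top.2 ⟨hM, measure_ne_top _ _⟩ h
    · exact hx0 h
  rw [Filter.eventually_false_iff_eq_bot, ae_eq_bot, Measure.restrict_eq_zero] at this
  exact this

variable {ν : Measure E} [IsProbabilityMeasure ν] {c : ℝ≥0∞}

theorem SymmetricDraws.setLIntegral_swap_smul (hc0 : c ≠ 0) (hc : c ≠ ∞)
    (h : SymmetricDraws R (c • ν)) {A B : Set E} (hA : MeasurableSet A) (hB : MeasurableSet B) :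
    ∫⁻ y in A, (c + R y Set.univ)⁻¹ * (c * ν B + R y B) ∂ν
      = ∫⁻ y in B, (c + R y Set.univ)⁻¹ * (c * ν A + R y A) ∂ν := by
  have := Measure.smul_finite ν hc
  have hne : c • ν ≠ 0 := fun h0 => by
    have := congrArg (fun m : Measure E => m Set.univ) h0
    simp [hc0] at this
  have h1 := h.setLIntegral_swap hne hA hB
  simp only [Measure.smul_apply, smul_eq_mul, measure_univ, mul_one, Measure.restrict_smul,
    lintegral_smul_measure] at h1
  exact (ENNReal.mul_right_inj hc0 hc).1 h1

/-- The second draw has the same law as the first one. -/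
theorem SymmetricDraws.lintegral_second (hR : ∀ x, IsFiniteMeasure (R x)) (hc0 : c ≠ 0) (hc : c ≠ ∞)
    (h0 : SymmetricDraws R (c • ν))
    {B : Set E} (hB : MeasurableSet B) :
    ∫⁻ y, (c + R y Set.univ)⁻¹ * (c * ν B + R y B) ∂ν = ν B := by
  have h1 := h0.setLIntegral_swap_smul hc0 hc MeasurableSet.univ hB
  rw [Measure.restrict_univ] at h1
  rw [h1]
  have e : ∀ y, (c + R y Set.univ)⁻¹ * (c * ν Set.univ + R y Set.univ) = 1 := fun y => by
    rw [measure_univ (μ := ν), mul_one]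
    exact ENNReal.inv_mul_cancel (fun h => hc0 (add_eq_zero.1 h).1)
      (ENNReal.add_ne_top.2 ⟨hc, measure_ne_top _ _⟩)
  simp only [e, setLIntegral_one]

/-- The reinforcement does not charge `ν`-null sets, since the second draw has law `ν`. -/
theorem SymmetricDraws.ae_ae_kernel (hR : ∀ x, IsFiniteMeasure (R x)) (hc0 : c ≠ 0) (hc : c ≠ ∞)
    (h0 : SymmetricDraws R (c • ν))
    {p : E → Prop} (hp : ∀ᵐ y ∂ν, p y) :
    ∀ᵐ x ∂ν, ∀ᵐ y ∂(R x), p y := by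
  set Z := toMeasurable ν {y | ¬ p y} with hZ
  have hZ0 : ν Z = 0 := by rw [hZ, measure_toMeasurable]; exact hp
  have hZm : MeasurableSet Z := measurableSet_toMeasurable _ _
  have h1 := h0.lintegral_second hR hc0 hc hZm
  rw [hZ0, lintegral_eq_zero_iff] at h1
  · filter_upwards [h1] with x hx
    have hx' : (c + R x Set.univ)⁻¹ * (c * 0 + R x Z) = 0 := hx
    rw [mul_zero, zero_add, mul_eq_zero, ENNReal.inv_eq_zero] at hx'
    rcases hx' with h | h
    · exact absurd h (ENNReal.add_ne_top.2 ⟨hc, measure_ne_top _ _⟩)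
    · exact measure_mono_null (subset_toMeasurable _ _) h
  · exact (measurable_const.add (R.measurable_coe MeasurableSet.univ)).inv.mul
      (measurable_const.add (R.measurable_coe hZm))

/-- If the proportion of the reinforcement that falls in `B` is constant, then it is `ν B`. -/
theorem SymmetricDraws.ae_eq_of_const_ratio (hR : ∀ x, IsFiniteMeasure (R x)) (hc0 : c ≠ 0)
    (hc : c ≠ ∞) (h0 : SymmetricDraws R (c • ν)) (hf0 : ν {x | R x Set.univ = 0} = 0)
    {B : Set E} (hB : MeasurableSet B) {k : ℝ≥0∞}
    (hk : ∀ᵐ x ∂ν, R x B = k * R x Set.univ) : ∀ᵐ x ∂ν, R x B = ν B * R x Set.univ := by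
  have hfm : Measurable fun x => R x Set.univ := R.measurable_coe MeasurableSet.univ
  have hIm : Measurable fun y => (c + R y Set.univ)⁻¹ * R y Set.univ :=
    (measurable_const.add hfm).inv.mul hfm
  have hJm : Measurable fun y => (c + R y Set.univ)⁻¹ * c :=
    (measurable_const.add hfm).inv.mul measurable_const
  set I := ∫⁻ y, (c + R y Set.univ)⁻¹ * R y Set.univ ∂ν with hI
  set J := ∫⁻ y, (c + R y Set.univ)⁻¹ * c ∂ν with hJ
  have hIJ : J + I = 1 := by
    have h1 := h0.lintegral_second hR hc0 hc MeasurableSet.univ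
    simp only [measure_univ, mul_one, mul_add] at h1
    rwa [lintegral_add_left hJm] at h1
  have h1 := h0.lintegral_second hR hc0 hc hB
  have h2 : ∫⁻ y, (c + R y Set.univ)⁻¹ * (c * ν B + R y B) ∂ν = ν B * J + k * I := by
    rw [hI, hJ, ← lintegral_const_mul _ hJm, ← lintegral_const_mul _ hIm,
      ← lintegral_add_left (hJm.const_mul _)]
    refine lintegral_congr_ae ?_
    filter_upwards [hk] with y hy
    rw [hy]
    ring
  have h3 : ν B * J + k * I = ν B * J + ν B * I := by
    rw [← h2, h1, ← mul_add, hIJ, mul_one]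
  have hJt : ν B * J ≠ ∞ := ENNReal.mul_ne_top (measure_ne_top _ _)
    (ne_top_of_le_ne_top ENNReal.one_ne_top (hIJ ▸ le_self_add))
  have hIt : I ≠ ∞ := ne_top_of_le_ne_top ENNReal.one_ne_top (hIJ ▸ le_add_self)
  have hI0 : I ≠ 0 := by
    have := setLIntegral_ratio_ne_zero hR hf0 (G := Set.univ) (by simp) c hc
    rwa [Measure.restrict_univ] at this
  have hkB : k = ν B :=
    (ENNReal.mul_left_inj hI0 hIt).1 ((ENNReal.add_right_inj hJt).1 h3)
  rwa [hkB] at hk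

/-- If the reinforcement is proportional to `ν` on a set `G`, then the reinforcement caused by
points of `G` is proportional to `ν`. -/
theorem SymmetricDraws.ae_restrict_eq (hR : ∀ x, IsFiniteMeasure (R x)) (hc0 : c ≠ 0) (hc : c ≠ ∞)
    (h0 : SymmetricDraws R (c • ν))
    {G : Set E} (hG : MeasurableSet G)
    (hprop : ∀ B ⊆ G, MeasurableSet B → ∀ᵐ x ∂ν, R x B = ν B * R x Set.univ)
    {A : Set E} (hA : MeasurableSet A) :
    ∀ᵐ x ∂(ν.restrict G), R x A = ν A * R x Set.univ := by
  have hne0 : ∀ y, c + R y Set.univ ≠ 0 := fun y h => hc0 (add_eq_zero.1 h).1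
  have hne : ∀ y, c + R y Set.univ ≠ ∞ := fun y => ENNReal.add_ne_top.2 ⟨hc, measure_ne_top _ _⟩
  have h1 : (fun y => (c + R y Set.univ)⁻¹ * (c * ν A + R y A))
      =ᵐ[ν.restrict G] fun _ => ν A := by
    refine ae_eq_of_forall_setLIntegral_eq_of_sigmaFinite
      ((measurable_const.add (R.measurable_coe MeasurableSet.univ)).inv.mul
        (measurable_const.add (R.measurable_coe hA))) measurable_const fun S hS _ => ?_
    rw [Measure.restrict_restrict hS, setLIntegral_const,
      ← h0.setLIntegral_swap_smul hc0 hc hA (hS.inter hG)]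
    have h2 : ∀ᵐ y ∂(ν.restrict A), (c + R y Set.univ)⁻¹ * (c * ν (S ∩ G) + R y (S ∩ G))
        = ν (S ∩ G) := by
      filter_upwards [ae_restrict_of_ae (hprop _ Set.inter_subset_right (hS.inter hG))] with y hy
      rw [hy, mul_comm c, ← mul_add, mul_left_comm, ENNReal.inv_mul_cancel (hne0 y) (hne y),
        mul_one]
    rw [lintegral_congr_ae h2, setLIntegral_const, mul_comm]
  filter_upwards [h1] with y hy
  have h3 : c * ν A + R y A = (c + R y Set.univ) * ν A := by
    calc c * ν A + R y A
        = (c + R y Set.univ) * ((c + R y Set.univ)⁻¹ * (c * ν A + R y A)) := by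
          rw [← mul_assoc, ENNReal.mul_inv_cancel (hne0 y) (hne y), one_mul]
      _ = (c + R y Set.univ) * ν A := by rw [hy]
  rw [add_mul] at h3
  rw [(ENNReal.add_right_inj (ENNReal.mul_ne_top hc (measure_ne_top _ _))).1 h3, mul_comm]

/-- If the reinforcement is proportional to `ν` on a set `G` of positive measure, then it is
proportional to `ν` altogether. -/
theorem SymmetricDraws.ae_eq_smul_of_subset [MeasurableSpace.CountablyGenerated E]
    (hR : ∀ x, IsFiniteMeasure (R x)) (hc0 : c ≠ 0) (hc : c ≠ ∞)
    (h0 : SymmetricDraws R (c • ν)) (hf0 : ν {x | R x Set.univ = 0} = 0)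
    (h1 : ∀ᵐ x ∂ν, SymmetricDraws R (c • ν + R x)) {G : Set E} (hG : MeasurableSet G)
    (hG0 : ν G ≠ 0)
    (hprop : ∀ B ⊆ G, MeasurableSet B → ∀ᵐ x ∂ν, R x B = ν B * R x Set.univ) :
    ∀ᵐ x ∂ν, R x = R x Set.univ • ν := by
  have hfm : Measurable fun x => R x Set.univ := R.measurable_coe MeasurableSet.univ
  have hrestr : ∀ᵐ x ∂ν, (R x).restrict G = R x Set.univ • ν.restrict G :=
    ae_eq_of_forall_ae_measure_eq (fun x => inferInstance) fun B hB => by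
      filter_upwards [hprop (B ∩ G) Set.inter_subset_right (hB.inter hG)] with x hx
      rw [Measure.restrict_apply hB, hx, Measure.smul_apply, Measure.restrict_apply hB,
        smul_eq_mul, mul_comm]
  have hRG : ∀ᵐ x ∂ν, ∀ᵐ y ∂(R x), R y G = ν G * R y Set.univ :=
    h0.ae_ae_kernel hR hc0 hc (hprop G subset_rfl hG)
  refine ae_eq_of_forall_ae_measure_eq hR fun A hA => ?_
  have hRA := h0.ae_restrict_eq hR hc0 hc hG hprop hA
  filter_upwards [h1, hrestr, hRG, hprop G subset_rfl hG] with x hx hxr hxG hxG'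
  have := Measure.smul_finite ν hc
  set M := c + R x Set.univ with hM
  set N := c • ν + R x with hN
  have hM0 : M ≠ 0 := fun h => hc0 (add_eq_zero.1 h).1
  have hMt : M ≠ ∞ := ENNReal.add_ne_top.2 ⟨hc, measure_ne_top _ _⟩
  have hNuniv : N Set.univ = M := by simp [hN, hM]
  have hNne : N ≠ 0 := fun h => hM0 (by rw [← hNuniv, h]; rfl)
  have hNG : N G = M * ν G := by
    rw [hN, hM, Measure.add_apply, hxG', Measure.smul_apply, smul_eq_mul]
    ring
  have hNr : N.restrict G = M • ν.restrict G := by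
    rw [hN, hM, Measure.restrict_add, Measure.restrict_smul, hxr, add_smul]
  have hyne0 : ∀ y, M + R y Set.univ ≠ 0 := fun y h => hM0 (add_eq_zero.1 h).1
  have hyne : ∀ y, M + R y Set.univ ≠ ∞ := fun y => ENNReal.add_ne_top.2 ⟨hMt, measure_ne_top _ _⟩
  -- Exchangeability of the draws in the urn `θν + R_x`, tested with `A` and `G`, determines `N A`:
  -- all other quantities are known to be proportional to `ν` on `G` or to a total mass.
  have h2 := hx.setLIntegral_swap hNne hA hG
  rw [hNuniv, hNr, lintegral_smul_measure, smul_eq_mul] at h2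
  have hL : ∀ᵐ y ∂(N.restrict A), (M + R y Set.univ)⁻¹ * (N G + R y G) = ν G := by
    refine ae_restrict_of_ae ?_
    rw [hN, ae_add_measure_iff]
    have aux : ∀ y, R y G = ν G * R y Set.univ →
        (M + R y Set.univ)⁻¹ * (N G + R y G) = ν G := fun y hy => by
      rw [hNG, hy, mul_comm M, ← mul_add, mul_left_comm,
        ENNReal.inv_mul_cancel (hyne0 y) (hyne y), mul_one]
    constructor
    · refine Measure.ae_smul_measure ?_ c
      filter_upwards [hprop G subset_rfl hG] with y hy using aux y hy
    · filter_upwards [hxG] with y hy using aux y hy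
  rw [lintegral_congr_ae hL, setLIntegral_const] at h2
  have hIm : Measurable fun y => (M + R y Set.univ)⁻¹ * R y Set.univ :=
    (measurable_const.add hfm).inv.mul hfm
  have hJm : Measurable fun y => (M + R y Set.univ)⁻¹ * M :=
    (measurable_const.add hfm).inv.mul measurable_const
  set I := ∫⁻ y in G, (M + R y Set.univ)⁻¹ * R y Set.univ ∂ν with hI
  set J := ∫⁻ y in G, (M + R y Set.univ)⁻¹ * M ∂ν with hJ
  have hIJ : J + I = ν G := by
    rw [hI, hJ, ← lintegral_add_left hJm, ← setLIntegral_one]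
    refine lintegral_congr fun y => ?_
    rw [← mul_add, ENNReal.inv_mul_cancel (hyne0 y) (hyne y)]
  have h3 : M * ∫⁻ y in G, (M + R y Set.univ)⁻¹ * (N A + R y A) ∂ν
      = N A * J + M * (ν A * I) := by
    rw [hI, hJ, ← lintegral_const_mul _ hJm, ← lintegral_const_mul _ hIm,
      ← lintegral_const_mul' _ _ hMt, ← lintegral_const_mul' _ _ hMt,
      ← lintegral_add_left (hJm.const_mul _)]
    refine lintegral_congr_ae ?_
    filter_upwards [hRA] with y hy
    rw [hy]
    ring
  rw [h3, ← hIJ, mul_comm, mul_add, ← mul_assoc M] at h2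
  have hJt : N A * J ≠ ∞ := ENNReal.mul_ne_top (measure_ne_top _ _)
    (ne_top_of_le_ne_top (measure_ne_top ν G) (hIJ ▸ le_self_add))
  have hIt : I ≠ ∞ := ne_top_of_le_ne_top (measure_ne_top ν G) (hIJ ▸ le_add_self)
  have hI0 : I ≠ 0 := setLIntegral_ratio_ne_zero hR hf0 hG0 M hMt
  have h4 : N A = M * ν A := (ENNReal.mul_left_inj hI0 hIt).1 ((ENNReal.add_right_inj hJt).1 h2)
  rw [hN, hM, Measure.add_apply, Measure.smul_apply, smul_eq_mul, add_mul] at h4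
  rw [(ENNReal.add_right_inj (ENNReal.mul_ne_top hc (measure_ne_top _ _))).1 h4,
    Measure.smul_apply, smul_eq_mul]

end TwoDraws

section Dichotomy

variable {E : Type w} [MeasurableSpace E] {R : Kernel E E} {ν : Measure E}
  [IsProbabilityMeasure ν] {c : ℝ≥0∞}

/-- Across a gap of the total masses, the proportion of the reinforcement falling in a set below
the gap or the one falling in a set above the gap is constant. -/
theorem SymmetricDraws.ae_const_ratio_or_of_gap (hR : ∀ x, IsFiniteMeasure (R x)) (hc0 : c ≠ 0)
    (hc : c ≠ ∞) (h0 : SymmetricDraws R (c • ν)) (hf0 : ν {x | R x Set.univ = 0} = 0)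
    (h1 : ∀ᵐ x ∂ν, SymmetricDraws R (c • ν + R x))
    (h2 : ∀ᵐ x ∂ν, ∀ᵐ y ∂ν, SymmetricDraws R (c • ν + R x + R y)) {A B : Set E}
    (hA : MeasurableSet A) (hB : MeasurableSet B) {s t K : ℝ≥0∞} (hst : s < t) (htK : t ≤ K)
    (hK : K ≠ ∞) (hAs : ∀ y ∈ A, R y Set.univ ≤ s)
    (hBt : ∀ z ∈ B, t ≤ R z Set.univ ∧ R z Set.univ ≤ K) :
    (∃ k, ∀ᵐ x ∂ν, R x A = k * R x Set.univ) ∨ ∃ k, ∀ᵐ x ∂ν, R x B = k * R x Set.univ := by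
  have := isSFiniteKernel_of_isFiniteMeasure hR
  have := Measure.smul_finite ν hc
  obtain ⟨D, U, V, U', V', hD, mU, mV, mU', mV', hU, hV, hU', hV', hid⟩ :=
    exists_bounded_symmetricDraws_gap hR hA hB hst htK hK hAs hBt
  have hpos : ∀ᵐ x ∂ν, (R x).real Set.univ ≠ 0 := by
    filter_upwards [measure_eq_zero_iff_ae_notMem.1 hf0] with x hx
    exact (ENNReal.toReal_pos hx (measure_ne_top _ _)).ne'
  have hrm : ∀ {S : Set E}, MeasurableSet S → Measurable fun x => (R x).real S := fun hS =>
    (R.measurable_coe hS).ennreal_toReal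
  have hne : ∀ m : Measure E, c • ν + m ≠ 0 := fun m h => by
    have := congrArg (fun m : Measure E => m Set.univ) h
    simp [hc0] at this
  -- Dividing the second difference along `R x`, `R y` by the total masses leads to a functional
  -- equation for the proportions `u`, `v` falling in `A`, `B`.
  set u : E → ℝ := fun x => (R x).real A / (R x).real Set.univ with hu
  set v : E → ℝ := fun x => (R x).real B / (R x).real Set.univ with hv
  set d : E → ℝ := fun x => ((∫⁻ z, U z ∂(R x)).toReal - (∫⁻ z, U' z ∂(R x)).toReal)
    / (R x).real Set.univ with hd
  have hratio : ∀ (x : E) (S : Set E), |(R x).real S / (R x).real Set.univ| ≤ 1 := fun x S => by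
    rw [abs_of_nonneg (by positivity)]
    exact div_le_one_of_le₀ (measureReal_mono (Set.subset_univ _)) measureReal_nonneg
  have hbd : ∀ {g : E → ℝ≥0∞}, (∀ x, g x ≤ D) → ∀ x,
      (∫⁻ z, g z ∂(R x)).toReal ≤ D.toReal * (R x).real Set.univ := fun hg x => by
    rw [Measure.real, ← ENNReal.toReal_mul]
    refine ENNReal.toReal_mono (ENNReal.mul_ne_top hD (measure_ne_top _ _)) ?_
    rw [← lintegral_const]
    exact lintegral_mono hg
  have hdb : ∀ x, |d x| ≤ D.toReal := fun x => by
    rw [hd, abs_div, abs_of_nonneg (measureReal_nonneg (μ := R x) (s := Set.univ))]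
    refine div_le_of_le_mul₀ measureReal_nonneg ENNReal.toReal_nonneg ?_
    refine abs_sub_le_of_nonneg_of_le ENNReal.toReal_nonneg (hbd hU x)
      ENNReal.toReal_nonneg (hbd hU' x)
  have hdm : Measurable d :=
    (mU.lintegral_kernel.ennreal_toReal.sub mU'.lintegral_kernel.ennreal_toReal).div
      (hrm MeasurableSet.univ)
  have hfun : ∀ᵐ x ∂ν, ∀ᵐ y ∂ν, u x * v y + u y * v x + d x + d y = 0 := by
    filter_upwards [h1, h2, hpos] with x hx1 hx2 hx0
    filter_upwards [h1, hx2, hpos] with y hy1 hy2 hy0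
    have e := second_difference_of_quadratic_identity (A := A) (B := B) hD hU hV hU' hV'
      (α := c • ν) (ρ := R x) (σ := R y) (by
        rintro N (rfl | rfl | rfl | rfl)
        · exact hid _ inferInstance (by simpa using hne 0) h0
        · exact hid _ inferInstance (hne _) hx1
        · exact hid _ inferInstance (hne _) hy1
        · exact hid _ inferInstance (by rw [add_assoc]; exact hne _) hy2)
    simp only [hu, hv, hd]
    field_simp
    linear_combination e
  have conv : ∀ S : Set E, (∃ r : ℝ, ∀ᵐ x ∂ν, (R x).real S / (R x).real Set.univ = r) →
      ∃ k, ∀ᵐ x ∂ν, R x S = k * R x Set.univ := by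
    rintro S ⟨r, hr⟩
    refine ⟨ENNReal.ofReal r, ?_⟩
    filter_upwards [hr, hpos] with x hx hx0
    have hr0 : 0 ≤ r := hx ▸ by positivity
    rw [div_eq_iff hx0] at hx
    rw [← ofReal_measureReal (μ := R x) (s := S), hx, ENNReal.ofReal_mul hr0, ofReal_measureReal]
  set C := max 1 D.toReal
  rcases ae_const_or_ae_const_of_symm_mul (ν := ν) ((hrm hA).div (hrm MeasurableSet.univ))
    ((hrm hB).div (hrm MeasurableSet.univ)) hdm
    (fun x => (hratio x A).trans (le_max_left 1 D.toReal))
    (fun x => (hratio x B).trans (le_max_left 1 D.toReal))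
    (fun x => (hdb x).trans (le_max_right 1 D.toReal)) hfun with h | h
  · exact Or.inl (conv A h)
  · exact Or.inr (conv B h)

/-- Either the total mass of the reinforcement is constant, or the reinforcement is always
proportional to `ν`. -/
theorem SymmetricDraws.ae_const_or_ae_eq_smul [MeasurableSpace.CountablyGenerated E]
    (hR : ∀ x, IsFiniteMeasure (R x)) (hc0 : c ≠ 0)
    (hc : c ≠ ∞) (h0 : SymmetricDraws R (c • ν)) (hf0 : ν {x | R x Set.univ = 0} = 0)
    (h1 : ∀ᵐ x ∂ν, SymmetricDraws R (c • ν + R x))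
    (h2 : ∀ᵐ x ∂ν, ∀ᵐ y ∂ν, SymmetricDraws R (c • ν + R x + R y)) :
    (∃ k, k ≠ 0 ∧ k ≠ ∞ ∧ ∀ᵐ x ∂ν, R x Set.univ = k) ∨ ∀ᵐ x ∂ν, R x = R x Set.univ • ν := by
  by_cases hconst : ∃ r : ℝ, ∀ᵐ x ∂ν, (R x).real Set.univ = r
  · obtain ⟨r, hr⟩ := hconst
    have hk : ∀ᵐ x ∂ν, R x Set.univ = ENNReal.ofReal r := by
      filter_upwards [hr] with x hx
      rw [← hx, ofReal_measureReal]
    refine Or.inl ⟨ENNReal.ofReal r, ?_, ENNReal.ofReal_ne_top, hk⟩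
    obtain ⟨x, hx, hx0⟩ := (hk.and (measure_eq_zero_iff_ae_notMem.1 hf0)).exists
    exact hx ▸ hx0
  · obtain ⟨s, t, K, hst, hs, ht⟩ := exists_gap_of_not_ae_const
      (fun x => measureReal_nonneg (μ := R x) (s := Set.univ)) hconst
    have hrm : Measurable fun x => (R x).real Set.univ :=
      (R.measurable_coe MeasurableSet.univ).ennreal_toReal
    have hs0 : 0 ≤ s := by
      obtain ⟨x, hx⟩ := nonempty_of_measure_ne_zero hs
      exact measureReal_nonneg.trans hx
    have htK : t ≤ K := by
      obtain ⟨x, hx⟩ := nonempty_of_measure_ne_zero ht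
      exact hx.1.trans hx.2
    have key := fun {A B : Set E} (hA : MeasurableSet A) (hB : MeasurableSet B)
        (hAs : A ⊆ {x | (R x).real Set.univ ≤ s})
        (hBt : B ⊆ {x | t ≤ (R x).real Set.univ ∧ (R x).real Set.univ ≤ K}) =>
      h0.ae_const_ratio_or_of_gap hR hc0 hc hf0 h1 h2 hA hB
        (s := ENNReal.ofReal s) (t := ENNReal.ofReal t) (K := ENNReal.ofReal K)
        ((ENNReal.ofReal_lt_ofReal_iff (hs0.trans_lt hst)).2 hst) (ENNReal.ofReal_le_ofReal htK)
        ENNReal.ofReal_ne_top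
        (fun y hy => by
          rw [← ofReal_measureReal (μ := R y) (s := Set.univ)]
          exact ENNReal.ofReal_le_ofReal (hAs hy))
        (fun y hy => by
          rw [← ofReal_measureReal (μ := R y) (s := Set.univ)]
          exact ⟨ENNReal.ofReal_le_ofReal (hBt hy).1, ENNReal.ofReal_le_ofReal (hBt hy).2⟩)
    right
    -- Either all sets below the gap receive a constant proportion, or one of them does not and then
    -- all sets above the gap do.
    by_cases hall : ∀ A ⊆ {x | (R x).real Set.univ ≤ s}, MeasurableSet A →
        ∃ k, ∀ᵐ x ∂ν, R x A = k * R x Set.univ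
    · exact h0.ae_eq_smul_of_subset hR hc0 hc hf0 h1 (hrm measurableSet_Iic) hs
        fun A hAs hA => (hall A hAs hA).elim fun k hk =>
          h0.ae_eq_of_const_ratio hR hc0 hc hf0 hA hk
    · simp only [not_forall] at hall
      obtain ⟨A, hAs, hA, hnot⟩ := hall
      exact h0.ae_eq_smul_of_subset hR hc0 hc hf0 h1 (hrm measurableSet_Icc) ht
        fun B hBt hB => ((key hA hB hAs hBt).resolve_left hnot).elim fun k hk =>
          h0.ae_eq_of_const_ratio hR hc0 hc hf0 hB hk

end Dichotomy

section Normalisation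

variable {Ω : Type u} {E : Type w} [MeasurableSpace Ω] [MeasurableSpace E]
  {P : Measure Ω} {X : ℕ → Ω → E} {θ : ℝ} {ν : Measure E}
  {R : Kernel E E}

theorem IsExchangeable.map_eq (h : IsExchangeable P X) (hX : ∀ i, Measurable (X i)) (i : ℕ) :
    P.map (X i) = P.map (X 0) := by
  have h1 := h (i + 1) (Equiv.swap ⟨i, by omega⟩ ⟨0, by omega⟩)
  have h2 := congrArg (Measure.map fun x : Fin (i + 1) → E => x ⟨0, by omega⟩) h1
  rw [Measure.map_map (by fun_prop) (measurable_pi_lambda _ fun i => hX _),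
    Measure.map_map (by fun_prop) (measurable_pi_lambda _ fun i => hX _)] at h2
  simpa [Function.comp_def] using h2

/-- The first state of an urn sequence, from the law of the empty sequence of observations. -/
theorem ae_map_prefix_zero [IsProbabilityMeasure P] {p : (Fin 0 → E) → Prop}
    (h : ∀ᵐ x ∂(P.map fun ω (i : Fin 0) => X i ω), p x) (x : Fin 0 → E) : p x := by
  have : IsProbabilityMeasure (P.map fun ω (i : Fin 0) => X i ω) :=
    Measure.isProbabilityMeasure_map (measurable_pi_lambda _ fun i => i.elim0).aemeasurable
  obtain ⟨y, hy⟩ := h.exists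
  rwa [Subsingleton.elim x y]

theorem ae_map_prefix_one (hX : ∀ i, Measurable (X i)) (h0 : P.map (X 0) = ν)
    {p : (Fin 1 → E) → Prop}
    (h : ∀ᵐ x ∂(P.map fun ω (i : Fin 1) => X i ω), p x) : ∀ᵐ x ∂ν, p fun _ => x := by
  have e : P.map (fun ω (i : Fin 1) => X i ω) = ν.map fun x _ => x := by
    rw [← h0, Measure.map_map (g := fun (x : E) (_ : Fin 1) => x)
      (measurable_pi_lambda _ fun _ => measurable_id) (hX 0)]
    congr 1
    funext ω i
    rw [Subsingleton.elim i 0]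
    rfl
  rw [e] at h
  exact ae_of_ae_map (measurable_pi_lambda _ fun _ => measurable_id).aemeasurable h

/-- In an exchangeable urn sequence, draws are exchangeable in the initial urn and after one or two
reinforcements. -/
theorem IsUrnSequence.symmetricDraws [StandardBorelSpace E] [IsProbabilityMeasure P]
    [IsProbabilityMeasure ν] (h : IsUrnSequence P X θ ν R) (hθ : 0 < θ)
    (hR : ∀ x, IsFiniteMeasure (R x)) (hX : ∀ i, Measurable (X i)) (h0 : P.map (X 0) = ν)
    (hex : IsExchangeable P X) :
    SymmetricDraws R (ENNReal.ofReal θ • ν) ∧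
      (∀ᵐ x ∂ν, SymmetricDraws R (ENNReal.ofReal θ • ν + R x)) ∧
      ∀ᵐ x ∂ν, ∀ᵐ y ∂ν, SymmetricDraws R (ENNReal.ofReal θ • ν + R x + R y) := by
  refine ⟨?_, ?_, ?_⟩
  · have := ae_map_prefix_zero (h.ae_symmetricDraws hX hex 0) Fin.elim0
    simpa [urnState] using this
  · have := ae_map_prefix_one hX h0 (h.ae_symmetricDraws hX hex 1)
    simpa [urnState] using this
  · have h2 := h.ae_symmetricDraws hX hex 2
    have hsm : Measurable fun q : (Fin 1 → E) × E => (![q.1 0, q.2] : Fin 2 → E) := by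
      refine measurable_pi_lambda _ fun i => ?_
      fin_cases i
      · exact (measurable_pi_apply (0 : Fin 1)).comp measurable_fst
      · exact measurable_snd
    have e : P.map (fun ω (i : Fin 2) => X i ω)
        = ((P.map fun ω (i : Fin 1) => X i ω) ⊗ₘ urnKernel θ ν R 1).map
          fun q => (![q.1 0, q.2] : Fin 2 → E) := by
      rw [← h 1, Measure.map_map hsm ((measurable_prefix hX 1).prodMk (hX 1))]
      congr 1
      funext ω i
      fin_cases i <;> rfl
    rw [e] at h2
    have h3 := Measure.ae_ae_of_ae_compProd (ae_of_ae_map hsm.aemeasurable h2)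
    have h4 := ae_map_prefix_one hX h0 h3
    filter_upwards [h4] with x hx
    -- The second draw has a law that depends on the first but always dominates `ν`.
    have hac : ν ≪ urnKernel θ ν R 1 (fun _ => x) := by
      rw [urnKernel_apply, normalizeKernel_apply]
      have hne : (urnState θ ν R fun _ : Fin 1 => x) Set.univ ≠ ∞ := by
        rw [urnState_apply]
        simp [measure_ne_top]
      have hne' : ENNReal.ofReal θ ≠ 0 := by simpa using hθ
      refine (Measure.AbsolutelyContinuous.trans ?_
        (Measure.absolutelyContinuous_smul (ENNReal.inv_ne_zero.2 hne)))
      refine (Measure.absolutelyContinuous_smul hne').trans ?_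
      exact Measure.AbsolutelyContinuous.add_right (Measure.AbsolutelyContinuous.refl _) _
    filter_upwards [hac.ae_le hx] with y hy
    simpa [urnState, Fin.sum_univ_two, add_assoc] using hy

/-- The parameters of an urn sequence may be changed as long as the normalised urn compositions
remain the same. -/
theorem IsUrnSequence.congr (h : IsUrnSequence P X θ ν R) (hX : ∀ i, Measurable (X i))
    (hid : ∀ i, P.map (X i) = ν) {θ' : ℝ} {R' : Kernel E E} {p : E → Prop}
    (hp : ∀ᵐ x ∂ν, p x) (hpr : ∀ (n : ℕ) (x : Fin n → E), (∀ i, p (x i)) →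
      ∃ k, k ≠ 0 ∧ k ≠ ∞ ∧ urnState θ ν R x = k • urnState θ' ν R' x) :
    IsUrnSequence P X θ' ν R' := by
  intro n
  rw [h n]
  refine Measure.compProd_congr ?_
  have hae : ∀ᵐ x ∂(P.map fun ω (i : Fin n) => X i ω), ∀ i, p (x i) := by
    rw [ae_all_iff]
    intro i
    have e : (P.map fun ω (i : Fin n) => X i ω).map (fun x => x i) = ν := by
      rw [Measure.map_map (by fun_prop) (measurable_prefix hX n), ← hid i]
      rfl
    rw [← e] at hp
    exact ae_of_ae_map (measurable_pi_apply i).aemeasurable hp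
  filter_upwards [hae] with x hx
  obtain ⟨k, hk0, hk, e⟩ := hpr n x hx
  rw [urnKernel_apply, urnKernel_apply, e, normalizeKernel_smul hk0 hk]

/-- Every exchangeable urn sequence with strictly positive reinforcement is one whose
reinforcement is a Markov kernel. -/
theorem IsMVPS.exists_markov [StandardBorelSpace E] [IsProbabilityMeasure P]
    (h : IsMVPS P X θ ν R) (hX : ∀ i, Measurable (X i))
    (hex : IsExchangeable P X) (hf0 : ν {x | R x Set.univ = 0} = 0) :
    ∃ (θ' : ℝ) (R' : Kernel E E), 0 < θ' ∧ IsMarkovKernel R' ∧ IsUrnSequence P X θ' ν R' := by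
  have hR := h.finite_kernel
  have hν := h.isProbabilityMeasure
  have hurn := h.isUrnSequence hX
  have hid : ∀ i, P.map (X i) = ν := fun i => (hex.map_eq hX i).trans h.map_zero
  have hc0 : ENNReal.ofReal θ ≠ 0 := by simpa using h.theta_pos
  obtain ⟨h0, h1, h2⟩ := hurn.symmetricDraws h.theta_pos hR hX h.map_zero hex
  rcases h0.ae_const_or_ae_eq_smul hR hc0 ENNReal.ofReal_ne_top hf0 h1 h2 with
    ⟨k, hk0, hk, hconst⟩ | hprop
  · classical
    have hm : MeasurableSet {x | R x Set.univ = k} :=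
      R.measurable_coe MeasurableSet.univ (measurableSet_singleton k)
    have := isSFiniteKernel_of_isFiniteMeasure hR
    -- If the mass is constant, equal to `k`, then `θ` and `R` are divided by `k`; on the null set
    -- where the mass is not `k` the kernel is replaced by `ν`.
    refine ⟨θ / k.toReal, Kernel.piecewise hm ((normalizeKernel E).comap R R.measurable)
      (Kernel.const E ν), div_pos h.theta_pos (ENNReal.toReal_pos hk0 hk), ⟨fun x => ?_⟩,
      hurn.congr hX hid hconst fun n x hx => ⟨k, hk0, hk, ?_⟩⟩
    · rw [Kernel.piecewise_apply]
      split_ifs with hx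
      · have hx' : R x Set.univ = k := hx
        exact isProbabilityMeasure_normalizeKernel (by rwa [hx']) (measure_ne_top _ _)
      · rw [Kernel.const_apply]
        infer_instance
    · rw [urnState, urnState, smul_add, smul_smul, Finset.smul_sum,
        ENNReal.ofReal_div_of_pos (ENNReal.toReal_pos hk0 hk), ENNReal.ofReal_toReal hk,
        ENNReal.mul_div_cancel hk0 hk]
      congr 1
      refine Finset.sum_congr rfl fun i _ => ?_
      rw [Kernel.piecewise_apply, if_pos (show x i ∈ {x | R x Set.univ = k} from hx i),
        Kernel.comap_apply, normalizeKernel_apply,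
        smul_smul, hx i, ENNReal.mul_inv_cancel hk0 hk, one_smul]
  -- If the reinforcement is proportional to `ν`, then every composition is proportional to `ν`: the
  -- sequence is i.i.d., and any urn reinforced by `ν` describes it.
  · refine ⟨1, Kernel.const E ν, one_pos, inferInstance, hurn.congr hX hid hprop fun n x hx =>
      ⟨(ENNReal.ofReal θ + ∑ i, R (x i) Set.univ) / (1 + n), ?_, ?_, ?_⟩⟩
    · simp [h.theta_pos, ENNReal.div_eq_zero_iff]
    · refine ENNReal.div_ne_top (ENNReal.add_ne_top.2 ⟨ENNReal.ofReal_ne_top, ?_⟩) (by simp)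
      exact ENNReal.sum_ne_top.2 fun i _ => measure_ne_top _ _
    · have e1 : urnState θ ν R x = (ENNReal.ofReal θ + ∑ i, R (x i) Set.univ) • ν := by
        rw [urnState, add_smul, Finset.sum_smul]
        congr 1
        exact Finset.sum_congr rfl fun i _ => hx i
      have e2 : urnState 1 ν (Kernel.const E ν) x = (1 + n : ℝ≥0∞) • ν := by
        simp [urnState, add_smul, Nat.cast_smul_eq_nsmul]
      rw [e1, e2, smul_smul, ENNReal.div_mul_cancel (by simp) (by simp)]

end Normalisation

/-! ### Markov reinforcement is conditioning on a random variable -/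

section Disintegration

variable {E : Type w} [MeasurableSpace E] {R : Kernel E E} [IsMarkovKernel R] {ν : Measure E}
  {c : ℝ≥0∞}

/-- For Markov reinforcement the normalising constants are deterministic and cancel. -/
theorem SymmetricDraws.setLIntegral_kernel_swap {N : Measure E} [IsFiniteMeasure N] (hN : N ≠ 0)
    (h : SymmetricDraws R N) {A B : Set E} (hA : MeasurableSet A) (hB : MeasurableSet B) :
    ∫⁻ y in A, R y B ∂N = ∫⁻ y in B, R y A ∂N := by
  have h1 := h.setLIntegral_swap hN hA hB
  simp only [measure_univ (μ := R _)] at h1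
  have hM : (N Set.univ + 1)⁻¹ ≠ ∞ := ENNReal.inv_ne_top.2 (by simp)
  have hM0 : (N Set.univ + 1)⁻¹ ≠ 0 := ENNReal.inv_ne_zero.2
    (ENNReal.add_ne_top.2 ⟨measure_ne_top _ _, ENNReal.one_ne_top⟩)
  rw [lintegral_const_mul' _ _ hM, lintegral_const_mul' _ _ hM, ENNReal.mul_right_inj hM0 hM,
    lintegral_add_left measurable_const, lintegral_add_left measurable_const, setLIntegral_const,
    setLIntegral_const, mul_comm] at h1
  exact (ENNReal.add_right_inj (ENNReal.mul_ne_top (measure_ne_top _ _) (measure_ne_top _ _))).1 h1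

/-- If draws are exchangeable in the initial urn, then the reinforcement is reversible with respect
to `ν`. -/
theorem SymmetricDraws.setLIntegral_kernel_swap_smul [IsProbabilityMeasure ν] (hc0 : c ≠ 0)
    (hc : c ≠ ∞) (h : SymmetricDraws R (c • ν)) {A B : Set E} (hA : MeasurableSet A)
    (hB : MeasurableSet B) : ∫⁻ y in A, R y B ∂ν = ∫⁻ y in B, R y A ∂ν := by
  have := Measure.smul_finite ν hc
  have hne : c • ν ≠ 0 := fun h0 => by
    have := congrArg (fun m : Measure E => m Set.univ) h0
    simp [hc0] at this
  have h1 := h.setLIntegral_kernel_swap hne hA hB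
  simp only [Measure.restrict_smul, lintegral_smul_measure, smul_eq_mul] at h1
  exact (ENNReal.mul_right_inj hc0 hc).1 h1

/-- The law `ν` is stationary for the reinforcement. -/
theorem SymmetricDraws.bind_eq [IsProbabilityMeasure ν] (hc0 : c ≠ 0)
    (hc : c ≠ ∞) (h : SymmetricDraws R (c • ν)) : ν.bind R = ν := by
  refine Measure.ext fun B hB => ?_
  rw [Measure.bind_apply hB R.measurable.aemeasurable]
  have h1 := h.setLIntegral_kernel_swap_smul hc0 hc MeasurableSet.univ hB
  simpa using h1

/-- Exchangeability of the draws after a reinforcement makes `R_x` stationary, too. -/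
theorem SymmetricDraws.bind_kernel_eq [IsProbabilityMeasure ν] (hc0 : c ≠ 0)
    (hc : c ≠ ∞) (h : SymmetricDraws R (c • ν)) {x : E} (hx : SymmetricDraws R (c • ν + R x)) :
    (R x).bind R = R x := by
  have := Measure.smul_finite ν hc
  refine Measure.ext fun B hB => ?_
  rw [Measure.bind_apply hB R.measurable.aemeasurable]
  have hne : c • ν + R x ≠ 0 := fun h0 => by
    have := congrArg (fun m : Measure E => m Set.univ) h0
    simp at this
  have h1 := hx.setLIntegral_kernel_swap hne MeasurableSet.univ hB
  have h2 : ∫⁻ y, R y B ∂(c • ν) = (c • ν) B := by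
    have := h.bind_eq hc0 hc
    rw [lintegral_smul_measure, ← Measure.bind_apply hB R.measurable.aemeasurable, this]
    rfl
  simp only [Measure.restrict_univ, lintegral_add_measure, measure_univ, setLIntegral_one,
    Measure.add_apply, h2] at h1
  exact (ENNReal.add_right_inj (measure_ne_top _ _)).1 h1

/-- If `ν R = ν` and `R_x R = R_x`, then `R_y = R_x` for `R_x`-almost every `y`: the variance of
`y ↦ R_y(A)` under `R_x` has `ν`-mean `0`. -/
theorem ae_ae_kernel_eq [MeasurableSpace.CountablyGenerated E] [IsProbabilityMeasure ν]
    (h0 : ν.bind R = ν) (h1 : ∀ᵐ x ∂ν, (R x).bind R = R x) :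
    ∀ᵐ x ∂ν, ∀ᵐ y ∂(R x), R y = R x := by
  refine Measure.ae_ae_of_ae_compProd (p := fun q => R q.2 = R q.1) ?_
  refine ae_eq_of_forall_ae_measure_eq (fun _ => inferInstance) fun A hA => ?_
  set h : E → ℝ := fun x => (R x).real A with hh
  have hm : Measurable h := (R.measurable_coe hA).ennreal_toReal
  have hb : ∀ x, |h x| ≤ 1 := fun x => by
    rw [hh, abs_of_nonneg measureReal_nonneg]
    exact measureReal_le_one
  have hb2 : ∀ x y, |h x * h y| ≤ 1 := fun x y => by
    rw [abs_mul]
    exact mul_le_one₀ (hb x) (abs_nonneg _) (hb y)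
  have isnd : Integrable (fun q : E × E => h q.2 * h q.2) (ν ⊗ₘ R) :=
    integrable_of_bounded (by fun_prop) fun q => hb2 _ _
  have ifst : Integrable (fun q : E × E => h q.1 * h q.1) (ν ⊗ₘ R) :=
    integrable_of_bounded (by fun_prop) fun q => hb2 _ _
  have icross : Integrable (fun q : E × E => h q.1 * h q.2) (ν ⊗ₘ R) :=
    integrable_of_bounded (by fun_prop) fun q => hb2 _ _
  have e1 : ∫ q, h q.2 * h q.2 ∂(ν ⊗ₘ R) = ∫ x, h x * h x ∂ν := by
    have hsnd : (ν ⊗ₘ R).map Prod.snd = ν := by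
      rw [← Measure.snd, Measure.snd_compProd]
      exact h0
    conv_rhs => rw [← hsnd]
    rw [integral_map measurable_snd.aemeasurable (by fun_prop)]
  have e2 : ∫ q, h q.1 * h q.1 ∂(ν ⊗ₘ R) = ∫ x, h x * h x ∂ν := by
    rw [Measure.integral_compProd ifst]
    simp
  have e3 : ∫ q, h q.1 * h q.2 ∂(ν ⊗ₘ R) = ∫ x, h x * h x ∂ν := by
    rw [Measure.integral_compProd icross]
    refine integral_congr_ae ?_
    filter_upwards [h1] with x hx
    rw [integral_const_mul]
    congr 1
    rw [hh]
    simp only [Measure.real]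
    rw [integral_toReal (R.measurable_coe hA).aemeasurable
      (Filter.Eventually.of_forall fun y => measure_lt_top _ _),
      ← Measure.bind_apply hA R.measurable.aemeasurable, hx]
  -- The three terms of the expanded square have the same integral.
  have e4 : ∫ q, (h q.2 - h q.1) * (h q.2 - h q.1) ∂(ν ⊗ₘ R) = 0 := by
    have e : ∀ q : E × E, (h q.2 - h q.1) * (h q.2 - h q.1)
        = h q.2 * h q.2 + h q.1 * h q.1 - 2 * (h q.1 * h q.2) := fun q => by ring
    simp only [e]
    have isum : Integrable (fun q : E × E => h q.2 * h q.2 + h q.1 * h q.1) (ν ⊗ₘ R) :=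
      isnd.add ifst
    rw [integral_sub isum (icross.const_mul 2), integral_add isnd ifst,
      integral_const_mul, e1, e2, e3]
    ring
  have ivar : Integrable (fun q : E × E => (h q.2 - h q.1) * (h q.2 - h q.1)) (ν ⊗ₘ R) := by
    have e : ∀ q : E × E, (h q.2 - h q.1) * (h q.2 - h q.1)
        = h q.2 * h q.2 + h q.1 * h q.1 - 2 * (h q.1 * h q.2) := fun q => by ring
    simp only [e]
    exact (isnd.add ifst).sub (icross.const_mul 2)
  filter_upwards [(integral_eq_zero_iff_of_nonneg (fun q => mul_self_nonneg _) ivar).1 e4] with q hq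
  have hq' : h q.2 = h q.1 := sub_eq_zero.1 (mul_self_eq_zero.1 hq)
  rw [← ofReal_measureReal (μ := R q.2), ← ofReal_measureReal (μ := R q.1)]
  exact congrArg ENNReal.ofReal hq'

/-- If `π` generates the σ-algebra of the Markov kernel `R`, which is reversible and satisfies
`π(y) = π(x)` for `R_x`-almost every `y`, then `R_x` is the conditional distribution given `π`. -/
theorem ae_condDistrib_id_eq [StandardBorelSpace E] [Nonempty E] [IsProbabilityMeasure ν]
    {T : Type v} [MeasurableSpace T] {π : E → T} (hπ : Measurable π)
    (hrev : ∀ A B, MeasurableSet A → MeasurableSet B →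
      ∫⁻ y in A, R y B ∂ν = ∫⁻ y in B, R y A ∂ν)
    (hRπ : Measurable[MeasurableSpace.comap π inferInstance] R)
    (hfib : ∀ᵐ x ∂ν, ∀ᵐ y ∂(R x), π y = π x) :
    ∀ᵐ x ∂ν, condDistrib id π ν (π x) = R x := by
  refine ae_eq_of_forall_ae_measure_eq (fun _ => inferInstance) fun A hA => ?_
  have h1 := condDistrib_ae_eq_condExp (μ := ν) hπ measurable_id hA
  have h2 : ν⟦(id : E → E) ⁻¹' A|MeasurableSpace.comap π inferInstance⟧
      =ᵐ[ν] fun x => (R x).real A := by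
    refine condExp_eq_of_measure_inter_eq hπ.comap_le hA
      ((Measure.measurable_coe hA).comp hRπ).ennreal_toReal (fun x => measureReal_nonneg) ?_
    rintro _ ⟨C, hC, rfl⟩
    have e : ∀ x, ENNReal.ofReal ((R x).real A) = R x A := fun x => ofReal_measureReal
    simp only [e]
    rw [hrev _ _ (hπ hC) hA, ← setLIntegral_one, ← lintegral_indicator ((hπ hC).inter hA),
      ← lintegral_indicator hA]
    refine lintegral_congr_ae ?_
    -- By reversibility the claim is `∫_A R_x(π⁻¹ C) ν(dx) = ν(A ∩ π⁻¹ C)`. As `π` is constant under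
    -- `R_x`, the mass `R_x(π⁻¹ C)` is the indicator of `π⁻¹ C` at `x`.
    filter_upwards [hfib] with x hx
    by_cases hxA : x ∈ A
    · by_cases hxC : π x ∈ C
      · have : ∀ᵐ y ∂(R x), y ∈ π ⁻¹' C := by
          filter_upwards [hx] with y hy
          rwa [Set.mem_preimage, hy]
        simp [hxA, hxC, prob_compl_eq_zero_iff (hπ hC) |>.1 this]
      · have : ∀ᵐ y ∂(R x), y ∉ π ⁻¹' C := by
          filter_upwards [hx] with y hy
          rwa [Set.mem_preimage, hy]
        simp [hxA, hxC, measure_eq_zero_iff_ae_notMem.2 this]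
    · simp [hxA]
  filter_upwards [h1.trans h2] with x hx
  rw [← ofReal_measureReal (μ := condDistrib id π ν (π x)), ← ofReal_measureReal (μ := R x)]
  exact congrArg ENNReal.ofReal hx

end Disintegration

/-! ### Balanced urns: replacing observations by their conditional laws -/

section Balanced

variable {Ω : Type u} {E : Type w} [MeasurableSpace Ω] [MeasurableSpace E]
  {P : Measure Ω} {X : ℕ → Ω → E} {θ : ℝ} {ν : Measure E} {R : Kernel E E}

/-- The predictive rule when the reinforcement is a Markov kernel: the total mass of the urn is
deterministic. -/
theorem IsUrnSequence.lintegral_succ_of_isMarkovKernel [IsProbabilityMeasure P]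
    [IsProbabilityMeasure ν] [IsMarkovKernel R] (h : IsUrnSequence P X θ ν R) (hθ : 0 < θ)
    (hX : ∀ i, Measurable (X i)) (n : ℕ) {Φ : (Fin n → E) → ℝ≥0∞} (hΦ : Measurable Φ)
    {g : E → ℝ≥0∞} (hg : Measurable g) :
    (ENNReal.ofReal θ + n) * ∫⁻ ω, Φ (fun i => X i ω) * g (X n ω) ∂P
      = ENNReal.ofReal θ * (∫⁻ y, g y ∂ν) * ∫⁻ ω, Φ (fun i => X i ω) ∂P
        + ∑ k : Fin n, ∫⁻ ω, Φ (fun i => X i ω) * ∫⁻ y, g y ∂(R (X k ω)) ∂P := by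
  have hpre := measurable_prefix hX n
  have hc0 : ENNReal.ofReal θ + n ≠ 0 := by simp [hθ]
  have hc : ENNReal.ofReal θ + n ≠ ∞ := by simp
  rw [h.lintegral_succ hX n (φ := fun x y => Φ x * g y)
    ((hΦ.comp measurable_fst).mul (hg.comp measurable_snd))]
  have e : ∀ ω, ∫⁻ y, Φ (fun i => X i ω) * g y
      ∂(normalizeKernel E (urnState θ ν R fun i : Fin n => X i ω))
      = (ENNReal.ofReal θ + n)⁻¹ * (ENNReal.ofReal θ * (∫⁻ y, g y ∂ν) * Φ (fun i => X i ω)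
        + ∑ k : Fin n, Φ (fun i => X i ω) * ∫⁻ y, g y ∂(R (X k ω))) := by
    intro ω
    rw [lintegral_const_mul _ hg, lintegral_normalizeKernel, urnState_apply, urnState,
      lintegral_add_measure, lintegral_smul_measure, lintegral_finsetSum_measure,
      ← Finset.mul_sum]
    simp only [measure_univ, mul_one, Finset.sum_const, Finset.card_univ, Fintype.card_fin,
      nsmul_eq_mul, smul_eq_mul]
    ring
  have hΦX : Measurable fun ω => Φ fun i => X i ω := hΦ.comp hpre
  have hk : ∀ k : Fin n, Measurable fun ω => Φ (fun i => X i ω) * ∫⁻ y, g y ∂(R (X k ω)) :=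
    fun k => (hΦ.comp hpre).mul (hg.lintegral_kernel.comp (hX k))
  simp only [e]
  rw [lintegral_const_mul' _ _ (ENNReal.inv_ne_top.2 hc0), ← mul_assoc,
    ENNReal.mul_inv_cancel hc0 hc, one_mul, lintegral_add_left (hΦX.const_mul _),
    lintegral_const_mul _ hΦX, lintegral_finsetSum _ fun k _ => hk k]

variable [IsProbabilityMeasure P] [IsProbabilityMeasure ν] [IsMarkovKernel R]

/-- If `ν R = ν` and `R_x R = R_x`, then the predictive laws are invariant under `R`, so that the
last observation may be resampled from `R`. -/
theorem IsUrnSequence.lintegral_resample_last (h : IsUrnSequence P X θ ν R) (hθ : 0 < θ)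
    (hX : ∀ i, Measurable (X i)) (hid : ∀ i, P.map (X i) = ν) (hν : ν.bind R = ν)
    (hRR : ∀ᵐ x ∂ν, (R x).bind R = R x) (n : ℕ) {Φ : (Fin n → E) → ℝ≥0∞} (hΦ : Measurable Φ)
    {g : E → ℝ≥0∞} (hg : Measurable g) :
    ∫⁻ ω, Φ (fun i => X i ω) * g (X n ω) ∂P
      = ∫⁻ ω, Φ (fun i => X i ω) * ∫⁻ y, g y ∂(R (X n ω)) ∂P := by
  have hc0 : ENNReal.ofReal θ + n ≠ 0 := by simp [hθ]
  have hc : ENNReal.ofReal θ + n ≠ ∞ := by simp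
  have h1 := h.lintegral_succ_of_isMarkovKernel hθ hX n hΦ hg
  have h2 := h.lintegral_succ_of_isMarkovKernel hθ hX n hΦ
    (g := fun x => ∫⁻ y, g y ∂(R x)) hg.lintegral_kernel
  have e1 : ∫⁻ x, ∫⁻ y, g y ∂(R x) ∂ν = ∫⁻ y, g y ∂ν := by
    rw [← Measure.lintegral_bind R.measurable.aemeasurable hg.aemeasurable, hν]
  have e2 : ∀ k, ∫⁻ ω, Φ (fun i => X i ω) * ∫⁻ x, ∫⁻ y, g y ∂(R x) ∂(R (X k ω)) ∂P
      = ∫⁻ ω, Φ (fun i => X i ω) * ∫⁻ y, g y ∂(R (X k ω)) ∂P := by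
    intro k
    refine lintegral_congr_ae ?_
    have hae := hRR
    rw [← hid k] at hae
    filter_upwards [ae_of_ae_map (hX k).aemeasurable hae] with ω hω
    rw [← Measure.lintegral_bind R.measurable.aemeasurable hg.aemeasurable, hω]
  simp only [e1, e2] at h2
  rw [← h2] at h1
  exact (ENNReal.mul_right_inj hc0 hc).1 h1

theorem IsExchangeable.lintegral_prod_comp_perm {P : Measure Ω} (h : IsExchangeable P X)
    (hX : ∀ i, Measurable (X i)) {n : ℕ} (σ : Equiv.Perm (Fin n)) {g : Fin n → E → ℝ≥0∞}
    (hg : ∀ i, Measurable (g i)) :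
    ∫⁻ ω, ∏ i, g (σ i) (X i ω) ∂P = ∫⁻ ω, ∏ i, g i (X i ω) ∂P := by
  have hm : Measurable fun x : Fin n → E => ∏ i, g i (x i) :=
    Finset.measurable_fun_prod _ fun i _ => (hg i).comp (measurable_pi_apply i)
  rw [← lintegral_map hm (measurable_prefix hX n), ← h n σ⁻¹,
    lintegral_map hm (measurable_pi_lambda _ fun i => hX _)]
  refine lintegral_congr fun ω => ?_
  refine Fintype.prod_equiv σ _ _ fun i => ?_
  simp

/-- In an exchangeable sequence any observation may be resampled from `R`. -/
theorem IsUrnSequence.lintegral_resample_one (h : IsUrnSequence P X θ ν R) (hθ : 0 < θ)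
    (hX : ∀ i, Measurable (X i)) (hex : IsExchangeable P X) (hid : ∀ i, P.map (X i) = ν)
    (hν : ν.bind R = ν) (hRR : ∀ᵐ x ∂ν, (R x).bind R = R x) {n : ℕ} {g : Fin n → E → ℝ≥0∞}
    (hg : ∀ i, Measurable (g i)) (j : Fin n) :
    ∫⁻ ω, ∏ i, g i (X i ω) ∂P
      = ∫⁻ ω, ∏ i, Function.update g j (fun x => ∫⁻ y, g j y ∂(R x)) i (X i ω) ∂P := by
  obtain _ | n := n
  · exact j.elim0
  set σ : Equiv.Perm (Fin (n + 1)) := Equiv.swap j (Fin.last n) with hσ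
  have hσl : σ (Fin.last n) = j := Equiv.swap_apply_right _ _
  have hupd : ∀ i, Measurable (Function.update g j (fun x => ∫⁻ y, g j y ∂(R x)) i) := by
    intro i
    by_cases hi : i = j
    · subst hi
      simpa using (hg i).lintegral_kernel
    · simpa [hi] using hg i
  rw [← hex.lintegral_prod_comp_perm hX σ hg, ← hex.lintegral_prod_comp_perm hX σ hupd]
  have e : ∀ i : Fin n, σ i.castSucc ≠ j := fun i hi => by
    rw [← hσl, σ.injective.eq_iff] at hi
    exact (Fin.castSucc_lt_last i).ne hi
  simp only [Fin.prod_univ_castSucc, hσl, Function.update_self, ne_eq, e, not_false_eq_true,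
    Function.update_of_ne]
  exact h.lintegral_resample_last hθ hX hid hν hRR n
    (Φ := fun x => ∏ i : Fin n, g (σ i.castSucc) (x i))
    (Finset.measurable_fun_prod _ fun i _ => (hg _).comp (measurable_pi_apply i)) (hg j)

/-- All observations may be resampled from `R`, independently of each other. -/
theorem IsUrnSequence.lintegral_resample (h : IsUrnSequence P X θ ν R) (hθ : 0 < θ)
    (hX : ∀ i, Measurable (X i)) (hex : IsExchangeable P X) (hid : ∀ i, P.map (X i) = ν)
    (hν : ν.bind R = ν) (hRR : ∀ᵐ x ∂ν, (R x).bind R = R x) {g : ℕ → E → ℝ≥0∞}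
    (hg : ∀ i, Measurable (g i)) (n : ℕ) :
    ∫⁻ ω, ∏ i ∈ Finset.range n, g i (X i ω) ∂P
      = ∫⁻ ω, ∏ i ∈ Finset.range n, ∫⁻ y, g i y ∂(R (X i ω)) ∂P := by
  have key : ∀ s : Finset (Fin n), ∫⁻ ω, ∏ i : Fin n, g i (X i ω) ∂P
      = ∫⁻ ω, ∏ i : Fin n, (if i ∈ s then fun x => ∫⁻ y, g i y ∂(R x) else g i) (X i ω) ∂P := by
    intro s
    induction s using Finset.induction_on with
    | empty => simp
    | insert j s hj ih =>
      rw [ih, h.lintegral_resample_one hθ hX hex hid hν hRR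
        (g := fun i : Fin n => if i ∈ s then fun x => ∫⁻ y, g i y ∂(R x) else g i)
        (fun i => by
          split_ifs
          · exact (hg i).lintegral_kernel
          · exact hg i) j]
      refine lintegral_congr fun ω => Finset.prod_congr rfl fun i _ => ?_
      by_cases hi : i = j
      · subst hi
        simp [hj]
      · simp [hi]
  simp only [Finset.prod_range]
  simpa using key Finset.univ

end Balanced

section Statistic

variable {E : Type w} [MeasurableSpace E] [MeasurableSpace.CountablyGenerated E]

instance standardBorelSpace_ulift {α : Type*} [MeasurableSpace α] [StandardBorelSpace α] :
    StandardBorelSpace (ULift.{v} α) := by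
  let _ := upgradeStandardBorel α
  have : PolishSpace (ULift.{v} α) := Topology.IsClosedEmbedding.uliftDown.polishSpace
  infer_instance

/-- Every Markov kernel generates the same σ-algebra as a measurable map to a standard Borel space,
given by the masses of the sets of a countable generating π-system. -/
theorem exists_statistic {α : Type*} [MeasurableSpace α] (κ : Kernel α E) [IsMarkovKernel κ] :
    ∃ π : α → (ℕ → ℝ), Measurable π ∧
      Measurable[MeasurableSpace.comap π inferInstance] κ ∧
      ∀ x y, κ x = κ y → π x = π y := by
  obtain ⟨A, hA, hpi, hgen, -⟩ := exists_piSystem_seq E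
  refine ⟨fun x n => (κ x).real (A n), measurable_pi_lambda _ fun n =>
    (κ.measurable_coe (hA n)).ennreal_toReal, ?_, fun x y h => by simp [h]⟩
  refine @Measurable.measure_of_isPiSystem_of_isProbabilityMeasure _ _
    (MeasurableSpace.comap _ inferInstance) _ _ (fun a => inferInstance) _ hgen hpi ?_
  rintro _ ⟨n, rfl⟩
  have e : (fun x => κ x (A n)) = (fun r : ℕ → ℝ => ENNReal.ofReal (r n)) ∘
      fun x n => (κ x).real (A n) := by
    funext x
    simp
  rw [e]
  exact (ENNReal.measurable_ofReal.comp (measurable_pi_apply n)).comp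
    (comap_measurable _)

end Statistic

/-! ### Mixtures of i.i.d. sequences: recovering the mixing measure -/

section Mixture

variable {T : Type v} [MeasurableSpace T]

theorem measurableSet_isProbabilityMeasure :
    MeasurableSet {m : Measure T | IsProbabilityMeasure m} := by
  have e : {m : Measure T | IsProbabilityMeasure m} = (fun m => m Set.univ) ⁻¹' {1} := by
    ext m
    exact isProbabilityMeasure_iff
  rw [e]
  exact Measure.measurable_coe MeasurableSet.univ (measurableSet_singleton 1)

open Classical in
/-- The tautological kernel `m ↦ m` on the space of measures, made Markov by sending every measure
that is not a probability measure to a point mass. -/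
def tautologicalKernel (T : Type v) [MeasurableSpace T] [Nonempty T] : Kernel (Measure T) T :=
  Kernel.piecewise measurableSet_isProbabilityMeasure ⟨id, measurable_id⟩
    (Kernel.const _ (Measure.dirac (Classical.arbitrary T)))

instance [Nonempty T] : IsMarkovKernel (tautologicalKernel T) := by
  refine ⟨fun m => ?_⟩
  classical
  rw [tautologicalKernel, Kernel.piecewise_apply]
  split_ifs with h
  · exact h
  · rw [Kernel.const_apply]
    infer_instance

theorem tautologicalKernel_apply [Nonempty T] (m : Measure T) [h : IsProbabilityMeasure m] :
    tautologicalKernel T m = m := by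
  classical
  rw [tautologicalKernel, Kernel.piecewise_apply,
    if_pos (show m ∈ {m : Measure T | IsProbabilityMeasure m} from h)]
  rfl

/-- Strong law of large numbers for the empirical frequency of a set. -/
theorem ae_tendsto_frequency (m : Measure T) [IsProbabilityMeasure m] {A : Set T}
    (hA : MeasurableSet A) :
    ∀ᵐ s ∂(Measure.infinitePi fun _ : ℕ => m), Filter.Tendsto
      (fun n : ℕ => (∑ i ∈ Finset.range n, A.indicator (1 : T → ℝ) (s i)) / n) Filter.atTop
      (nhds (m.real A)) := by
  have hAm : Measurable (A.indicator (1 : T → ℝ)) := measurable_one.indicator hA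
  have hmp := fun i : ℕ => measurePreserving_eval_infinitePi (fun _ : ℕ => m) i
  have hint : Integrable (fun s : ℕ → T => A.indicator (1 : T → ℝ) (s 0))
      (Measure.infinitePi fun _ : ℕ => m) :=
    (hmp 0).integrable_comp_of_integrable ((integrable_const (1 : ℝ)).indicator hA)
  have h := strong_law_ae_real (fun i (s : ℕ → T) => A.indicator (1 : T → ℝ) (s i)) hint
    (fun i j hij => (iIndepFun_infinitePi (P := fun _ : ℕ => m)
      (X := fun _ => A.indicator (1 : T → ℝ)) fun _ => hAm).indepFun hij)
    (fun i => ⟨(hAm.comp (measurable_pi_apply i)).aemeasurable,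
      (hAm.comp (measurable_pi_apply 0)).aemeasurable, by
        have e : ∀ j : ℕ, Measure.map (fun s : ℕ → T => A.indicator (1 : T → ℝ) (s j))
            (Measure.infinitePi fun _ : ℕ => m) = m.map (A.indicator (1 : T → ℝ)) := fun j => by
          conv_rhs => rw [← (hmp j).map_eq, Measure.map_map hAm (measurable_pi_apply j)]
          rfl
        rw [e i, e 0]⟩)
  have e : ∫ s : ℕ → T, A.indicator (1 : T → ℝ) (s 0) ∂(Measure.infinitePi fun _ : ℕ => m)
      = m.real A := by
    have e1 := integral_map (μ := Measure.infinitePi fun _ : ℕ => m)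
      (measurable_pi_apply 0).aemeasurable (f := A.indicator (1 : T → ℝ))
      hAm.aestronglyMeasurable
    rw [(hmp 0).map_eq, integral_indicator_one hA] at e1
    exact e1.symm
  rwa [e] at h

/-- A Markov kernel into a standard Borel space that is measurable with respect to a map `a`
factors through `a`, almost surely. -/
theorem exists_kernel_factor [StandardBorelSpace T] [Nonempty T] {Z W : Type*}
    [MeasurableSpace Z] [MeasurableSpace W] {Θ : Measure Z} [IsProbabilityMeasure Θ]
    (κ : Kernel Z T) [IsMarkovKernel κ] {a : Z → W} (ha : Measurable a)
    (hκ : Measurable[MeasurableSpace.comap a inferInstance] κ) :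
    ∃ G : Kernel W T, IsMarkovKernel G ∧ ∀ᵐ z ∂Θ, G (a z) = κ z := by
  refine ⟨condDistrib Prod.snd (fun q : Z × T => a q.1) (Θ ⊗ₘ κ), inferInstance, ?_⟩
  refine ae_eq_of_forall_ae_measure_eq (fun _ => inferInstance) fun A hA => ?_
  have ha' : Measurable fun q : Z × T => a q.1 := ha.comp measurable_fst
  have h1 := condDistrib_ae_eq_condExp (μ := Θ ⊗ₘ κ) ha' measurable_snd hA
  have h2 : (Θ ⊗ₘ κ)⟦(Prod.snd : Z × T → T) ⁻¹' A|
      MeasurableSpace.comap (fun q : Z × T => a q.1) inferInstance⟧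
      =ᵐ[Θ ⊗ₘ κ] fun q => (κ q.1).real A := by
    have hκ' : Measurable[MeasurableSpace.comap (fun q : Z × T => a q.1) inferInstance]
        fun q : Z × T => κ q.1 := by
      refine hκ.comp ?_
      rw [measurable_iff_comap_le, MeasurableSpace.comap_comp]
      exact le_rfl
    refine condExp_eq_of_measure_inter_eq ha'.comap_le (measurable_snd hA)
      ((Measure.measurable_coe hA).comp hκ').ennreal_toReal (fun x => measureReal_nonneg) ?_
    rintro _ ⟨C, hC, rfl⟩
    have e : ∀ q : Z × T, ENNReal.ofReal ((κ q.1).real A) = κ q.1 A := fun q => ofReal_measureReal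
    simp only [e]
    have e1 : (fun q : Z × T => a q.1) ⁻¹' C ∩ Prod.snd ⁻¹' A = (a ⁻¹' C) ×ˢ A := rfl
    have e2 : (fun q : Z × T => a q.1) ⁻¹' C = (a ⁻¹' C) ×ˢ Set.univ := by
      ext
      simp
    rw [e1, Measure.compProd_apply_prod (ha hC) hA, e2, Measure.setLIntegral_compProd
      (f := fun q => κ q.1 A) ((κ.measurable_coe hA).comp measurable_fst) (ha hC)
      MeasurableSet.univ]
    simp
  have h3 := Measure.ae_ae_of_ae_compProd (h1.trans h2)
  filter_upwards [h3] with z hz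
  obtain ⟨y, hy⟩ := hz.exists
  rw [← ofReal_measureReal (μ := κ z), ← hy, ofReal_measureReal]

/-- The mixing measure of a mixture of i.i.d. sequences is a function of the sequence. -/
theorem exists_kernel_mixing [StandardBorelSpace T] [Nonempty T] (Θ : Measure (Measure T))
    [IsProbabilityMeasure Θ] :
    ∃ F : Kernel (ℕ → T) T, IsMarkovKernel F ∧
      ∀ᵐ q ∂(Θ ⊗ₘ infinitePiKernel fun _ => tautologicalKernel T),
        F q.2 = tautologicalKernel T q.1 := by
  obtain ⟨A, hA, hpi, hgen, -⟩ := exists_piSystem_seq T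
  set κ := tautologicalKernel T with hκ
  set a : Measure T → (ℕ → ℝ) := fun m k => (κ m).real (A k) with ha
  have ham : Measurable a :=
    measurable_pi_lambda _ fun k => (κ.measurable_coe (hA k)).ennreal_toReal
  have hκa : Measurable[MeasurableSpace.comap a inferInstance] κ := by
    refine @Measurable.measure_of_isPiSystem_of_isProbabilityMeasure _ _
      (MeasurableSpace.comap _ inferInstance) _ _ (fun a => inferInstance) _ hgen hpi ?_
    rintro _ ⟨n, rfl⟩
    have e : (fun m => κ m (A n)) = (fun r : ℕ → ℝ => ENNReal.ofReal (r n)) ∘ a := by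
      funext m
      simp [ha]
    rw [e]
    exact (ENNReal.measurable_ofReal.comp (measurable_pi_apply n)).comp (comap_measurable _)
  obtain ⟨G, hG, hGκ⟩ := exists_kernel_factor (Θ := Θ) κ ham hκa
  -- The limiting frequencies of the generating sets recover `a`. The upper limit makes them
  -- measurable functions of every sequence, convergent or not.
  set l : (ℕ → T) → (ℕ → ℝ) := fun s k => Filter.limsup
    (fun n : ℕ => (∑ i ∈ Finset.range n, (A k).indicator (1 : T → ℝ) (s i)) / n) Filter.atTop
  have hl : Measurable l := measurable_pi_lambda _ fun k => Measurable.limsup fun n =>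
    (Finset.measurable_fun_sum _ fun i _ =>
      (measurable_one.indicator (hA k)).comp (measurable_pi_apply i)).div_const _
  refine ⟨G.comap l hl, inferInstance, ?_⟩
  have h1 : ∀ᵐ q ∂(Θ ⊗ₘ infinitePiKernel fun _ => κ), l q.2 = a q.1 := by
    refine Measure.ae_compProd_of_ae_ae
      (measurableSet_eq_fun (hl.comp measurable_snd) (ham.comp measurable_fst))
      (Filter.Eventually.of_forall fun m => ?_)
    rw [infinitePiKernel_apply]
    filter_upwards [ae_all_iff.2 fun k => ae_tendsto_frequency (κ m) (hA k)] with s hs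
    funext k
    exact (hs k).limsup_eq
  have h2 : ∀ᵐ q ∂(Θ ⊗ₘ infinitePiKernel fun _ => κ), G (a q.1) = κ q.1 := by
    have hfst : (Θ ⊗ₘ infinitePiKernel fun _ => κ).map Prod.fst = Θ := Measure.fst_compProd _ _
    rw [← hfst] at hGκ
    exact ae_of_ae_map measurable_fst.aemeasurable hGκ
  filter_upwards [h1, h2] with q hq1 hq2
  rw [Kernel.comap_apply, hq1, hq2]

/-- A sequence whose law is a mixture of laws of i.i.d. sequences, with mixing law `Θ`, is i.i.d.
given a random measure with law `Θ`, which is a function of the sequence. -/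
theorem exists_mixing_kernel [StandardBorelSpace T] [Nonempty T] {Ω : Type u} [MeasurableSpace Ω]
    {P : Measure Ω} [IsProbabilityMeasure P] {p : ℕ → Ω → T} (hp : ∀ i, Measurable (p i))
    {Θ : Measure (Measure T)} [IsProbabilityMeasure Θ] (hΘ : ∀ᵐ m ∂Θ, IsProbabilityMeasure m)
    (h : ∀ (n : ℕ) (A : ℕ → Set T), (∀ i, MeasurableSet (A i)) →
      P {ω | ∀ i < n, p i ω ∈ A i} = ∫⁻ m, ∏ i ∈ Finset.range n, m (A i) ∂Θ) :
    ∃ Q : Kernel Ω T, IsMarkovKernel Q ∧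
      Measurable[MeasurableSpace.comap (fun ω n => p n ω) inferInstance] Q ∧
      P.map Q = Θ ∧
      CondIndepWithLaw P (MeasurableSpace.comap (fun ω => Q ω) inferInstance) p
        fun _ ω => Q ω := by
  have hpm : Measurable fun ω n => p n ω := measurable_pi_lambda _ hp
  set κ := tautologicalKernel T with hκ
  set J := Θ ⊗ₘ infinitePiKernel fun _ => κ with hJ
  obtain ⟨F, hF, hFJ⟩ := exists_kernel_mixing (T := T) Θ
  have hbox : ∀ (n : ℕ) (A : ℕ → Set T), (∀ i, MeasurableSet (A i)) →
      ∀ D : Set (Measure T), MeasurableSet D → J (D ×ˢ {s | ∀ i < n, s i ∈ A i})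
        = ∫⁻ m in D, ∏ i ∈ Finset.range n, κ m (A i) ∂Θ := fun n A hA D hD => by
    rw [hJ, Measure.compProd_apply_prod hD (measurableSet_seqBox hA n)]
    simp only [infinitePiKernel_apply, infinitePi_seqBox _ hA]
  have hsnd : P.map (fun ω n => p n ω) = J.map Prod.snd := by
    refine ext_of_seqBox fun n A hA => ?_
    have e : Prod.snd ⁻¹' {s : ℕ → T | ∀ i < n, s i ∈ A i}
        = (Set.univ : Set (Measure T)) ×ˢ {s | ∀ i < n, s i ∈ A i} := by
      ext
      simp
    rw [Measure.map_apply hpm (measurableSet_seqBox hA n),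
      Measure.map_apply measurable_snd (measurableSet_seqBox hA n), e,
      hbox n A hA _ MeasurableSet.univ, Measure.restrict_univ]
    refine (h n A hA).trans (lintegral_congr_ae ?_)
    filter_upwards [hΘ] with m hm
    rw [hκ, tautologicalKernel_apply]
  set Q := F.comap _ hpm with hQ
  have hκid : ∀ᵐ m ∂Θ, κ m = m := by
    filter_upwards [hΘ] with m hm using tautologicalKernel_apply m
  -- The pair of mixing measure and sequence has the law `J` of the mixture, because the first
  -- component is the same function of the second on both sides.
  have hjoint : P.map (fun ω => (Q ω, fun n => p n ω)) = J := by
    have hg : Measurable fun s : ℕ → T => (F s, s) := F.measurable.prodMk measurable_id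
    have e1 : P.map (fun ω => (Q ω, fun n => p n ω))
        = (P.map fun ω n => p n ω).map fun s => (F s, s) := by
      rw [Measure.map_map hg hpm]
      rfl
    have hfst : ∀ᵐ q ∂J, κ q.1 = q.1 := by
      have hfst : J.map Prod.fst = Θ := Measure.fst_compProd _ _
      rw [← hfst] at hκid
      exact ae_of_ae_map measurable_fst.aemeasurable hκid
    rw [e1, hsnd, Measure.map_map hg measurable_snd]
    conv_rhs => rw [← Measure.map_id (μ := J)]
    refine Measure.map_congr ?_
    filter_upwards [hFJ, hfst] with q hq1 hq2
    simp only [Function.comp_apply, id_eq]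
    rw [hq1, hq2]
  have hQm : Measurable fun ω => Q ω := Q.measurable
  have hlaw : P.map Q = Θ := by
    have e : J.map Prod.fst = Θ := Measure.fst_compProd _ _
    rw [← e, ← hjoint, Measure.map_map measurable_fst (hQm.prodMk hpm)]
    rfl
  refine ⟨Q, inferInstance, F.measurable.comp (comap_measurable _), hlaw, ?_⟩
  refine condIndepWithLaw_of_measure_inter_eq hQm.comap_le hp (fun i => comap_measurable _) ?_
  rintro n A hA _ ⟨D, hD, rfl⟩
  have e : (fun ω => Q ω) ⁻¹' D ∩ (fun ω i => p i ω) ⁻¹' {s | ∀ i < n, s i ∈ A i}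
      = (fun ω => (Q ω, fun n => p n ω)) ⁻¹' (D ×ˢ {s | ∀ i < n, s i ∈ A i}) := rfl
  have hprod : Measurable fun m : Measure T => ∏ i ∈ Finset.range n, m (A i) :=
    Finset.measurable_fun_prod _ fun i _ => Measure.measurable_coe (hA i)
  rw [e, ← Measure.map_apply (hQm.prodMk hpm) (hD.prod (measurableSet_seqBox hA n)), hjoint,
    hbox n A hA D hD]
  have e2 := setLIntegral_map (μ := P) hD hprod hQm
  rw [hlaw] at e2
  rw [← e2]
  refine lintegral_congr_ae (ae_restrict_of_ae ?_)
  filter_upwards [hκid] with m hm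
  rw [hm]

end Mixture

/-! ### The hierarchical representation of a balanced urn -/

section Hierarchy

/-- The recursion of `dirichletProcess_predictive` determines the mixed moments of a sequence. -/
theorem lintegral_prod_eq_dirichletProcess {Ω : Type u} [MeasurableSpace Ω] {P : Measure Ω}
    [IsProbabilityMeasure P] {T : Type v} [MeasurableSpace T] {p : ℕ → Ω → T} {θ : ℝ} (hθ : 0 < θ)
    {μ : Measure T} [IsProbabilityMeasure μ]
    (h : ∀ (g : ℕ → T → ℝ≥0∞), (∀ i, Measurable (g i)) → ∀ n : ℕ,
      (ENNReal.ofReal θ + n) * ∫⁻ ω, ∏ i ∈ Finset.range (n + 1), g i (p i ω) ∂P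
        = ENNReal.ofReal θ * (∫⁻ y, g n y ∂μ) * ∫⁻ ω, ∏ i ∈ Finset.range n, g i (p i ω) ∂P
          + ∑ k ∈ Finset.range n, ∫⁻ ω, ∏ i ∈ Finset.range n,
            Function.update g k (fun y => g k y * g n y) i (p i ω) ∂P)
    (n : ℕ) {g : ℕ → T → ℝ≥0∞} (hg : ∀ i, Measurable (g i)) (hg1 : ∀ i y, g i y ≤ 1) :
    ∫⁻ ω, ∏ i ∈ Finset.range n, g i (p i ω) ∂P
      = ∫⁻ m, ∏ i ∈ Finset.range n, ∫⁻ y, g i y ∂m ∂(dirichletProcess θ μ) := by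
  have := isProbabilityMeasure_dirichletProcess hθ μ
  induction n generalizing g with
  | zero => simp
  | succ n ih =>
    have hc0 : ENNReal.ofReal θ + n ≠ 0 := by simp [hθ]
    have hc : ENNReal.ofReal θ + n ≠ ∞ := by simp
    rw [← ENNReal.mul_right_inj hc0 hc, h g hg n, dirichletProcess_predictive hθ μ hg hg1 n,
      ih hg hg1]
    congr 1
    refine Finset.sum_congr rfl fun k _ => ih (fun i => ?_) fun i y => ?_
    · by_cases hi : i = k
      · subst hi
        simpa using! (hg i).mul (hg n)
      · simpa [hi] using hg i
    · by_cases hi : i = k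
      · subst hi
        simpa using mul_le_one' (hg1 i y) (hg1 n y)
      · simpa [hi] using hg1 i y

variable {Ω : Type u} {E : Type w} [MeasurableSpace Ω] [MeasurableSpace E]
  {P : Measure Ω} [IsProbabilityMeasure P] {X : ℕ → Ω → E} {θ : ℝ} {ν : Measure E}
  [IsProbabilityMeasure ν] {R : Kernel E E} [IsMarkovKernel R] {T : Type v} [MeasurableSpace T]
  {π : E → T}

/-- If the reinforcement preserves the value of `π`, then `π ∘ X` is a Blackwell–MacQueen urn. -/
theorem IsUrnSequence.lintegral_prod_statistic (h : IsUrnSequence P X θ ν R) (hθ : 0 < θ)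
    (hX : ∀ i, Measurable (X i)) (hid : ∀ i, P.map (X i) = ν) (hπ : Measurable π)
    (hfib : ∀ᵐ x ∂ν, ∀ᵐ y ∂(R x), π y = π x) (n : ℕ) {g : ℕ → T → ℝ≥0∞}
    (hg : ∀ i, Measurable (g i)) (hg1 : ∀ i y, g i y ≤ 1) :
    ∫⁻ ω, ∏ i ∈ Finset.range n, g i (π (X i ω)) ∂P
      = ∫⁻ m, ∏ i ∈ Finset.range n, ∫⁻ y, g i y ∂m ∂(dirichletProcess θ (ν.map π)) := by
  have := Measure.isProbabilityMeasure_map (μ := ν) hπ.aemeasurable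
  refine lintegral_prod_eq_dirichletProcess (p := fun i ω => π (X i ω)) hθ
    (fun g hg n => ?_) n hg hg1
  have h1 := h.lintegral_succ_of_isMarkovKernel hθ hX n
    (Φ := fun x => ∏ i : Fin n, g i (π (x i)))
    (Finset.measurable_fun_prod _ fun i _ => ((hg i).comp hπ).comp (measurable_pi_apply i))
    (g := fun x => g n (π x)) ((hg n).comp hπ)
  simp only [Finset.prod_range_succ]
  simp only [Finset.prod_range, Finset.sum_range]
  rw [h1, lintegral_map (hg n) hπ]
  congr 1
  refine Finset.sum_congr rfl fun k _ => lintegral_congr_ae ?_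
  have hae := hfib
  rw [← hid k] at hae
  filter_upwards [ae_of_ae_map (hX k).aemeasurable hae] with ω hω
  have e : ∫⁻ y, g n (π y) ∂(R (X k ω)) = g n (π (X k ω)) := by
    rw [lintegral_congr_ae (hω.mono fun y hy => by rw [hy])]
    simp
  rw [e, ← Finset.mul_prod_erase _ _ (Finset.mem_univ k),
    ← Finset.mul_prod_erase _ _ (Finset.mem_univ k), Function.update_self, mul_right_comm]
  congr 1
  refine Finset.prod_congr rfl fun i hi => ?_
  rw [Function.update_of_ne fun hik => Finset.ne_of_mem_erase hi (Fin.ext hik)]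

/-- Given the values of `π`, the observations are independent, with law `R`. -/
theorem IsUrnSequence.condIndepWithLaw_statistic [StandardBorelSpace E] [Nonempty E]
    (h : IsUrnSequence P X θ ν R) (hθ : 0 < θ)
    (hX : ∀ i, Measurable (X i)) (hex : IsExchangeable P X) (hid : ∀ i, P.map (X i) = ν)
    (hν : ν.bind R = ν) (hRR : ∀ᵐ x ∂ν, (R x).bind R = R x) (hπ : Measurable π)
    (hfib : ∀ᵐ x ∂ν, ∀ᵐ y ∂(R x), π y = π x)
    (hcond : ∀ᵐ x ∂ν, condDistrib id π ν (π x) = R x) :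
    CondIndepWithLaw P (MeasurableSpace.comap (fun ω n => π (X n ω)) inferInstance) X
      fun n ω => condDistrib id π ν (π (X n ω)) := by
  have hpm : Measurable fun ω n => π (X n ω) := measurable_pi_lambda _ fun n => hπ.comp (hX n)
  refine condIndepWithLaw_of_measure_inter_eq hpm.comap_le hX (fun i => ?_) ?_
  · exact (condDistrib id π ν).measurable.comp
      ((measurable_pi_apply i).comp (comap_measurable (fun ω n => π (X n ω))))
  rintro n A hA _ ⟨D, hD, rfl⟩
  set B : Set Ω := (fun ω i => X i ω) ⁻¹' {s | ∀ i < n, s i ∈ A i} with hB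
  have hBm : MeasurableSet B := measurable_pi_lambda _ hX (measurableSet_seqBox hA n)
  set f : Ω → ℝ≥0∞ := fun ω => ∏ i ∈ Finset.range n, condDistrib id π ν (π (X i ω)) (A i) with hf
  -- For fixed `A`, both sides are measures in the conditioning event, hence it suffices to compare
  -- them on boxes.
  suffices hlaw : (P.restrict B).map (fun ω n => π (X n ω))
      = (P.withDensity f).map fun ω n => π (X n ω) by
    have h1 := congrArg (fun m : Measure (ℕ → T) => m D) hlaw
    simp only [Measure.map_apply hpm hD] at h1
    rwa [Measure.restrict_apply (hpm hD), withDensity_apply _ (hpm hD)] at h1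
  refine ext_of_seqBox fun N D hD => ?_
  have hbox := measurableSet_seqBox hD N
  rw [Measure.map_apply hpm hbox, Measure.map_apply hpm hbox, Measure.restrict_apply (hpm hbox),
    withDensity_apply _ (hpm hbox)]
  -- Both boxes are extended to the same length by factors without a constraint.
  set K := max n N with hK
  set A' : ℕ → Set E := fun i => if i < n then A i else Set.univ with hA'
  set D' : ℕ → Set T := fun i => if i < N then D i else Set.univ with hD'
  have hA'm : ∀ i, MeasurableSet (A' i) := fun i => by
    simp only [hA']
    split_ifs
    exacts [hA i, MeasurableSet.univ]
  have hD'm : ∀ i, MeasurableSet (D' i) := fun i => by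
    simp only [hD']
    split_ifs
    exacts [hD i, MeasurableSet.univ]
  have hS : ∀ i, MeasurableSet (A' i ∩ π ⁻¹' D' i) := fun i => (hA'm i).inter (hπ (hD'm i))
  have e1 : (fun ω n => π (X n ω)) ⁻¹' {s | ∀ i < N, s i ∈ D i} ∩ B
      = {ω | ∀ i < K, X i ω ∈ A' i ∩ π ⁻¹' D' i} := by
    ext ω
    simp only [hB, Set.mem_inter_iff, Set.mem_preimage, Set.mem_ofPred_eq, hA', hD', hK,
      lt_max_iff]
    constructor
    · rintro ⟨h1, h2⟩ i _
      constructor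
      · split_ifs with hi
        exacts [h2 i hi, Set.mem_univ _]
      · split_ifs with hi
        exacts [h1 i hi, Set.mem_univ _]
    · intro h1
      refine ⟨fun i hi => ?_, fun i hi => ?_⟩
      · simpa [hi] using (h1 i (Or.inr hi)).2
      · simpa [hi] using (h1 i (Or.inl hi)).1
  rw [e1, ← lintegral_prod_indicator hX hS K, h.lintegral_resample hθ hX hex hid hν hRR
    (fun i => measurable_one.indicator (hS i)) K, ← lintegral_indicator (hpm hbox)]
  have hae : ∀ᵐ ω ∂P, ∀ i, (∀ᵐ y ∂(R (X i ω)), π y = π (X i ω)) ∧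
      condDistrib id π ν (π (X i ω)) = R (X i ω) := by
    rw [ae_all_iff]
    intro i
    refine ae_of_ae_map (p := fun x => (∀ᵐ y ∂(R x), π y = π x) ∧
      condDistrib id π ν (π x) = R x) (hX i).aemeasurable ?_
    rw [hid i]
    exact hfib.and hcond
  refine lintegral_congr_ae ?_
  filter_upwards [hae] with ω hω
  -- After resampling, the constraint on `π` can be pulled out because `π` is constant under `R_x`.
  have e2 : ∀ i, ∫⁻ y, (A' i ∩ π ⁻¹' D' i).indicator 1 y ∂(R (X i ω))
      = (D' i).indicator 1 (π (X i ω)) * R (X i ω) (A' i) := by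
    intro i
    rw [lintegral_indicator_one (hS i)]
    by_cases hi : π (X i ω) ∈ D' i
    · rw [Set.indicator_of_mem hi, Pi.one_apply, one_mul]
      refine measure_congr ?_
      filter_upwards [(hω i).1] with y hy
      exact propext ⟨fun h => h.1, fun h => ⟨h, by rwa [Set.mem_preimage, hy]⟩⟩
    · rw [Set.indicator_of_notMem hi, zero_mul]
      refine measure_eq_zero_iff_ae_notMem.2 ?_
      filter_upwards [(hω i).1] with y hy hmem
      exact hi (by rw [← hy]; exact hmem.2)
  have e3 : ∏ i ∈ Finset.range K, R (X i ω) (A' i) = f ω := by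
    rw [hf, ← Finset.prod_subset (Finset.range_subset_range.2 (le_max_left n N))]
    · refine Finset.prod_congr rfl fun i hi => ?_
      simp [hA', Finset.mem_range.1 hi, (hω i).2]
    · intro i _ hi
      simp [hA', Finset.mem_range.not.1 hi]
  have e4 : ∏ i ∈ Finset.range K, (D' i).indicator (1 : T → ℝ≥0∞) (π (X i ω))
      = {s : ℕ → T | ∀ i < N, s i ∈ D i}.indicator 1 fun n => π (X n ω) := by
    rw [prod_indicator_one D' fun i => π (X i ω)]
    have e5 : {s : ℕ → T | ∀ i < K, s i ∈ D' i} = {s | ∀ i < N, s i ∈ D i} := by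
      ext s
      simp only [Set.mem_ofPred_eq, hD', hK, lt_max_iff]
      refine ⟨fun h i hi => by simpa [hi] using h i (Or.inr hi), fun h i _ => ?_⟩
      split_ifs with hi
      exacts [h i hi, Set.mem_univ _]
    rw [e5]
  simp only [e2, Finset.prod_mul_distrib, e3, e4]
  by_cases hmem : ω ∈ (fun ω n => π (X n ω)) ⁻¹' {s : ℕ → T | ∀ i < N, s i ∈ D i}
  · rw [Set.indicator_of_mem hmem, Set.indicator_of_mem (Set.mem_preimage.1 hmem)]
    simp
  · rw [Set.indicator_of_notMem (a := ω) hmem, Set.indicator_of_notMem (by exact hmem), zero_mul]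

/-- An urn sequence with Markov reinforcement that is the conditional distribution given `π` is
generated by the hierarchical model, with latent variables `π ∘ X`. -/
theorem IsUrnSequence.exists_isDPHierarchy [StandardBorelSpace E] [Nonempty E]
    [StandardBorelSpace T] [Nonempty T]
    (h : IsUrnSequence P X θ ν R) (hθ : 0 < θ)
    (hX : ∀ i, Measurable (X i)) (hex : IsExchangeable P X) (hid : ∀ i, P.map (X i) = ν)
    (hν : ν.bind R = ν) (hRR : ∀ᵐ x ∂ν, (R x).bind R = R x) (hπ : Measurable π)
    (hfib : ∀ᵐ x ∂ν, ∀ᵐ y ∂(R x), π y = π x)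
    (hcond : ∀ᵐ x ∂ν, condDistrib id π ν (π x) = R x) :
    ∃ Q : Kernel Ω T, IsDPHierarchy P X θ ν π (fun n ω => π (X n ω)) Q := by
  have := Measure.isProbabilityMeasure_map (μ := ν) hπ.aemeasurable
  have := isProbabilityMeasure_dirichletProcess hθ (ν.map π)
  have hp : ∀ n, Measurable fun ω => π (X n ω) := fun n => hπ.comp (hX n)
  obtain ⟨Q, hQ, hQp, hlaw, hlat⟩ := exists_mixing_kernel (p := fun n ω => π (X n ω)) hp
    (dirichletProcess_ae_isProbabilityMeasure hθ (ν.map π)) fun n A hA => by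
      have h1 := h.lintegral_prod_statistic hθ hX hid hπ hfib n
        (g := fun i => (A i).indicator 1) (fun i => measurable_one.indicator (hA i))
        fun i y => Set.indicator_le_self' (fun _ _ => zero_le) y
      rw [lintegral_prod_indicator (X := fun n ω => π (X n ω)) hp hA n] at h1
      simpa only [lintegral_indicator_one (hA _)] using h1
  refine ⟨Q, hQ, hp, ?_, hlat, hlaw⟩
  rw [sup_eq_right.2 (measurable_iff_comap_le.1 hQp)]
  exact h.condIndepWithLaw_statistic hθ hX hex hid hν hRR hπ hfib hcond

end Hierarchy

section Representation

/-- Every exchangeable measure-valued Pólya sequence with strictly positive reinforcement is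
generated by the hierarchical model, for a parameter map `π` into a standard Borel space. -/
theorem IsMVPS.exists_isDPHierarchy {Ω : Type u} {E : Type w} [MeasurableSpace Ω]
    [MeasurableSpace E] [StandardBorelSpace E] [Nonempty E] {P : Measure Ω}
    [IsProbabilityMeasure P] {X : ℕ → Ω → E} {θ : ℝ} {ν : Measure E} [IsProbabilityMeasure ν]
    {R : Kernel E E} (h : IsMVPS P X θ ν R) (hX : ∀ n, Measurable (X n))
    (hex : IsExchangeable P X) (hf0 : ν {x | R x Set.univ = 0} = 0) :
    ∃ (θ' : ℝ) (π : E → ULift.{v} (ℕ → ℝ)) (Q : Kernel Ω (ULift.{v} (ℕ → ℝ))),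
      0 < θ' ∧ Measurable π ∧ IsDPHierarchy P X θ' ν π (fun n ω => π (X n ω)) Q := by
  have hid : ∀ i, P.map (X i) = ν := fun i => (hex.map_eq hX i).trans h.map_zero
  obtain ⟨θ', R', hθ, hR, hurn⟩ := h.exists_markov hX hex hf0
  have hc0 : ENNReal.ofReal θ' ≠ 0 := by simpa using hθ
  have hc : ENNReal.ofReal θ' ≠ ∞ := ENNReal.ofReal_ne_top
  obtain ⟨h0, h1, -⟩ := hurn.symmetricDraws hθ (fun x => inferInstance) hX h.map_zero hex
  have hν := h0.bind_eq hc0 hc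
  have hRR : ∀ᵐ x ∂ν, (R' x).bind R' = R' x := by
    filter_upwards [h1] with x hx using h0.bind_kernel_eq hc0 hc hx
  obtain ⟨π, hπ, hRπ, hπeq⟩ := exists_statistic R'
  -- The statistic takes values in `ℕ → ℝ`; lifting it places the parameter space in a prescribed
  -- universe.
  have hπ' : Measurable fun x => (ULift.up (π x) : ULift.{v} (ℕ → ℝ)) :=
    MeasurableEquiv.ulift.symm.measurable.comp hπ
  have hfib : ∀ᵐ x ∂ν, ∀ᵐ y ∂(R' x),
      (ULift.up (π y) : ULift.{v} (ℕ → ℝ)) = ULift.up (π x) := by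
    filter_upwards [ae_ae_kernel_eq hν hRR] with x hx
    filter_upwards [hx] with y hy
    rw [hπeq y x hy]
  have hRπ' : Measurable[MeasurableSpace.comap
      (fun x => (ULift.up (π x) : ULift.{v} (ℕ → ℝ))) inferInstance] R' := by
    refine hRπ.mono ?_ le_rfl
    rw [← measurable_iff_comap_le]
    exact MeasurableEquiv.ulift.measurable.comp
      (comap_measurable fun x => (ULift.up (π x) : ULift.{v} (ℕ → ℝ)))
  have hcond := ae_condDistrib_id_eq hπ'
    (fun A B hA hB => h0.setLIntegral_kernel_swap_smul hc0 hc hA hB) hRπ' hfib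
  obtain ⟨Q, hQ⟩ := hurn.exists_isDPHierarchy hθ hX hex hid hν hRR hπ' hfib hcond
  exact ⟨θ', _, Q, hθ, hπ', hQ⟩

/-- A map to a countably generated space generates a countably generated σ-algebra, so that no null
set has to be removed. -/
theorem isCGUnder_comap {E : Type w} [MeasurableSpace E] (ν : Measure E) [IsProbabilityMeasure ν]
    {T : Type v} [MeasurableSpace T] [h : MeasurableSpace.CountablyGenerated T] (π : E → T) :
    IsCGUnder ν (MeasurableSpace.comap π inferInstance) := by
  refine ⟨Set.univ, MeasurableSet.univ, measure_univ, ?_⟩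
  rw [MeasurableSpace.comap_comp]
  exact MeasurableSpace.CountablyGenerated.comap _

end Representation
end

theorem mainTheorem1 {Ω : Type u} {E : Type w} [MeasurableSpace Ω] [MeasurableSpace E]
    [StandardBorelSpace E] [Nonempty E] (P : Measure Ω) [IsProbabilityMeasure P]
    (X : ℕ → Ω → E) (hX : ∀ n, Measurable (X n)) :
    (IsExchangeable P X ∧
      ∃ (θ : ℝ) (ν : Measure E) (R : Kernel E E),
        IsMVPS P X θ ν R ∧ ν {x | R x Set.univ = 0} = 0) ↔
    ∃ (θ : ℝ) (ν : Measure E) (_ : IsProbabilityMeasure ν)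
      (T : Type v) (_ : MeasurableSpace T) (π : E → T),
      0 < θ ∧ Measurable π ∧
      (∀ᵐ q ∂(ν.map π), MeasurableSet {q}) ∧
      IsCGUnder ν (MeasurableSpace.comap π inferInstance) ∧
      ∃ (p : ℕ → Ω → T) (Q : Kernel Ω T), IsDPHierarchy P X θ ν π p Q := by
  constructor
  · rintro ⟨hex, θ, ν, R, h, hf0⟩
    have hν := h.isProbabilityMeasure
    obtain ⟨θ', π, Q, hθ, hπ, hQ⟩ := h.exists_isDPHierarchy hX hex hf0
    exact ⟨θ', ν, hν, ULift.{v} (ℕ → ℝ), inferInstance, π, hθ, hπ,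
      Filter.Eventually.of_forall fun q => measurableSet_singleton q, isCGUnder_comap ν π,
      _, Q, hQ⟩
  · rintro ⟨θ, ν, hν, T, hT, π, hθ, hπ, -, -, p, Q, h⟩
    exact ⟨h.isExchangeable hX, θ, ν, (condDistrib id π ν).comap π hπ, h.isMVPS hθ hπ hX, by simp⟩
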